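/- **Setting.** Let $(D,\mathcal M,\mu)$ be a measure space, $p\in(1,\infty)$, $X=L^p(D,\mathcal M,\mu)$ with its pointwise a.e. order and positive cone $K_+$, and let $X^*$ be its topological dual ($\cong L^{p^*}$, $\frac1p+\frac1{p^*}=1$) with positive cone $K_+^*$ and pairing $\langle\cdot,\cdot\rangle$. Let $\mathcal A$ be a closed, densely defined operator on $X$ that generates a $C_0$-semigroup $(e^{t\mathcal A})_{t\ge0}$ of positivity-preserving bounded operators. Let $T\le\infty$ (with $[0,T]$ and $[s,T]$ read as $[0,\infty)$ and $[s,\infty)$ if $T=\infty$), let $(\Omega,\mathcal F,(\mathcal F_t)_{t\in[0,T]},\mathsf P)$ be a filtered probability space satisfying the usual conditions, $q$ a finite Borel measure on $[0,T]$, and $\mathbf y\in K_+$. *Controls.* $\mathcal S$ is the set of adapted $K_+$-valued processes $\nu$ whose paths are a.s. nondecreasing, right-continuous and of finite variation on every $[0,t]$, $t\in[0,T]$ finite; put $\nu_{0^-}=0$. Then $\mathrm d\nu=\rho\,\mathrm d|\nu|$ pathwise, where $|\nu|$ is the variation measure of $\nu$ (with $|\nu|(\{0\})=|\nu_0|_X$)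 and $\rho$ is a Bochner density, and one sets $\int_0^T\langle f^*_s,\mathrm d\nu_s\rangle:=\int_{[0,T]}\langle f^*_s,\rho_s\rangle\,\mathrm d|\nu|_s$. The state is the mild solution $$Y_t^{\mathbf y,\nu}=e^{t\mathcal A}\mathbf y+\int_{[0,t]}e^{(t-s)\mathcal A}\rho_s\,\mathrm d|\nu|_s .$$ *Criterion.* Let $\Phi^*$ be an adapted càdlàg $K_+^*$-valued process and $\mathcal C=\{\nu\in\mathcal S:\mathsf E\int_0^T\langle\Phi^*_t,\mathrm d\nu_t\rangle<\infty\}$. Let $\Pi:\Omega\times[0,T]\times K_+\to[0,\infty)$ be measurable and such that $\Pi(\cdot,\cdot,\mathbf k)$ is progressively measurable for each $\mathbf k\in K_+$ and, for each $(\omega,t)$, $\Pi(\omega,t,\cdot)$ is concave and nondecreasing on $K_+$ and of class $C^1$ on $S_{\mathbf y}(t)=\{\mathbf k\in K_+:\mathbf k\ge e^{t\mathcal A}\mathbf y\}$, with gradient $\nabla\Pi(t,\cdot)\in X^*$ (the derivative relative to $S_{\mathbf y}(t)$). Put $$\mathcal J(\mathbf y,\nu)=\mathsf E\Big[\int_0^T\Pi(t,Y_t^{\mathbf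 y,\nu})\,q(\mathrm dt)-\int_0^T\langle\Phi^*_t,\mathrm d\nu_t\rangle\Big],\qquad \nu\in\mathcal C,$$ and assume $\mathcal J(\mathbf y,\nu)<\infty$ for every $\nu\in\mathcal C$. A control $\nu^\star\in\mathcal C$ is optimal if $\mathcal J(\mathbf y,\nu^\star)=\sup_{\nu\in\mathcal C}\mathcal J(\mathbf y,\nu)$. *Conditional expectation.* For $\nu^\star\in\mathcal C$ let $$G_s=\int_{[s,T]}e^{(t-s)\mathcal A^*}\nabla\Pi(t,Y_t^{\mathbf y,\nu^\star})\,q(\mathrm dt),$$ taken weakly: $\langle G_s,v\rangle=\int_{[s,T]}\langle e^{(t-s)\mathcal A^*}\nabla\Pi(t,Y_t^{\mathbf y,\nu^\star}),v\rangle\,q(\mathrm dt)\in[0,\infty]$ for $v\in K_+$. The process $s\mapsto\mathsf E[G_s\mid\mathcal F_s]$ denotes any $K^*_+$-valued strongly progressively measurable process $\Gamma$ such that $\langle\Gamma_\tau,v\rangle=\mathsf E[\langle G_\tau,v\rangle\mid\mathcal F_\tau]$ a.s. for every finite stopping time $\tau$ and every $v\in K_+$ (a version of the optional projection of $G$). **Theorem.**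 Let $\nu^\star\in\mathcal C$ and let $s\mapsto\mathsf E[G_s\mid\mathcal F_s]$ be such an $X^*$-valued process for $\nu^\star$. Then $\nu^\star$ is optimal if and only if both of the following hold: (i) for every $\nu\in\mathcal C$, $$\mathsf E\Big[\int_0^T\Big\langle\mathsf E\Big[\int_{[s,T]}e^{(t-s)\mathcal A^*}\nabla\Pi(t,Y_t^{\mathbf y,\nu^\star})\,q(\mathrm dt)\,\Big|\,\mathcal F_s\Big]-\Phi^*_s,\ \mathrm d\nu_s\Big\rangle\Big]\le0;$$ (ii) $$\mathsf E\Big[\int_0^T\Big\langle\mathsf E\Big[\int_{[s,T]}e^{(t-s)\mathcal A^*}\nabla\Pi(t,Y_t^{\mathbf y,\nu^\star})\,q(\mathrm dt)\,\Big|\,\mathcal F_s\Big]-\Phi^*_s,\ \mathrm d\nu^\star_s\Big\rangle\Big]=0.$$ Expectations and integrals of functions of variable sign are extended-real valued (positive part minus negative part). -/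

import Mathlib

open MeasureTheory Filter Topology Set
open scoped NNReal ENNReal

noncomputable section

namespace SingularControl

/-- The time set `[0, T]`, read as `[0, ∞)` when `T = ∞`. -/
abbrev Horizon (T : ℝ≥0∞) : Type := {t : ℝ≥0 // (t : ℝ≥0∞) ≤ T}

/-- The initial time. -/
def Horizon.zero (T : ℝ≥0∞) : Horizon T := ⟨0, by simp⟩

/-- The integral of an extended-real function: the integral of the positive part minus the integral
of the negative part. It is the usual value as soon as one of the two is finite. -/
def extIntegral {α : Type*} [MeasurableSpace α] (m : Measure α) (h : α → EReal) : EReal :=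
  ((∫⁻ a, (h a).toENNReal ∂m : ℝ≥0∞) : EReal) - ((∫⁻ a, (-h a).toENNReal ∂m : ℝ≥0∞) : EReal)

section Path

variable {T : ℝ≥0∞} {E : Type*} [NormedAddCommGroup E] [NormedSpace ℝ E]

/-- `m` is the variation measure `|f|` of the path `f` (with the convention `f 0- = 0`, so that there
is an atom of mass `‖f 0‖` at time `0`) and `ρ` is a Bochner density of the vector measure `df` with
respect to it: `df = ρ d|f|`. -/
structure IsPolar (f : Horizon T → E) (m : Measure (Horizon T)) (ρ : Horizon T → E) : Prop where
  mass : ∀ t, m (Iic t) = ‖f (Horizon.zero T)‖ₑ + eVariationOn f (Iic t)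
  stronglyMeasurable : StronglyMeasurable ρ
  integrableOn : ∀ t, IntegrableOn ρ (Iic t) m
  density : ∀ t, f t = ∫ s in Iic t, ρ s ∂m

open Classical in
/-- The pair `(|f|, ρ)` with `df = ρ d|f|`. The measure is unique and `ρ` is unique up to
`|f|`-null sets when `f` has finite variation on each `[0, t]`. -/
def polar (f : Horizon T → E) : Measure (Horizon T) × (Horizon T → E) :=
  if h : ∃ z : Measure (Horizon T) × (Horizon T → E), IsPolar f z.1 z.2 then h.choose else (0, 0)

/-- The variation measure `|f|`. -/
def variationMeasure (f : Horizon T → E) : Measure (Horizon T) := (polar f).1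

/-- The density `ρ` in `df = ρ d|f|`. -/
def polarDensity (f : Horizon T → E) : Horizon T → E := (polar f).2

/-- The integral `∫_{[0,T]} ⟨g_s, df_s⟩ = ∫_{[0,T]} ⟨g_s, ρ_s⟩ d|f|_s`. -/
def dualIntegral (g : Horizon T → StrongDual ℝ E) (f : Horizon T → E) : EReal :=
  extIntegral (variationMeasure f) fun s => ((g s (polarDensity f s) : ℝ) : EReal)

/-- The mild solution `Y_t = e^{tA} y + ∫_{[0,t]} e^{(t-s)A} df_s` driven by the path `f`, where
`S t = e^{tA}`. -/
def mildPath (S : ℝ≥0 → E →L[ℝ] E) (y : E) (f : Horizon T → E) (t : Horizon T) : E :=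
  S t.1 y + ∫ s in Iic t, S (t.1 - s.1) (polarDensity f s) ∂(variationMeasure f)

end Path

section Model

variable {T : ℝ≥0∞} {Ω : Type*} [mΩ : MeasurableSpace Ω]
  {E : Type*} [NormedAddCommGroup E] [NormedSpace ℝ E] [PartialOrder E]

/-- The closed, densely defined operator `A` generates the `C₀`-semigroup `S`, whose operators are
positivity-preserving. -/
structure GeneratesPositiveSemigroup (A : E →ₗ.[ℝ] E) (S : ℝ≥0 → E →L[ℝ] E) : Prop where
  isClosed : A.IsClosed
  dense_domain : Dense (A.domain : Set E)
  map_zero : S 0 = ContinuousLinearMap.id ℝ E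
  map_add : ∀ s t, S (s + t) = (S s).comp (S t)
  continuous : ∀ x, Continuous fun t => S t x
  generator : ∀ x z, (x, z) ∈ A.graph ↔
    Tendsto (fun h : ℝ≥0 => (h : ℝ)⁻¹ • (S h x - x)) (𝓝[>] 0) (𝓝 z)
  nonneg : ∀ t x, 0 ≤ x → 0 ≤ S t x

/-- The usual conditions: the filtration is right-continuous and the initial σ-algebra contains every
`P`-negligible set. -/
structure UsualConditions (P : Measure Ω) (𝓕 : Filtration (Horizon T) mΩ) : Prop where
  rightContinuous : 𝓕.IsRightContinuous
  complete : ∀ N : Set Ω, P N = 0 → MeasurableSet[𝓕 (Horizon.zero T)] N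

/-- The set `𝒮` of monotone controls: adapted processes with values in the positive cone whose paths
are almost surely nondecreasing, right-continuous, and of finite variation on each `[0, t]`. -/
structure IsControl (P : Measure Ω) (𝓕 : Filtration (Horizon T) mΩ) (ν : Horizon T → Ω → E) :
    Prop where
  adapted : StronglyAdapted 𝓕 ν
  nonneg : ∀ᵐ ω ∂P, ∀ t, 0 ≤ ν t ω
  monotone : ∀ᵐ ω ∂P, Monotone fun t => ν t ω
  rightContinuous : ∀ᵐ ω ∂P, ∀ t, ContinuousWithinAt (fun s => ν s ω) (Ici t) t
  finiteVariation : ∀ᵐ ω ∂P, ∀ t, eVariationOn (fun s => ν s ω) (Iic t) ≠ ∞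

/-- The marginal cost: an adapted càdlàg process with values in the positive cone of the dual. -/
structure IsMarginalCost (P : Measure Ω) (𝓕 : Filtration (Horizon T) mΩ)
    (Φ : Horizon T → Ω → StrongDual ℝ E) : Prop where
  adapted : StronglyAdapted 𝓕 Φ
  nonneg : ∀ᵐ ω ∂P, ∀ t v, 0 ≤ v → 0 ≤ Φ t ω v
  rightContinuous : ∀ᵐ ω ∂P, ∀ t, ContinuousWithinAt (fun s => Φ s ω) (Ici t) t
  leftLimits : ∀ᵐ ω ∂P, ∀ t, ∃ l, Tendsto (fun s => Φ s ω) (𝓝[<] t) (𝓝 l)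

/-- The set `S_y(t)` of all `k` in the positive cone with `e^{tA} y ≤ k`. -/
def reachable (S : ℝ≥0 → E →L[ℝ] E) (y : E) (t : Horizon T) : Set E := {k | 0 ≤ k ∧ S t.1 y ≤ k}

/-- The requirements on the random running profit. Only its values on the positive cone matter. -/
structure IsRunningProfit (𝓕 : Filtration (Horizon T) mΩ) (S : ℝ≥0 → E →L[ℝ] E) (y : E)
    (Pi : Ω → Horizon T → E → ℝ) : Prop where
  nonneg : ∀ ω t k, 0 ≤ k → 0 ≤ Pi ω t k
  measurable : letI : MeasurableSpace E := borel E
    Measurable fun z : Ω × Horizon T × {k : E // 0 ≤ k} => Pi z.1 z.2.1 z.2.2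
  progressive : ∀ k, 0 ≤ k → IsProgressive 𝓕 fun t ω => Pi ω t k
  concave : ∀ ω t, ConcaveOn ℝ {k | 0 ≤ k} (Pi ω t)
  monotone : ∀ ω t, MonotoneOn (Pi ω t) {k | 0 ≤ k}
  contDiffOn : ∀ ω t, ContDiffOn ℝ 1 (Pi ω t) (reachable S y t)

/-- The gradient of the running profit in its last argument, an element of the dual. It is the Fréchet
derivative relative to `S_y(t)`; this derivative is unique, because `S_y(t)` contains `k + v` for each
of its points `k` and each `v ≥ 0`. -/
def profitGradient (S : ℝ≥0 → E →L[ℝ] E) (y : E) (Pi : Ω → Horizon T → E → ℝ) (ω : Ω)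
    (t : Horizon T) (k : E) : StrongDual ℝ E :=
  fderivWithin ℝ (Pi ω t) (reachable S y t) k

/-- The set `𝒞` of admissible controls. -/
def admissible (P : Measure Ω) (𝓕 : Filtration (Horizon T) mΩ)
    (Φ : Horizon T → Ω → StrongDual ℝ E) : Set (Horizon T → Ω → E) :=
  {ν | IsControl P 𝓕 ν ∧ extIntegral P (fun ω => dualIntegral (fun s => Φ s ω) fun s => ν s ω) < ⊤}

/-- The performance criterion `J(y, ν) = E[∫ Π(t, Y_t) q(dt) - ∫ ⟨Φ_t, dν_t⟩]`. -/
def payoff (P : Measure Ω) (S : ℝ≥0 → E →L[ℝ] E) (y : E) (q : Measure (Horizon T))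
    (Pi : Ω → Horizon T → E → ℝ) (Φ : Horizon T → Ω → StrongDual ℝ E) (ν : Horizon T → Ω → E) :
    EReal :=
  extIntegral P fun ω =>
    ((∫⁻ t, ENNReal.ofReal (Pi ω t (mildPath S y (fun s => ν s ω) t)) ∂q : ℝ≥0∞) : EReal)
      - dualIntegral (fun s => Φ s ω) fun s => ν s ω

/-- `ν` is optimal: it attains the supremum of the performance criterion over `𝒞`. -/
def IsOptimal (P : Measure Ω) (𝓕 : Filtration (Horizon T) mΩ) (S : ℝ≥0 → E →L[ℝ] E) (y : E)
    (q : Measure (Horizon T)) (Pi : Ω → Horizon T → E → ℝ)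
    (Φ : Horizon T → Ω → StrongDual ℝ E) (ν : Horizon T → Ω → E) : Prop :=
  ν ∈ admissible P 𝓕 Φ ∧ payoff P S y q Pi Φ ν = ⨆ ν' ∈ admissible P 𝓕 Φ, payoff P S y q Pi Φ ν'

/-- The pairing with `v ≥ 0` of the `X*`-valued integral
`∫_{[s,T]} e^{(t-s)A*} ∇Π(t, Y_t) q(dt)`. As the integrand is a positive functional, the pairing is
always a well defined element of `[0, ∞]`, and for `v ≥ 0` these numbers determine the integral. -/
def futureGradient (S : ℝ≥0 → E →L[ℝ] E) (y : E) (q : Measure (Horizon T))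
    (Pi : Ω → Horizon T → E → ℝ) (ν : Horizon T → Ω → E) (s : Horizon T) (ω : Ω) (v : E) : ℝ≥0∞ :=
  ∫⁻ t in Ici s, ENNReal.ofReal
    (((profitGradient S y Pi ω t (mildPath S y (fun r => ν r ω) t)).comp (S (t.1 - s.1))) v) ∂q

/-- `Γ` is (a version of) the process `s ↦ E[G_s | 𝓕_s]` of conditional expectations of a process `G`
with values in the positive cone of the dual, given through its pairings `G s ω v` with `v ≥ 0`.
As usual for conditional expectations that are integrated against a random measure in time, the
process is the one which is determined along stopping times (the optional projection):
`Γ_τ = E[G_τ | 𝓕_τ]` for each finite stopping time `τ`; conditional expectations in the dual are taken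
weakly, which agrees with the Bochner conditional expectation when the latter exists. -/
structure IsConditionalExpectation (P : Measure Ω) (𝓕 : Filtration (Horizon T) mΩ)
    (G : Horizon T → Ω → E → ℝ≥0∞) (Γ : Horizon T → Ω → StrongDual ℝ E) : Prop where
  progressive : IsStronglyProgressive 𝓕 Γ
  nonneg : ∀ᵐ ω ∂P, ∀ s v, 0 ≤ v → 0 ≤ Γ s ω v
  condExp : ∀ (τ : Ω → Horizon T)
    (hτ : IsStoppingTime 𝓕 (fun ω => (τ ω : WithTop (Horizon T)))) (v : E), 0 ≤ v →
      (fun ω => ENNReal.ofReal (Γ (τ ω) ω v))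
        =ᵐ[P] condLExp hτ.measurableSpace P (fun ω => G (τ ω) ω v)

end Model

end SingularControl

end

/-!
Why the first-order conditions characterize optimal controls.

Write `a(ν)` for the expected running profit, `b(ν)` for the expected cost and `g(ν)` for the expected
first-order gain at `ν⋆` in the direction `ν`, that is, for the expectation of
`∫ ⟨∇Π(t, Y_t), ∫_{[0,t]} e^{(t-s)A} dν_s⟩ q(dt)` with the state `Y` of `ν⋆`. All three are elements of
`[0, ∞]`; the costs and `a(ν⋆)` are finite. The two conditions of the theorem say that `g(ν) ≤ b(ν)` for
all admissible `ν`, and that `g(ν⋆) = b(ν⋆)`. They are sufficient, as concavity of the running profit gives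
`a(ν) + g(ν⋆) ≤ a(ν⋆) + g(ν)` (`expectedProfit_add_le`). They are necessary because the set of controls
is a convex cone: the perturbation `ν⋆ + ν / (n + 1)` and Fatou's lemma give `g(ν) ≤ b(ν)`
(`marginalGain_le_expectedCost`), and the perturbation `(1 - 1 / (n + 1)) ν⋆` and dominated convergence
give `b(ν⋆) ≤ g(ν⋆)` (`expectedCost_le_marginalGain_self`). Here the state is affine and the cost is
additive in the control, although its polar decomposition is not (`exists_common_density`).

What remains is the identity `E ∫ ⟨Γ_s, dν_s⟩ = g(ν)` (`lintegral_pairing_eq_marginalGain`) for the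
conditional expectation `Γ_s = E[G_s | 𝓕_s]` of the future gradient `G`. By Tonelli's theorem `g(ν)` is
`E ∫ ⟨G_s, dν_s⟩`, and the passage from `G` to `Γ` rests on three facts.

* A path of finite variation with values in `L^p` has a Bochner density with respect to its variation
  (`IsPath.exists_isPolar`). The space is uniformly convex in a quantitative form
  (`midpointConvexityGap_Lp`); therefore the averages of the vector measure over a refining sequence of
  finite partitions are Cauchy in `L¹`, and their limit is the density (`exists_density_of_le_measure`).
* The density of a control may be chosen nonnegative and progressively measurable. By the Besicovitch
  differentiation theorem it is a limit of difference quotients (`ae_tendsto_quotient`), which look only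
  infinitesimally into the future, and the filtration is right-continuous
  (`IsRegularControl.stronglyProgressive_densityProcess`).
* The hitting times `τ_u` of the levels `u` by the variation process are stopping times, and integrals
  against the variation are Lebesgue integrals along `τ_u` (`map_hitting`). So the defining property
  `Γ_τ = E[G_τ | 𝓕_τ]` may be integrated over `u`, after it has been extended from fixed vectors to
  `𝓕_τ`-measurable ones (`setLIntegral_condExp_apply`,
  `IsConditionalExpectation.lintegral_lintegral_eq`).

Path properties that hold almost surely are made to hold everywhere by a modification on a null event,
which the usual conditions permit (`IsControl.exists_regular`).
-/

set_option linter.unusedSectionVars false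

noncomputable section

namespace SingularControl

/-! ### Radon–Nikodym densities in uniformly convex spaces -/

section Density

open MeasurableSpace

/-- Quantitative form of the uniform convexity of a normed space, in terms of the convex function
`‖·‖ ^ p`: the distance of two points is controlled by the gap in the midpoint inequality. -/
def MidpointConvexityGap (E : Type*) [NormedAddCommGroup E] [NormedSpace ℝ E] (p : ℝ) : Prop :=
  ∀ ε : ℝ, 0 < ε → ∃ C : ℝ, 0 ≤ C ∧ ∀ a b : E, ‖b - a‖ ^ p ≤ ε * (‖a‖ ^ p + ‖b‖ ^ p) +
    C * ((‖a‖ ^ p + ‖b‖ ^ p) / 2 - ‖(2⁻¹ : ℝ) • (a + b)‖ ^ p)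

variable {α : Type*} [mα : MeasurableSpace α] [CountablyGenerated α]
  {E : Type*} [NormedAddCommGroup E] [NormedSpace ℝ E]

/-- The average of the vector measure `F` with respect to `m` over the cells of the `n`-th finite
partition of a fixed generating sequence of partitions. -/
def cellAverage (m : Measure α) (F : VectorMeasure α E) (n : ℕ) (x : α) : E :=
  (m.real (countablePartitionSet n x))⁻¹ • F (countablePartitionSet n x)

variable {m : Measure α} {F : VectorMeasure α E}

lemma cellAverage_of_mem {n : ℕ} {A : Set α} (hA : A ∈ countablePartition α n) {x : α}
    (hx : x ∈ A) : cellAverage m F n x = (m.real A)⁻¹ • F A := by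
  rw [cellAverage, countablePartitionSet_of_mem hA hx]

lemma stronglyMeasurable_cellAverage (n : ℕ) :
    StronglyMeasurable[generateFrom (countablePartition α n)] (cellAverage m F n) := by
  classical
  have h : cellAverage m F n = fun x => ∑ A ∈ (finite_countablePartition α n).toFinset,
      A.indicator (fun _ => (m.real A)⁻¹ • F A) x := by
    funext x
    rw [Finset.sum_eq_single (countablePartitionSet n x)]
    · rw [indicator_of_mem (mem_countablePartitionSet n x), cellAverage]
    · intro A hA hne
      refine indicator_of_notMem (fun hx => hne ?_) _
      exact (countablePartitionSet_of_mem ((finite_countablePartition α n).mem_toFinset.1 hA)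
        hx).symm
    · intro hx
      exact absurd ((finite_countablePartition α n).mem_toFinset.2
        (countablePartitionSet_mem n x)) hx
  rw [h]
  refine Finset.stronglyMeasurable_fun_sum _ fun A hA => ?_
  exact stronglyMeasurable_const.indicator
    (measurableSet_generateFrom ((finite_countablePartition α n).mem_toFinset.1 hA))

lemma stronglyMeasurable_cellAverage' (n : ℕ) : StronglyMeasurable (cellAverage m F n) :=
  (stronglyMeasurable_cellAverage n).mono (generateFrom_countablePartition_le α n)

variable [IsFiniteMeasure m]

lemma norm_le_real_of_enorm_le (hF : ∀ A, ‖F A‖ₑ ≤ m A) (A : Set α) : ‖F A‖ ≤ m.real A := by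
  have := ENNReal.toReal_mono (measure_ne_top m A) (hF A)
  simpa [Measure.real] using this

lemma norm_cellAverage_le (hF : ∀ A, ‖F A‖ₑ ≤ m A) (n : ℕ) (x : α) :
    ‖cellAverage m F n x‖ ≤ 1 := by
  rw [cellAverage, norm_smul, norm_inv, Real.norm_of_nonneg measureReal_nonneg]
  exact inv_mul_le_one_of_le₀ (norm_le_real_of_enorm_le hF _) measureReal_nonneg

lemma integrable_cellAverage (hF : ∀ A, ‖F A‖ₑ ≤ m A) (n : ℕ) :
    Integrable (cellAverage m F n) m :=
  Integrable.of_bound (stronglyMeasurable_cellAverage' n).aestronglyMeasurable 1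
    (ae_of_all _ (norm_cellAverage_le hF n))

variable [CompleteSpace E]

lemma setIntegral_cellAverage (hF : ∀ A, ‖F A‖ₑ ≤ m A) (n : ℕ) {B : Set α}
    (hB : MeasurableSet[generateFrom (countablePartition α n)] B) :
    ∫ x in B, cellAverage m F n x ∂m = F B := by
  classical
  obtain ⟨s, hs, rfl⟩ := (measurableSet_generateFrom_countablePartition_iff n B).1 hB
  have hmeas : ∀ A ∈ s, MeasurableSet A := fun A hA => measurableSet_countablePartition n (hs hA)
  have hdisj : (s : Set (Set α)).PairwiseDisjoint id := fun A hA B hB hne =>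
    disjoint_countablePartition (hs hA) (hs hB) hne
  have hU : ⋃₀ (s : Set (Set α)) = ⋃ A ∈ s, id A := by simp [sUnion_eq_biUnion]
  rw [hU, integral_biUnion_finset (s := id) s hmeas hdisj
    fun A _ => (integrable_cellAverage hF n).integrableOn,
    VectorMeasure.of_biUnion_finset (f := id) hdisj hmeas]
  refine Finset.sum_congr rfl fun A hA => ?_
  rw [id, setIntegral_congr_fun (g := fun _ => (m.real A)⁻¹ • F A) (hmeas A hA)
    fun x hx => cellAverage_of_mem (hs hA) hx, setIntegral_const]
  by_cases h0 : m.real A = 0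
  · have : ‖F A‖ ≤ 0 := h0 ▸ norm_le_real_of_enorm_le hF A
    simp [h0, norm_le_zero_iff.1 this]
  · rw [smul_smul, mul_inv_cancel₀ h0, one_smul]

/-- Conditional Jensen: averaging over coarser cells decreases the integral of a convex function. -/
lemma integral_norm_rpow_cellAverage_le (hF : ∀ A, ‖F A‖ₑ ≤ m A) {p : ℝ} (hp : 1 ≤ p) (n : ℕ)
    {g : α → E} (hg : Integrable g m) (hgp : Integrable (fun x => ‖g x‖ ^ p) m)
    (hset : ∀ B, MeasurableSet[generateFrom (countablePartition α n)] B →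
      ∫ x in B, g x ∂m = F B) :
    ∫ x, ‖cellAverage m F n x‖ ^ p ∂m ≤ ∫ x, ‖g x‖ ^ p ∂m := by
  have hle := generateFrom_countablePartition_le α n
  have hce : cellAverage m F n =ᵐ[m] m[g | generateFrom (countablePartition α n)] := by
    refine ae_eq_condExp_of_forall_setIntegral_eq hle hg
      (fun _ _ _ => (integrable_cellAverage hF n).integrableOn) (fun B hB _ => ?_)
      (stronglyMeasurable_cellAverage n).aestronglyMeasurable
    rw [setIntegral_cellAverage hF n hB, hset B hB]
  have hconv : ConvexOn ℝ univ fun x : E => ‖x‖ ^ p := by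
    refine ⟨convex_univ, fun x _ y _ a b ha hb hab => ?_⟩
    refine (Real.rpow_le_rpow (norm_nonneg _) (norm_add_le _ _) (by linarith)).trans ?_
    rw [norm_smul, norm_smul, Real.norm_of_nonneg ha, Real.norm_of_nonneg hb]
    exact (convexOn_rpow hp).2 (norm_nonneg x) (norm_nonneg y) ha hb hab
  have hcont : Continuous fun x : E => ‖x‖ ^ p :=
    continuous_norm.rpow_const fun _ => Or.inr (by linarith)
  have hJ := hconv.map_condExp_le_univ hle hcont.lowerSemicontinuous hg hgp
  calc ∫ x, ‖cellAverage m F n x‖ ^ p ∂m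
      ≤ ∫ x, (m[(fun x => ‖x‖ ^ p) ∘ g | generateFrom (countablePartition α n)]) x ∂m := by
        refine integral_mono_ae ?_ integrable_condExp ?_
        · refine Integrable.of_bound (hcont.comp_stronglyMeasurable
            (stronglyMeasurable_cellAverage' n)).aestronglyMeasurable 1 (ae_of_all _ fun x => ?_)
          rw [Real.norm_of_nonneg (by positivity)]
          exact Real.rpow_le_one (norm_nonneg _) (norm_cellAverage_le hF n x) (by linarith)
        · filter_upwards [hce, hJ] with x h1 h2
          rw [h1]
          exact h2
    _ = ∫ x, ‖g x‖ ^ p ∂m := by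
        rw [integral_condExp hle]
        rfl

lemma integrable_norm_rpow_of_bounded {p : ℝ} (hp : 0 ≤ p) {g : α → E} (hg : StronglyMeasurable g)
    {c : ℝ} (hb : ∀ x, ‖g x‖ ≤ c) : Integrable (fun x => ‖g x‖ ^ p) m := by
  refine Integrable.of_bound ((continuous_norm.rpow_const fun _ => Or.inr hp).comp_stronglyMeasurable
    hg).aestronglyMeasurable (c ^ p) (ae_of_all _ fun x => ?_)
  rw [Real.norm_of_nonneg (by positivity)]
  exact Real.rpow_le_rpow (norm_nonneg _) (hb x) hp

lemma setIntegral_cellAverage_of_le (hF : ∀ A, ‖F A‖ₑ ≤ m A) {n k : ℕ} (hnk : n ≤ k) {B : Set α}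
    (hB : MeasurableSet[generateFrom (countablePartition α n)] B) :
    ∫ x in B, cellAverage m F k x ∂m = F B := by
  refine setIntegral_cellAverage hF k ?_
  have := monotone_nat_of_le_succ
    (f := fun n => generateFrom (countablePartition α n))
    (generateFrom_countablePartition_le_succ α) hnk
  exact this _ hB

lemma tendsto_integral_norm_cellAverage (hF : ∀ A, ‖F A‖ₑ ≤ m A) {p : ℝ} (hp : 1 < p) :
    ∃ l, Tendsto (fun n => ∫ x, ‖cellAverage m F n x‖ ^ p ∂m) atTop (𝓝 l) := by
  have hint : ∀ n, Integrable (fun x => ‖cellAverage m F n x‖ ^ p) m := fun n =>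
    integrable_norm_rpow_of_bounded (by linarith) (stronglyMeasurable_cellAverage' n)
      (norm_cellAverage_le hF n)
  refine ⟨_, tendsto_atTop_ciSup (fun n k hnk => ?_) ⟨m.real univ, ?_⟩⟩
  · exact integral_norm_rpow_cellAverage_le hF hp.le n (integrable_cellAverage hF k) (hint k)
      fun B hB => setIntegral_cellAverage_of_le hF hnk hB
  · rintro _ ⟨n, rfl⟩
    calc ∫ x, ‖cellAverage m F n x‖ ^ p ∂m ≤ ∫ _, (1 : ℝ) ∂m :=
          integral_mono (hint n) (integrable_const _) fun x =>
            Real.rpow_le_one (norm_nonneg _) (norm_cellAverage_le hF n x) (by linarith)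
      _ = m.real univ := by simp

/-- Passing from the `n`-th to the `k`-th partition, the midpoint gap is integrated. Averaging the midpoint
of the two approximations over the cells of the coarser partition returns the coarser approximation,
so that by Jensen's inequality the gap is at most half of the increment of the integrals. -/
lemma integral_norm_sub_rpow_cellAverage_le (hF : ∀ A, ‖F A‖ₑ ≤ m A) {p : ℝ} (hp : 1 < p)
    {ε C : ℝ} (hε : 0 < ε) (hC : 0 ≤ C)
    (h : ∀ a b : E, ‖b - a‖ ^ p ≤ ε * (‖a‖ ^ p + ‖b‖ ^ p) +
      C * ((‖a‖ ^ p + ‖b‖ ^ p) / 2 - ‖(2⁻¹ : ℝ) • (a + b)‖ ^ p)) {n k : ℕ} (hnk : n ≤ k) :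
    ∫ x, ‖cellAverage m F k x - cellAverage m F n x‖ ^ p ∂m ≤ ε * (2 * m.real univ) +
      C * (∫ x, ‖cellAverage m F k x‖ ^ p ∂m - ∫ x, ‖cellAverage m F n x‖ ^ p ∂m) / 2 := by
  have hp0 : 0 ≤ p := by linarith
  have hint : ∀ n, Integrable (fun x => ‖cellAverage m F n x‖ ^ p) m := fun n =>
    integrable_norm_rpow_of_bounded hp0 (stronglyMeasurable_cellAverage' n)
      (norm_cellAverage_le hF n)
  have hbd : ∀ n, ∫ x, ‖cellAverage m F n x‖ ^ p ∂m ≤ m.real univ := fun n => by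
    calc ∫ x, ‖cellAverage m F n x‖ ^ p ∂m ≤ ∫ _, (1 : ℝ) ∂m :=
          integral_mono (hint n) (integrable_const _) fun x =>
            Real.rpow_le_one (norm_nonneg _) (norm_cellAverage_le hF n x) (by linarith)
      _ = m.real univ := by simp
  set g : α → E := fun x => (2⁻¹ : ℝ) • (cellAverage m F n x + cellAverage m F k x) with hgdef
  have hgs : StronglyMeasurable g :=
    ((stronglyMeasurable_cellAverage' n).add (stronglyMeasurable_cellAverage' k)).const_smul _
  have hgb : ∀ x, ‖g x‖ ≤ 1 := fun x => by
    rw [hgdef, norm_smul, Real.norm_of_nonneg (by norm_num)]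
    linarith [norm_add_le (cellAverage m F n x) (cellAverage m F k x),
      norm_cellAverage_le hF n x, norm_cellAverage_le hF k x]
  have hgp := integrable_norm_rpow_of_bounded (m := m) hp0 hgs hgb
  have hkey : ∫ x, ‖cellAverage m F n x‖ ^ p ∂m ≤ ∫ x, ‖g x‖ ^ p ∂m := by
    refine integral_norm_rpow_cellAverage_le hF hp.le n
      (((integrable_cellAverage hF n).add (integrable_cellAverage hF k)).smul _) hgp fun B hB => ?_
    simp only [hgdef]
    rw [integral_smul, integral_add (integrable_cellAverage hF n).integrableOn
      (integrable_cellAverage hF k).integrableOn, setIntegral_cellAverage hF n hB,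
      setIntegral_cellAverage_of_le hF hnk hB, ← two_smul ℝ, smul_smul]
    norm_num
  have hsub : Integrable (fun x => ‖cellAverage m F k x - cellAverage m F n x‖ ^ p) m :=
    integrable_norm_rpow_of_bounded hp0
      ((stronglyMeasurable_cellAverage' k).sub (stronglyMeasurable_cellAverage' n))
      (c := 2) fun x => by
        linarith [norm_sub_le (cellAverage m F k x) (cellAverage m F n x),
          norm_cellAverage_le hF n x, norm_cellAverage_le hF k x]
  have hsum : Integrable (fun x => ‖cellAverage m F n x‖ ^ p + ‖cellAverage m F k x‖ ^ p) m :=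
    (hint n).add (hint k)
  have hgap : Integrable (fun x => (‖cellAverage m F n x‖ ^ p + ‖cellAverage m F k x‖ ^ p) / 2 -
      ‖g x‖ ^ p) m := (hsum.div_const 2).sub hgp
  have h1 := integral_mono hsub ((hsum.const_mul ε).add (hgap.const_mul C))
    fun x => h (cellAverage m F n x) (cellAverage m F k x)
  simp only [Pi.add_apply] at h1
  rw [integral_add (hsum.const_mul ε) (hgap.const_mul C), integral_const_mul,
    integral_const_mul, integral_sub (hsum.div_const 2) hgp, integral_div,
    integral_add (hint n) (hint k)] at h1
  have h2 := hbd n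
  have h3 := hbd k
  nlinarith [mul_nonneg hC (sub_nonneg.2 hkey)]

/-- The cell averages converge in `L¹`: the integrals of `‖·‖ ^ p` increase along the partitions and
are bounded, so the midpoint gaps, and with them the distances, become small. -/
lemma cauchySeq_cellAverage (hF : ∀ A, ‖F A‖ₑ ≤ m A) {p : ℝ} (hp : 1 < p)
    (hE : MidpointConvexityGap E p) :
    CauchySeq fun n => (integrable_cellAverage hF n).toL1 (cellAverage m F n) := by
  obtain ⟨l, hl⟩ := tendsto_integral_norm_cellAverage hF hp
  rw [Metric.cauchySeq_iff']
  intro η hη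
  set M := m.real univ with hM
  have hM0 : 0 ≤ M := measureReal_nonneg
  -- as `‖x‖ ≤ δ + δ ^ (1 - p) * ‖x‖ ^ p`, it suffices that the `p`-th powers have small integrals;
  -- the budget `η` is split between `δ`, the error `ε` of the convexity gap, and the increment `θ`
  obtain ⟨δ, hδ, hδM⟩ : ∃ δ : ℝ, 0 < δ ∧ δ * M < η / 3 :=
    ⟨η / 3 / (M + 1), by positivity, by
      rw [div_mul_eq_mul_div, div_lt_iff₀ (by positivity)]
      nlinarith⟩
  set K := δ ^ (1 - p) with hK
  have hK0 : 0 < K := Real.rpow_pos_of_pos hδ _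
  obtain ⟨ε, hε, hεM⟩ : ∃ ε : ℝ, 0 < ε ∧ K * (ε * (2 * M)) < η / 3 :=
    ⟨η / 3 / (K * (2 * M) + 1), by positivity, by
      rw [show K * (η / 3 / (K * (2 * M) + 1) * (2 * M)) =
        (η / 3) * (K * (2 * M)) / (K * (2 * M) + 1) by ring, div_lt_iff₀ (by positivity)]
      nlinarith [show 0 ≤ K * (2 * M) by positivity]⟩
  obtain ⟨C, hC, hCE⟩ := hE ε hε
  obtain ⟨θ, hθ, hθM⟩ : ∃ θ : ℝ, 0 < θ ∧ K * (C * θ / 2) < η / 3 :=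
    ⟨η / 3 / (K * C + 1), by positivity, by
      rw [show K * (C * (η / 3 / (K * C + 1)) / 2) =
        (η / 3) * (K * C / 2) / (K * C + 1) by ring, div_lt_iff₀ (by positivity)]
      nlinarith [show 0 ≤ K * C by positivity]⟩
  obtain ⟨N, hN⟩ := Metric.cauchySeq_iff'.1 hl.cauchySeq θ hθ
  refine ⟨N, fun k hk => ?_⟩
  have hk' := hN k hk
  rw [Real.dist_eq] at hk'
  have hk'' := (abs_lt.1 hk').2
  have hsub := integral_norm_sub_rpow_cellAverage_le hF hp hε hC hCE hk
  have hpt : ∀ x : E, ‖x‖ ≤ δ + K * ‖x‖ ^ p := fun x => by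
    rcases le_or_gt ‖x‖ δ with h | h
    · have : 0 ≤ K * ‖x‖ ^ p := by positivity
      linarith
    · have hx : 0 < ‖x‖ := hδ.trans h
      have h1 : ‖x‖ ^ (1 - p) ≤ K :=
        Real.rpow_le_rpow_of_nonpos hδ h.le (by linarith)
      have h2 : ‖x‖ = ‖x‖ ^ (1 - p) * ‖x‖ ^ p := by
        rw [← Real.rpow_add hx]
        simp
      have h3 : ‖x‖ ^ (1 - p) * ‖x‖ ^ p ≤ K * ‖x‖ ^ p :=
        mul_le_mul_of_nonneg_right h1 (by positivity)
      linarith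
  have hint : Integrable (fun x => ‖cellAverage m F k x - cellAverage m F N x‖ ^ p) m :=
    integrable_norm_rpow_of_bounded (by linarith)
      ((stronglyMeasurable_cellAverage' k).sub (stronglyMeasurable_cellAverage' N))
      (c := 2) fun x => by
        linarith [norm_sub_le (cellAverage m F k x) (cellAverage m F N x),
          norm_cellAverage_le hF N x, norm_cellAverage_le hF k x]
  rw [dist_eq_norm, ← Integrable.toL1_sub, L1.norm_of_fun_eq_integral_norm]
  have h4 : ∫ x, ‖cellAverage m F k x - cellAverage m F N x‖ ∂m ≤
      ∫ x, (δ + K * ‖cellAverage m F k x - cellAverage m F N x‖ ^ p) ∂m :=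
    integral_mono ((integrable_cellAverage hF k).sub (integrable_cellAverage hF N)).norm
      ((integrable_const δ).add (hint.const_mul K)) fun x => hpt _
  rw [integral_add (integrable_const δ) (hint.const_mul K), integral_const_mul,
    integral_const, smul_eq_mul] at h4
  have h5 : K * ∫ x, ‖cellAverage m F k x - cellAverage m F N x‖ ^ p ∂m ≤
      K * (ε * (2 * M) + C * θ / 2) := by
    refine mul_le_mul_of_nonneg_left (hsub.trans ?_) hK0.le
    have := mul_le_mul_of_nonneg_left hk''.le hC
    linarith
  simp only [Pi.sub_apply]
  rw [mul_add] at h5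
  have h6 : m.real univ * δ = δ * M := by rw [hM, mul_comm]
  linarith

/-- Radon–Nikodym theorem for a vector measure dominated by a finite measure, with values in a
uniformly convex space. -/
theorem exists_density_of_le_measure (hF : ∀ A, ‖F A‖ₑ ≤ m A) {p : ℝ} (hp : 1 < p)
    (hE : MidpointConvexityGap E p) :
    ∃ ρ : α → E, StronglyMeasurable ρ ∧ Integrable ρ m ∧
      ∀ A, MeasurableSet A → F A = ∫ x in A, ρ x ∂m := by
  obtain ⟨ρ, hρ⟩ := cauchySeq_tendsto_of_complete (cauchySeq_cellAverage hF hp hE)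
  refine ⟨ρ, Lp.stronglyMeasurable ρ, L1.integrable_coeFn ρ, ?_⟩
  have hle : ∀ n, generateFrom (countablePartition α n) ≤ mα := generateFrom_countablePartition_le α
  have hmono : Monotone fun n => generateFrom (countablePartition α n) :=
    monotone_nat_of_le_succ (generateFrom_countablePartition_le_succ α)
  have hcell : ∀ n B, MeasurableSet[generateFrom (countablePartition α n)] B →
      F B = ∫ x in B, ρ x ∂m := by
    intro n B hB
    have h1 := ((continuous_setIntegral B).tendsto ρ).comp hρ
    refine tendsto_nhds_unique (tendsto_const_nhds.congr' ?_) h1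
    filter_upwards [eventually_ge_atTop n] with k hk
    rw [Function.comp_apply, integral_congr_ae (ae_restrict_of_ae (Integrable.coeFn_toL1 _)),
      setIntegral_cellAverage_of_le hF hk hB]
  have hEq : F = m.withDensityᵥ ρ := by
    refine VectorMeasure.ext_of_generateFrom
      (⋃ n, {B | MeasurableSet[generateFrom (countablePartition α n)] B}) ?_ ?_ ?_ ?_
    · intro B hB
      obtain ⟨n, hn⟩ := mem_iUnion.1 hB
      rw [withDensityᵥ_apply (L1.integrable_coeFn ρ) (hle n _ hn), hcell n B hn]
    · refine le_antisymm ?_ (generateFrom_le fun B hB => ?_)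
      · conv_lhs => rw [← generateFrom_iUnion_countablePartition α]
        exact generateFrom_mono (iUnion_mono fun n A hA => measurableSet_generateFrom hA)
      · obtain ⟨n, hn⟩ := mem_iUnion.1 hB
        exact hle n _ hn
    · exact isPiSystem_iUnion_of_monotone _ (fun n => @isPiSystem_measurableSet α
        (generateFrom (countablePartition α n))) fun i j hij B hB => hmono hij _ hB
    · rw [withDensityᵥ_apply (L1.integrable_coeFn ρ) MeasurableSet.univ]
      exact hcell 0 _ (@MeasurableSet.univ α (generateFrom (countablePartition α 0)))
  intro A hA
  rw [hEq, withDensityᵥ_apply (L1.integrable_coeFn ρ) hA]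

end Density

/-! ### Uniform convexity and order of the spaces `L^p` -/

section LpConvexity

/-- Uniform convexity of `|·| ^ p` on the line, by homogeneity and compactness of the sphere
`|a| ^ p + |b| ^ p = 1`. -/
lemma exists_abs_sub_rpow_le {p : ℝ} (hp : 1 < p) {ε : ℝ} (hε : 0 < ε) :
    ∃ C : ℝ, 0 ≤ C ∧ ∀ a b : ℝ, |b - a| ^ p ≤ ε * (|a| ^ p + |b| ^ p) +
      C * ((|a| ^ p + |b| ^ p) / 2 - |2⁻¹ * (a + b)| ^ p) := by
  have hp0 : 0 < p := by linarith
  have hconv : ∀ a b : ℝ, |2⁻¹ * (a + b)| ^ p ≤ (|a| ^ p + |b| ^ p) / 2 := fun a b => by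
    have h1 : |2⁻¹ * (a + b)| ≤ 2⁻¹ * |a| + 2⁻¹ * |b| := by
      rw [abs_mul, abs_of_pos (by norm_num : (0 : ℝ) < 2⁻¹), ← mul_add]
      exact mul_le_mul_of_nonneg_left (abs_add_le a b) (by norm_num)
    refine (Real.rpow_le_rpow (abs_nonneg _) h1 hp0.le).trans ?_
    have := (convexOn_rpow hp.le).2 (abs_nonneg a) (abs_nonneg b)
      (by norm_num : (0 : ℝ) ≤ 2⁻¹) (by norm_num : (0 : ℝ) ≤ 2⁻¹) (by norm_num)
    simp only [smul_eq_mul] at this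
    linarith
  have hstrict : ∀ a b : ℝ, a ≠ b → |2⁻¹ * (a + b)| ^ p < (|a| ^ p + |b| ^ p) / 2 := by
    intro a b hab
    have h1 : |2⁻¹ * (a + b)| ≤ 2⁻¹ * |a| + 2⁻¹ * |b| := by
      rw [abs_mul, abs_of_pos (by norm_num : (0 : ℝ) < 2⁻¹), ← mul_add]
      exact mul_le_mul_of_nonneg_left (abs_add_le a b) (by norm_num)
    rcases eq_or_ne |a| |b| with h | h
    · -- then `b = -a`, so that the midpoint vanishes
      have hb : b = -a := by
        rcases abs_eq_abs.1 h with h | h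
        · exact absurd h hab
        · rw [h, neg_neg]
      have ha : a ≠ 0 := fun h0 => hab (by rw [hb, h0, neg_zero])
      subst hb
      simp only [add_neg_cancel, mul_zero, abs_zero, abs_neg]
      rw [Real.zero_rpow hp0.ne']
      have : 0 < |a| ^ p := Real.rpow_pos_of_pos (abs_pos.2 ha) p
      linarith
    · refine (Real.rpow_le_rpow (abs_nonneg _) h1 hp0.le).trans_lt ?_
      have := (strictConvexOn_rpow hp).2 (abs_nonneg a) (abs_nonneg b) h
        (by norm_num : (0 : ℝ) < 2⁻¹) (by norm_num : (0 : ℝ) < 2⁻¹) (by norm_num)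
      simp only [smul_eq_mul] at this
      linarith
  set gap : ℝ × ℝ → ℝ := fun z => (|z.1| ^ p + |z.2| ^ p) / 2 - |2⁻¹ * (z.1 + z.2)| ^ p with hgap
  have hrc : ∀ f : ℝ × ℝ → ℝ, Continuous f → Continuous fun z => |f z| ^ p := fun f hf =>
    hf.abs.rpow_const fun _ => Or.inr hp0.le
  have hgapc : Continuous gap := (((hrc _ continuous_fst).add (hrc _ continuous_snd)).div_const 2).sub
    (hrc _ (continuous_const.mul (continuous_fst.add continuous_snd)))
  have hc1 : Continuous fun z : ℝ × ℝ => |z.1| ^ p + |z.2| ^ p :=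
    (hrc _ continuous_fst).add (hrc _ continuous_snd)
  have hc2 : Continuous fun z : ℝ × ℝ => |z.2 - z.1| ^ p := hrc _ (continuous_snd.sub continuous_fst)
  set K : Set (ℝ × ℝ) := {z | |z.1| ^ p + |z.2| ^ p = 1 ∧ ε ≤ |z.2 - z.1| ^ p} with hK
  have hle1 : ∀ x y : ℝ, |x| ^ p + |y| ^ p = 1 → |x| ≤ 1 := fun x y h => by
    by_contra hx
    push Not at hx
    have := Real.one_lt_rpow hx hp0
    have : 0 ≤ |y| ^ p := by positivity
    linarith
  have hKc : IsCompact K := by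
    refine Metric.isCompact_of_isClosed_isBounded
      ((isClosed_eq hc1 continuous_const).inter (isClosed_le continuous_const hc2)) ?_
    refine (Metric.isBounded_closedBall (x := (0 : ℝ × ℝ)) (r := 1)).subset fun z hz => ?_
    rw [mem_closedBall_zero_iff, Prod.norm_def, Real.norm_eq_abs, Real.norm_eq_abs, sup_le_iff]
    exact ⟨hle1 _ _ hz.1, hle1 _ _ ((add_comm _ _).trans hz.1)⟩
  obtain ⟨δ, hδ, hδK⟩ : ∃ δ : ℝ, 0 < δ ∧ ∀ z ∈ K, δ ≤ gap z := by
    rcases K.eq_empty_or_nonempty with h | h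
    · exact ⟨1, one_pos, fun z hz => by simp [h] at hz⟩
    · obtain ⟨z, hz, hmin⟩ := hKc.exists_isMinOn h hgapc.continuousOn
      refine ⟨gap z, ?_, fun w hw => hmin hw⟩
      have hne : z.1 ≠ z.2 := fun h0 => by
        have := hz.2
        rw [h0, sub_self, abs_zero, Real.zero_rpow hp0.ne'] at this
        linarith
      exact sub_pos.2 (hstrict _ _ hne)
  refine ⟨2 ^ p / δ, by positivity, fun a b => ?_⟩
  have hsphere : ∀ a b : ℝ, |a| ^ p + |b| ^ p = 1 → |b - a| ^ p ≤ ε + 2 ^ p / δ * gap (a, b) := by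
    intro a b h
    have hg0 : 0 ≤ gap (a, b) := sub_nonneg.2 (hconv a b)
    rcases le_or_gt ε (|b - a| ^ p) with h1 | h1
    · have h2 := hδK (a, b) ⟨h, h1⟩
      have h3 : |b - a| ^ p ≤ 2 ^ p := by
        refine Real.rpow_le_rpow (abs_nonneg _) ?_ hp0.le
        have := abs_sub b a
        linarith [hle1 _ _ h, hle1 _ _ ((add_comm _ _).trans h)]
      have h4 : 2 ^ p ≤ 2 ^ p / δ * gap (a, b) := by
        rw [div_mul_eq_mul_div, le_div_iff₀ hδ]
        exact mul_le_mul_of_nonneg_left h2 (by positivity)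
      linarith
    · have : 0 ≤ 2 ^ p / δ * gap (a, b) := by positivity
      linarith
  set r := |a| ^ p + |b| ^ p with hr
  have hr0 : 0 ≤ r := by positivity
  rcases hr0.eq_or_lt with h0 | h0
  · have ha : a = 0 := by
      by_contra ha
      have h1 := Real.rpow_pos_of_pos (abs_pos.2 ha) p
      have h2 : 0 ≤ |b| ^ p := by positivity
      linarith
    have hb : b = 0 := by
      by_contra hb
      have h1 := Real.rpow_pos_of_pos (abs_pos.2 hb) p
      have h2 : 0 ≤ |a| ^ p := by positivity
      linarith
    simp [ha, hb, hr, Real.zero_rpow hp0.ne']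
  · set c := r ^ (p⁻¹) with hc
    have hc0 : 0 < c := Real.rpow_pos_of_pos h0 _
    have hcp : c ^ p = r := by rw [hc, ← Real.rpow_mul hr0, inv_mul_cancel₀ hp0.ne', Real.rpow_one]
    have hscale : ∀ x : ℝ, |x / c| ^ p = |x| ^ p / r := fun x => by
      rw [abs_div, abs_of_pos hc0, Real.div_rpow (abs_nonneg _) hc0.le, hcp]
    have h1 := hsphere (a / c) (b / c) (by rw [hscale, hscale, ← add_div, ← hr, div_self h0.ne'])
    simp only [hgap] at h1
    rw [← sub_div, ← add_div, ← mul_div_assoc, hscale, hscale, hscale, hscale] at h1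
    rw [show ε * r + 2 ^ p / δ * (r / 2 - |2⁻¹ * (a + b)| ^ p) =
      (ε + 2 ^ p / δ * ((|a| ^ p / r + |b| ^ p / r) / 2 - |2⁻¹ * (a + b)| ^ p / r)) * r by
        rw [← add_div, ← hr]; field_simp]
    exact (div_le_iff₀ h0).1 h1

variable {D : Type*} [MeasurableSpace D] {μ : Measure D} {p : ℝ≥0∞}

lemma Lp.norm_rpow_eq_integral (hp : 1 < p) (hp' : p < ∞) (f : Lp ℝ p μ) :
    ‖f‖ ^ p.toReal = ∫ x, |f x| ^ p.toReal ∂μ := by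
  have h0 : p ≠ 0 := (zero_lt_one.trans hp).ne'
  have hpr : 0 < p.toReal := ENNReal.toReal_pos h0 hp'.ne
  rw [Lp.norm_def, eLpNorm_eq_lintegral_rpow_enorm_toReal h0 hp'.ne, ← ENNReal.toReal_rpow,
    ← Real.rpow_mul ENNReal.toReal_nonneg, one_div, inv_mul_cancel₀ hpr.ne', Real.rpow_one,
    integral_eq_lintegral_of_nonneg_ae (ae_of_all _ fun x => by positivity)
      (((continuous_abs.rpow_const fun _ => Or.inr hpr.le).comp_stronglyMeasurable
        (Lp.stronglyMeasurable f)).aestronglyMeasurable)]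
  congr 1
  refine lintegral_congr fun x => ?_
  rw [← ENNReal.ofReal_rpow_of_nonneg (abs_nonneg _) hpr.le, ← Real.norm_eq_abs,
    ofReal_norm]

lemma Lp.integrable_abs_rpow (hp : 1 < p) (hp' : p < ∞) (f : Lp ℝ p μ) :
    Integrable (fun x => |f x| ^ p.toReal) μ := by
  have := (Lp.memLp f).integrable_norm_rpow (zero_lt_one.trans hp).ne' hp'.ne
  simpa [Real.norm_eq_abs] using this

/-- The spaces `L^p` with `1 < p < ∞` are uniformly convex: the inequality for real numbers is
integrated pointwise. -/
lemma midpointConvexityGap_Lp [Fact (1 ≤ p)] (hp : 1 < p) (hp' : p < ∞) :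
    MidpointConvexityGap (Lp ℝ p μ) p.toReal := by
  intro ε hε
  have hpr : 1 < p.toReal := by
    have := (ENNReal.toReal_lt_toReal ENNReal.one_ne_top hp'.ne).2 hp
    simpa using this
  obtain ⟨C, hC, h⟩ := exists_abs_sub_rpow_le hpr hε
  refine ⟨C, hC, fun a b => ?_⟩
  have hsum : Integrable (fun x => |a x| ^ p.toReal + |b x| ^ p.toReal) μ :=
    (Lp.integrable_abs_rpow hp hp' a).add (Lp.integrable_abs_rpow hp hp' b)
  have hmid := Lp.integrable_abs_rpow hp hp' ((2⁻¹ : ℝ) • (a + b))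
  have hgap : Integrable (fun x => (|a x| ^ p.toReal + |b x| ^ p.toReal) / 2 -
      |((2⁻¹ : ℝ) • (a + b) : Lp ℝ p μ) x| ^ p.toReal) μ := (hsum.div_const 2).sub hmid
  rw [Lp.norm_rpow_eq_integral hp hp', Lp.norm_rpow_eq_integral hp hp',
    Lp.norm_rpow_eq_integral hp hp', Lp.norm_rpow_eq_integral hp hp',
    ← integral_add (Lp.integrable_abs_rpow hp hp' a) (Lp.integrable_abs_rpow hp hp' b),
    ← integral_div, ← integral_sub (hsum.div_const 2) hmid, ← integral_const_mul,
    ← integral_const_mul, ← integral_add (hsum.const_mul ε) (hgap.const_mul C)]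
  refine integral_mono_ae (Lp.integrable_abs_rpow hp hp' _)
    ((hsum.const_mul ε).add (hgap.const_mul C)) ?_
  filter_upwards [Lp.coeFn_sub b a, Lp.coeFn_add a b, Lp.coeFn_smul (2⁻¹ : ℝ) (a + b)]
    with x h1 h2 h3
  rw [h1, h3, Pi.smul_apply, h2]
  exact h (a x) (b x)

lemma isOrderedModule_Lp : IsOrderedModule ℝ (Lp ℝ p μ) := by
  refine .of_smul_nonneg fun c hc f hf => ?_
  rw [← Lp.coeFn_nonneg] at hf ⊢
  filter_upwards [hf, Lp.coeFn_smul c f] with x h1 h2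
  rw [h2]
  exact mul_nonneg hc h1

end LpConvexity

/-! ### The time set -/

section HorizonLemmas

variable {T : ℝ≥0∞}

instance : OrdConnected {t : ℝ≥0 | (t : ℝ≥0∞) ≤ T} :=
  ⟨fun _ _ _ hb _ hc => (ENNReal.coe_le_coe.2 hc.2).trans hb⟩

instance : OrderTopology (Horizon T) :=
  inferInstanceAs (OrderTopology ↥{t : ℝ≥0 | (t : ℝ≥0∞) ≤ T})

instance : DenselyOrdered (Horizon T) :=
  inferInstanceAs (DenselyOrdered ↥{t : ℝ≥0 | (t : ℝ≥0∞) ≤ T})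

instance : OrderBot (Horizon T) where
  bot := Horizon.zero T
  bot_le _ := Subtype.coe_le_coe.1 (zero_le (a := (_ : ℝ≥0)))

instance : Nonempty (Horizon T) := ⟨Horizon.zero T⟩

lemma Horizon.zero_le (t : Horizon T) : Horizon.zero T ≤ t := bot_le

lemma Horizon.isClosed : IsClosed {t : ℝ≥0 | (t : ℝ≥0∞) ≤ T} :=
  isClosed_le ENNReal.continuous_coe continuous_const

instance : CompactIccSpace (Horizon T) where
  isCompact_Icc {a b} := by
    have h : IsClosedEmbedding (Subtype.val : Horizon T → ℝ≥0) :=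
      Horizon.isClosed.isClosedEmbedding_subtypeVal
    exact (h.isCompact_preimage (isCompact_Icc (a := a.1) (b := b.1)))

/-- The time `t`, stopped at the horizon. -/
def Horizon.clip (T : ℝ≥0∞) (t : ℝ≥0) : Horizon T :=
  ⟨(min (t : ℝ≥0∞) T).toNNReal, by
    rw [ENNReal.coe_toNNReal (ne_top_of_le_ne_top ENNReal.coe_ne_top (min_le_left _ _))]
    exact min_le_right _ _⟩

lemma Horizon.coe_clip (t : ℝ≥0) : ((Horizon.clip T t).1 : ℝ≥0∞) = min (t : ℝ≥0∞) T :=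
  ENNReal.coe_toNNReal (ne_top_of_le_ne_top ENNReal.coe_ne_top (min_le_left _ _))

lemma Horizon.le_clip_iff {s : Horizon T} {t : ℝ≥0} : s ≤ Horizon.clip T t ↔ s.1 ≤ t := by
  rw [← Subtype.coe_le_coe, ← ENNReal.coe_le_coe, Horizon.coe_clip, le_min_iff]
  simp [s.2]

lemma Horizon.clip_coe (s : Horizon T) : Horizon.clip T s.1 = s := by
  apply Subtype.ext
  rw [← ENNReal.coe_inj, Horizon.coe_clip, min_eq_left s.2]

lemma Horizon.clip_mono : Monotone (Horizon.clip T) := fun s t h =>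
  Horizon.le_clip_iff.2 ((by
    rw [← ENNReal.coe_le_coe, Horizon.coe_clip]; exact min_le_left _ _ :
      (Horizon.clip T s).1 ≤ s).trans h)

lemma Horizon.clip_le (t : ℝ≥0) : (Horizon.clip T t).1 ≤ t := by
  rw [← ENNReal.coe_le_coe, Horizon.coe_clip]; exact min_le_left _ _

lemma Horizon.continuous_clip : Continuous (Horizon.clip T) := by
  refine Continuous.subtype_mk ?_ _
  rw [ENNReal.isEmbedding_coe.continuous_iff]
  have : (fun t : ℝ≥0 => (((min (t : ℝ≥0∞) T).toNNReal : ℝ≥0) : ℝ≥0∞)) =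
      fun t : ℝ≥0 => min (t : ℝ≥0∞) T := by
    funext t
    exact ENNReal.coe_toNNReal (ne_top_of_le_ne_top ENNReal.coe_ne_top (min_le_left _ _))
  rw [Function.comp_def, this]
  exact ENNReal.continuous_coe.min continuous_const

/-- The integer times, stopped at the horizon; they are cofinal in `[0, T]`. -/
def Horizon.grid (T : ℝ≥0∞) (n : ℕ) : Horizon T := Horizon.clip T n

lemma Horizon.grid_mono : Monotone (Horizon.grid T) := fun _ _ h =>
  Horizon.clip_mono (Nat.cast_le.2 h)

lemma Horizon.le_grid {s : Horizon T} {n : ℕ} (h : s.1 ≤ n) : s ≤ Horizon.grid T n :=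
  Horizon.le_clip_iff.2 h

lemma Horizon.exists_le_grid (s : Horizon T) : ∃ n, s ≤ Horizon.grid T n :=
  let ⟨n, hn⟩ := exists_nat_ge s.1
  ⟨n, Horizon.le_grid hn⟩

lemma Horizon.iUnion_Iic_grid : ⋃ n, Iic (Horizon.grid T n) = univ :=
  eq_univ_of_forall fun s => mem_iUnion.2 (Horizon.exists_le_grid s)

lemma Horizon.borel_eq_generateFrom_Iic :
    (inferInstance : MeasurableSpace (Horizon T)) =
      MeasurableSpace.generateFrom (range Iic) := by
  rw [BorelSpace.measurable_eq (α := Horizon T)]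
  exact _root_.borel_eq_generateFrom_Iic _

lemma isPiSystem_range_Iic : IsPiSystem (range (Iic : Horizon T → Set (Horizon T))) := by
  rintro _ ⟨a, rfl⟩ _ ⟨b, rfl⟩ _
  exact ⟨a ⊓ b, by rw [Iic_inter_Iic]⟩

end HorizonLemmas

/-! ### Measures on the time set -/

section LocallyFinite

variable {T : ℝ≥0∞} {m : Measure (Horizon T)}

lemma sigmaFinite_of_Iic (hm : ∀ t, m (Iic t) < ∞) : SigmaFinite m :=
  ⟨⟨{ set := fun n => Iic (Horizon.grid T n)
      set_mem := fun _ => trivial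
      finite := fun _ => hm _
      spanning := Horizon.iUnion_Iic_grid }⟩⟩

lemma measure_ext_of_Iic {m' : Measure (Horizon T)} (hm : ∀ t, m (Iic t) < ∞)
    (h : ∀ t, m (Iic t) = m' (Iic t)) : m = m' := by
  refine Measure.ext_of_generateFrom_of_iUnion (range Iic) (fun n => Iic (Horizon.grid T n))
    Horizon.borel_eq_generateFrom_Iic isPiSystem_range_Iic Horizon.iUnion_Iic_grid
    (fun n => ⟨_, rfl⟩) (fun n => (hm _).ne) ?_
  rintro _ ⟨t, rfl⟩
  exact h t

variable {E : Type*} [NormedAddCommGroup E] [NormedSpace ℝ E] [CompleteSpace E]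

/-- A function is determined almost everywhere on `[0, N]` by its integrals over the intervals
`[0, t]`. -/
lemma ae_eq_of_setIntegral_Iic_eq_of_le {ρ σ : Horizon T → E} (N : Horizon T)
    (hρ : IntegrableOn ρ (Iic N) m) (hσ : IntegrableOn σ (Iic N) m)
    (h : ∀ t ≤ N, ∫ s in Iic t, ρ s ∂m = ∫ s in Iic t, σ s ∂m) :
    ρ =ᵐ[m.restrict (Iic N)] σ := by
  have hEq : (m.restrict (Iic N)).withDensityᵥ ρ = (m.restrict (Iic N)).withDensityᵥ σ := by
    refine VectorMeasure.ext_of_generateFrom (range Iic) ?_ Horizon.borel_eq_generateFrom_Iic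
      isPiSystem_range_Iic ?_
    · rintro _ ⟨t, rfl⟩
      rw [withDensityᵥ_apply hρ measurableSet_Iic, withDensityᵥ_apply hσ measurableSet_Iic,
        Measure.restrict_restrict measurableSet_Iic, Iic_inter_Iic]
      exact h _ inf_le_right
    · rw [withDensityᵥ_apply hρ MeasurableSet.univ, withDensityᵥ_apply hσ MeasurableSet.univ,
        Measure.restrict_univ]
      exact h N le_rfl
  refine Integrable.ae_eq_of_forall_setIntegral_eq ρ σ hρ hσ fun s hs _ => ?_
  rw [← withDensityᵥ_apply hρ hs, hEq, withDensityᵥ_apply hσ hs]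

lemma ae_of_forall_ae_restrict_grid {q : Horizon T → Prop}
    (h : ∀ n, ∀ᵐ s ∂(m.restrict (Iic (Horizon.grid T n))), q s) : ∀ᵐ s ∂m, q s := by
  rw [← Measure.restrict_univ (μ := m), ← Horizon.iUnion_Iic_grid]
  exact (ae_restrict_iUnion_iff _ _).2 h

lemma ae_eq_of_setIntegral_Iic_eq {ρ σ : Horizon T → E}
    (hρ : ∀ t, IntegrableOn ρ (Iic t) m) (hσ : ∀ t, IntegrableOn σ (Iic t) m)
    (h : ∀ t, ∫ s in Iic t, ρ s ∂m = ∫ s in Iic t, σ s ∂m) : ρ =ᵐ[m] σ :=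
  ae_of_forall_ae_restrict_grid fun _ => ae_eq_of_setIntegral_Iic_eq_of_le _ (hρ _) (hσ _)
    fun t _ => h t

end LocallyFinite

/-! ### Variation measures of paths -/

section Variation

variable {T : ℝ≥0∞} {E : Type*} [NormedAddCommGroup E]

/-- A right-continuous path of finite variation on each `[0, t]`. -/
structure IsPath (f : Horizon T → E) : Prop where
  rightContinuous : ∀ t, ContinuousWithinAt f (Ici t) t
  finiteVariation : ∀ t, eVariationOn f (Iic t) ≠ ∞

variable {f : Horizon T → E}

lemma eVariationOn_Iic_add_Icc {s t : Horizon T} (h : s ≤ t) :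
    eVariationOn f (Iic s) + eVariationOn f (Icc s t) = eVariationOn f (Iic t) := by
  have := eVariationOn.Icc_add_Icc f (s := univ) (bot_le (a := s)) h (mem_univ _)
  simpa [Icc_bot] using this

/-- The variation on `[0, t]`, as a Stieltjes function of `t`. -/
def IsPath.stieltjes (hf : IsPath f) : StieltjesFunction (Horizon T) where
  toFun t := (eVariationOn f (Iic t)).toReal
  mono' _ t h := ENNReal.toReal_mono (hf.finiteVariation t)
    (eVariationOn.mono f (Iic_subset_Iic.2 h))
  right_continuous' t := by
    by_cases ht : IsMax t
    · have : Ici t = {t} := by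
        ext s; exact ⟨fun h => le_antisymm (ht h) h, fun h => (mem_singleton_iff.1 h).ge⟩
      rw [this]
      exact continuousWithinAt_singleton
    obtain ⟨u, hu⟩ := not_isMax_iff.1 ht
    refine (ENNReal.tendsto_toReal (hf.finiteVariation t)).comp ?_
    have h0 : Tendsto (fun s => eVariationOn f (Iic u ∩ Icc t s)) (𝓝[Iic u] t) (𝓝 0) :=
      BoundedVariationOn.tendsto_eVariationOn_Icc_zero_right (hf.finiteVariation u) t
        ((hf.rightContinuous t).mono inter_subset_right)
    have h1 : 𝓝[Ici t] t ≤ 𝓝[Iic u] t :=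
      (nhdsWithin_le_nhds).trans (by rw [nhdsWithin_eq_nhds.2 (Iic_mem_nhds hu)])
    have h2 := ((tendsto_const_nhds (x := eVariationOn f (Iic t))).add (h0.mono_left h1))
    rw [add_zero] at h2
    refine h2.congr' ?_
    filter_upwards [self_mem_nhdsWithin, mem_nhdsWithin_of_mem_nhds (Iic_mem_nhds hu)] with s hs hsu
    rw [← eVariationOn_Iic_add_Icc hs]
    congr 2
    exact inter_eq_right.2 (Icc_subset_Iic_self.trans (Iic_subset_Iic.2 hsu))

/-- The variation measure of a path, with the atom `‖f 0‖` at the initial time. -/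
def IsPath.measure (hf : IsPath f) : Measure (Horizon T) :=
  ‖f (Horizon.zero T)‖ₑ • Measure.dirac (Horizon.zero T) + hf.stieltjes.measure

lemma IsPath.measure_Iic (hf : IsPath f) (t : Horizon T) :
    hf.measure (Iic t) = ‖f (Horizon.zero T)‖ₑ + eVariationOn f (Iic t) := by
  have hb : (botSet : Set (Horizon T)) = {Horizon.zero T} :=
    botSet_eq_singleton_of_isBot fun s => Horizon.zero_le s
  have h1 : Iic t = botSet ∪ Ioc (Horizon.zero T) t := by
    rw [hb]
    ext s
    simp only [mem_Iic, singleton_union, mem_insert_iff, mem_Ioc]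
    constructor
    · intro h
      rcases (Horizon.zero_le s).eq_or_lt with h0 | h0
      · exact Or.inl h0.symm
      · exact Or.inr ⟨h0, h⟩
    · rintro (h | h)
      · rw [h]; exact Horizon.zero_le t
      · exact h.2
  have h2 : hf.stieltjes.measure (Iic t) = eVariationOn f (Iic t) := by
    have hd : Disjoint (botSet : Set (Horizon T)) (Ioc (Horizon.zero T) t) := by
      rw [hb]; simp
    have h0 : eVariationOn f (Iic (Horizon.zero T)) = 0 :=
      eVariationOn.subsingleton f fun a ha b hb =>
        (le_bot_iff.1 ha).trans (le_bot_iff.1 hb).symm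
    have h3 : hf.stieltjes t - hf.stieltjes (Horizon.zero T) = (eVariationOn f (Iic t)).toReal := by
      change (eVariationOn f (Iic t)).toReal - (eVariationOn f (Iic (Horizon.zero T))).toReal = _
      rw [h0, ENNReal.toReal_zero, sub_zero]
    rw [h1, measure_union hd measurableSet_Ioc, StieltjesFunction.measure_botSet, zero_add,
      StieltjesFunction.measure_Ioc, h3, ENNReal.ofReal_toReal (hf.finiteVariation t)]
    exact congrArg _ h1
  rw [IsPath.measure, Measure.add_apply, h2, Measure.smul_apply, Measure.dirac_apply' _
    measurableSet_Iic, indicator_of_mem (mem_Iic.2 (Horizon.zero_le t)), Pi.one_apply, smul_eq_mul,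
    mul_one]

lemma IsPath.measure_Iic_lt_top (hf : IsPath f) (t : Horizon T) : hf.measure (Iic t) < ∞ := by
  rw [hf.measure_Iic]
  exact ENNReal.add_lt_top.2 ⟨enorm_lt_top, (hf.finiteVariation t).lt_top⟩

variable [NormedSpace ℝ E] [CompleteSpace E]

/-- The increments of a path on `[0, N]` extend to a vector measure dominated by the variation
measure. -/
lemma IsPath.exists_vectorMeasure (hf : IsPath f) (N : Horizon T) :
    ∃ F : VectorMeasure (Horizon T) E, (∀ t ≤ N, F (Iic t) = f t) ∧
      ∀ A, ‖F A‖ₑ ≤ hf.measure.restrict (Iic N) A := by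
  have hfin : IsFiniteMeasure (hf.stieltjes.measure.restrict (Iic N)) := by
    refine ⟨?_⟩
    rw [Measure.restrict_apply_univ]
    refine lt_of_le_of_lt ?_ (hf.measure_Iic_lt_top N)
    rw [IsPath.measure, Measure.add_apply]
    exact le_add_self
  obtain ⟨F, hF, hFle⟩ : ∃ F : VectorMeasure (Horizon T) E,
      (∀ u v, u ≤ v → F (Ioc u v) = f (v ⊓ N) - f (u ⊓ N)) ∧
      ∀ A, ‖F A‖ₑ ≤ hf.stieltjes.measure.restrict (Iic N) A := by
    have hle : ∀ A ∈ {s : Set (Horizon T) | ∃ u v, u ≤ v ∧ s = Ioc u v},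
        ‖AddContent.onIoc (fun s => f (s ⊓ N)) A‖ₑ ≤
          hf.stieltjes.measure.restrict (Iic N) A := by
      rintro _ ⟨u, v, huv, rfl⟩
      rw [AddContent.onIoc_apply huv, Measure.restrict_apply measurableSet_Ioc]
      rcases le_total u N with hu | hu
      · have h1 : Ioc u v ∩ Iic N = Ioc u (v ⊓ N) := by
          ext s; simp only [mem_inter_iff, mem_Ioc, mem_Iic, le_inf_iff, and_assoc]
        have huv' : u ≤ v ⊓ N := le_inf huv hu
        have h2 := eVariationOn_Iic_add_Icc (f := f) huv'
        have h3 : hf.stieltjes (v ⊓ N) - hf.stieltjes u =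
            (eVariationOn f (Icc u (v ⊓ N))).toReal := by
          change (eVariationOn f (Iic (v ⊓ N))).toReal - (eVariationOn f (Iic u)).toReal = _
          rw [← h2, ENNReal.toReal_add (hf.finiteVariation u)
            (ne_top_of_le_ne_top (hf.finiteVariation (v ⊓ N)) (h2 ▸ le_add_self))]
          ring
        rw [h1, StieltjesFunction.measure_Ioc, h3, ENNReal.ofReal_toReal
          (ne_top_of_le_ne_top (hf.finiteVariation (v ⊓ N)) (h2 ▸ le_add_self)),
          inf_eq_left.2 hu, ← edist_eq_enorm_sub]
        exact eVariationOn.edist_le f ⟨huv', le_rfl⟩ ⟨le_rfl, huv'⟩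
      · simp [inf_eq_right.2 hu, inf_eq_right.2 (hu.trans huv)]
    have hgen : (inferInstance : MeasurableSpace (Horizon T)) =
        MeasurableSpace.generateFrom {s | ∃ u v, u ≤ v ∧ s = Ioc u v} := by
      rw [BorelSpace.measurable_eq (α := Horizon T), borel_eq_generateFrom_Ioc_le (Horizon T)]
      refine congrArg MeasurableSpace.generateFrom (Set.ext fun s => ⟨?_, ?_⟩)
      · rintro ⟨u, v, huv, rfl⟩; exact ⟨u, v, huv, rfl⟩
      · rintro ⟨u, v, huv, rfl⟩; exact ⟨u, v, huv, rfl⟩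
    obtain ⟨F, hF, hFle⟩ :=
      VectorMeasure.exists_extension_of_isSetSemiring_of_le_measure_of_generateFrom
        IsSetSemiring.Ioc hle hgen
    refine ⟨F, fun u v huv => ?_, hFle⟩
    rw [hF _ ⟨u, v, huv, rfl⟩, AddContent.onIoc_apply huv]
  have hrestr : hf.measure.restrict (Iic N) =
      ‖f (Horizon.zero T)‖ₑ • Measure.dirac (Horizon.zero T) +
        hf.stieltjes.measure.restrict (Iic N) := by
    classical
    rw [IsPath.measure, Measure.restrict_add, Measure.restrict_smul,
      restrict_dirac' measurableSet_Iic, if_pos (mem_Iic.2 (Horizon.zero_le N))]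
  refine ⟨VectorMeasure.dirac (Horizon.zero T) (f (Horizon.zero T)) + F, fun t ht => ?_,
    fun A => ?_⟩
  · have hb : (botSet : Set (Horizon T)) = {Horizon.zero T} :=
      botSet_eq_singleton_of_isBot fun s => Horizon.zero_le s
    have h1 : Iic t = {Horizon.zero T} ∪ Ioc (Horizon.zero T) t := by
      ext s
      simp only [mem_Iic, singleton_union, mem_insert_iff, mem_Ioc]
      constructor
      · intro h
        rcases (Horizon.zero_le s).eq_or_lt with h0 | h0
        · exact Or.inl h0.symm
        · exact Or.inr ⟨h0, h⟩
      · rintro (h | h)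
        · rw [h]; exact Horizon.zero_le t
        · exact h.2
    have h2 : F {Horizon.zero T} = 0 := by
      have h3 := hFle {Horizon.zero T}
      rw [← hb] at h3 ⊢
      have h4 : hf.stieltjes.measure.restrict (Iic N) botSet = 0 :=
        le_antisymm ((Measure.restrict_apply_le _ _).trans
          (StieltjesFunction.measure_botSet _).le) bot_le
      rw [h4] at h3
      simpa using h3
    rw [_root_.add_apply, VectorMeasure.dirac_apply_of_mem measurableSet_Iic
      (mem_Iic.2 (Horizon.zero_le t)), h1, VectorMeasure.of_union (by simp)
      (measurableSet_singleton _) measurableSet_Ioc, h2, hF _ _ (Horizon.zero_le t),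
      inf_eq_left.2 ht, inf_eq_left.2 (Horizon.zero_le N)]
    abel
  · rw [_root_.add_apply, hrestr, Measure.add_apply]
    refine (enorm_add_le _ _).trans (add_le_add ?_ (hFle A))
    by_cases hA : MeasurableSet A ∧ Horizon.zero T ∈ A
    · rw [VectorMeasure.dirac_apply_of_mem hA.1 hA.2, Measure.smul_apply,
        Measure.dirac_apply' _ hA.1, indicator_of_mem hA.2, Pi.one_apply, smul_eq_mul, mul_one]
    · by_cases hA' : MeasurableSet A
      · rw [VectorMeasure.dirac_apply_of_notMem fun h => hA ⟨hA', h⟩]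
        simp
      · rw [VectorMeasure.not_measurable _ hA']
        simp

/-- A path with values in a uniformly convex space has a Bochner density with respect to its
variation measure. -/
lemma IsPath.exists_isPolar (hf : IsPath f) {p : ℝ} (hp : 1 < p)
    (hE : MidpointConvexityGap E p) :
    ∃ ρ, IsPolar f hf.measure ρ := by
  have hN : ∀ n : ℕ, ∃ ρ : Horizon T → E, StronglyMeasurable ρ ∧
      IntegrableOn ρ (Iic (Horizon.grid T n)) hf.measure ∧
      ∀ t ≤ Horizon.grid T n, f t = ∫ s in Iic t, ρ s ∂hf.measure := by
    intro n
    obtain ⟨F, hF, hFle⟩ := hf.exists_vectorMeasure (Horizon.grid T n)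
    have hfin : IsFiniteMeasure (hf.measure.restrict (Iic (Horizon.grid T n))) :=
      ⟨by rw [Measure.restrict_apply_univ]; exact hf.measure_Iic_lt_top _⟩
    obtain ⟨ρ, h1, h2, h3⟩ := exists_density_of_le_measure hFle hp hE
    refine ⟨ρ, h1, h2, fun t ht => ?_⟩
    rw [← hF t ht, h3 _ measurableSet_Iic, Measure.restrict_restrict measurableSet_Iic,
      Iic_inter_Iic, inf_eq_left.2 ht]
  choose ρ hρm hρi hρd using hN
  -- the densities on the intervals `[0, n]` agree where both are defined, and are patched together
  set σ : Horizon T → E := fun s => ρ ⌈s.1⌉₊ s with hσ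
  have hσm : StronglyMeasurable σ := by
    refine stronglyMeasurable_of_tendsto (f := fun n s => ∑ k ∈ Finset.range n,
      {s : Horizon T | ⌈s.1⌉₊ = k}.indicator (ρ k) s) atTop (fun n => ?_)
      (tendsto_pi_nhds.2 fun s => ?_)
    · refine Finset.stronglyMeasurable_fun_sum _ fun k _ => (hρm k).indicator ?_
      exact (Nat.measurable_ceil.comp measurable_subtype_coe) (measurableSet_singleton k)
    · refine tendsto_const_nhds.congr' ?_
      filter_upwards [eventually_gt_atTop ⌈s.1⌉₊] with n hn
      rw [Finset.sum_eq_single ⌈s.1⌉₊]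
      · exact (indicator_of_mem (s := {x : Horizon T | ⌈x.1⌉₊ = ⌈s.1⌉₊}) rfl _).symm
      · exact fun k _ hk => indicator_of_notMem (fun h => hk h.symm) _
      · exact fun h => absurd (Finset.mem_range.2 hn) h
  have hae : ∀ n, σ =ᵐ[hf.measure.restrict (Iic (Horizon.grid T n))] ρ n := by
    intro n
    have h1 : ∀ k ∈ Finset.range (n + 1),
        ∀ᵐ s ∂hf.measure, s ∈ Iic (Horizon.grid T k) → ρ k s = ρ n s := by
      intro k hk
      have hkn : Horizon.grid T k ≤ Horizon.grid T n :=
        Horizon.grid_mono (Nat.lt_succ_iff.1 (Finset.mem_range.1 hk))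
      refine (ae_restrict_iff' measurableSet_Iic).1 ?_
      exact ae_eq_of_setIntegral_Iic_eq_of_le _ (hρi k)
        ((hρi n).mono_set (Iic_subset_Iic.2 hkn)) fun t ht => by
          rw [← hρd k t ht, ← hρd n t (ht.trans hkn)]
    have h2 := (Finset.eventually_all (Finset.range (n + 1))).2 h1
    filter_upwards [ae_restrict_of_ae h2, ae_restrict_mem measurableSet_Iic] with s hs hsn
    refine hs ⌈s.1⌉₊ (Finset.mem_range.2 (Nat.lt_succ_iff.2 (Nat.ceil_le.2 ?_)))
      (Horizon.le_grid (Nat.le_ceil _))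
    exact Horizon.le_clip_iff.1 hsn
  refine ⟨σ, hf.measure_Iic, hσm, fun t => ?_, fun t => ?_⟩
  · obtain ⟨n, hn⟩ := t.exists_le_grid
    exact IntegrableOn.mono_set ((hρi n).congr (hae n).symm) (Iic_subset_Iic.2 hn)
  · obtain ⟨n, hn⟩ := t.exists_le_grid
    rw [hρd n t hn]
    exact (integral_congr_ae (ae_restrict_of_ae_restrict_of_subset (Iic_subset_Iic.2 hn)
      (hae n))).symm

end Variation

/-! ### Differentiation of paths with respect to their variation -/

section Differentiation

variable {T : ℝ≥0∞} {E : Type*} [NormedAddCommGroup E] [NormedSpace ℝ E]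

/-- The extension of a path to the real line: `0` at negative times (so that it jumps by `f 0` at
time `0`), and constant after the horizon. -/
def lineExtension (f : Horizon T → E) (x : ℝ) : E :=
  if x < 0 then 0 else f (Horizon.clip T x.toNNReal)

lemma Horizon.preimage_Iic_of_nonneg {x : ℝ} (hx : 0 ≤ x) :
    {u : Horizon T | (u.1 : ℝ) ≤ x} = Iic (Horizon.clip T x.toNNReal) := by
  ext u
  rw [mem_Iic, Horizon.le_clip_iff, ← NNReal.coe_le_coe, Real.coe_toNNReal x hx]
  rfl

lemma Horizon.preimage_Iic_of_neg {x : ℝ} (hx : x < 0) :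
    {u : Horizon T | (u.1 : ℝ) ≤ x} = ∅ := by
  ext u
  simp only [mem_ofPred_eq, mem_empty_iff_false, iff_false, not_le]
  exact hx.trans_le u.1.2

lemma setIntegral_le_eq_lineExtension {m : Measure (Horizon T)} {f ρ : Horizon T → E}
    (h : ∀ t, f t = ∫ s in Iic t, ρ s ∂m) (x : ℝ) :
    ∫ u in {u : Horizon T | (u.1 : ℝ) ≤ x}, ρ u ∂m = lineExtension f x := by
  rcases lt_or_ge x 0 with hx | hx
  · rw [Horizon.preimage_Iic_of_neg hx, lineExtension, if_pos hx, setIntegral_empty]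
  · rw [Horizon.preimage_Iic_of_nonneg hx, lineExtension, if_neg hx.not_gt, h]

lemma measureReal_le_eq_lineExtension (m : Measure (Horizon T)) (x : ℝ) :
    m.real {u : Horizon T | (u.1 : ℝ) ≤ x} = lineExtension (fun t => m.real (Iic t)) x := by
  rcases lt_or_ge x 0 with hx | hx
  · rw [Horizon.preimage_Iic_of_neg hx, lineExtension, if_pos hx, measureReal_empty]
  · rw [Horizon.preimage_Iic_of_nonneg hx, lineExtension, if_neg hx.not_gt]

lemma Horizon.measurable_coe : Measurable fun u : Horizon T => (u.1 : ℝ) :=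
  measurable_subtype_coe.coe_nnreal_real

lemma Horizon.measurableEmbedding_coe : MeasurableEmbedding fun u : Horizon T => (u.1 : ℝ) :=
  (NNReal.isClosedEmbedding_coe.comp Horizon.isClosed.isClosedEmbedding_subtypeVal).measurableEmbedding

/-- The difference quotient of the path `f` with respect to the distribution function `V` over the
interval `(s - 1 / (n + 1) - 1 / (k + 1), s + 1 / (n + 1)]`. As `k → ∞` the half-open interval becomes
the closed interval of radius `1 / (n + 1)` about `s`. -/
def quotient (V : Horizon T → ℝ) (f : Horizon T → E) (n k : ℕ) (s : Horizon T) : E :=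
  (lineExtension V (s.1 + 1 / ((n : ℝ) + 1)) -
      lineExtension V (s.1 - 1 / ((n : ℝ) + 1) - 1 / ((k : ℝ) + 1)))⁻¹ •
    (lineExtension f (s.1 + 1 / ((n : ℝ) + 1)) -
      lineExtension f (s.1 - 1 / ((n : ℝ) + 1) - 1 / ((k : ℝ) + 1)))

variable [CompleteSpace E] {m : Measure (Horizon T)} {f ρ : Horizon T → E}

/-- The Besicovitch differentiation theorem on the line, transferred to the horizon. -/
lemma ae_tendsto_average_closedBall (hm : ∀ t, m (Iic t) < ∞)
    (hρ : ∀ t, IntegrableOn ρ (Iic t) m) :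
    ∀ᵐ s ∂m, (∀ n : ℕ, 0 < m {u : Horizon T | |(u.1 : ℝ) - s.1| ≤ 1 / ((n : ℝ) + 1)}) ∧
      Tendsto (fun n : ℕ =>
        ⨍ u in {u : Horizon T | |(u.1 : ℝ) - s.1| ≤ 1 / ((n : ℝ) + 1)}, ρ u ∂m)
        atTop (𝓝 (ρ s)) := by
  set c : Horizon T → ℝ := fun u => (u.1 : ℝ) with hc
  have hcm : Measurable c := Horizon.measurable_coe
  have hce : MeasurableEmbedding c := Horizon.measurableEmbedding_coe
  have hIic : ∀ x : ℝ, ∃ t : Horizon T, c ⁻¹' Iic x ⊆ Iic t := fun x => by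
    rcases lt_or_ge x 0 with hx | hx
    · exact ⟨Horizon.zero T, by
        rw [show c ⁻¹' Iic x = ∅ from Horizon.preimage_Iic_of_neg hx]; exact empty_subset _⟩
    · exact ⟨_, (Horizon.preimage_Iic_of_nonneg hx).subset⟩
  have hfin : ∀ x : ℝ, m.map c (Iic x) < ∞ := fun x => by
    rw [Measure.map_apply hcm measurableSet_Iic]
    obtain ⟨t, ht⟩ := hIic x
    exact (measure_mono ht).trans_lt (hm t)
  have hloc : IsLocallyFiniteMeasure (m.map c) :=
    ⟨fun x => ⟨Iic (x + 1), Iic_mem_nhds (by linarith), hfin _⟩⟩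
  set σ : ℝ → E := Function.extend c ρ 0 with hσ
  have hσc : ∀ u, σ (c u) = ρ u := fun u => hce.injective.extend_apply ρ 0 u
  have hσi : LocallyIntegrable σ (m.map c) := by
    intro x
    refine ⟨Iic (x + 1), Iic_mem_nhds (lt_add_one x), ?_⟩
    rw [hce.integrableOn_map_iff]
    obtain ⟨t, ht⟩ := hIic (x + 1)
    exact ((hρ t).mono_set ht).congr (ae_of_all _ fun u => (hσc u).symm)
  have h1 := (Besicovitch.vitaliFamily (m.map c)).ae_tendsto_average hσi
  have h2 := (Besicovitch.vitaliFamily (m.map c)).ae_eventually_measure_pos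
  have h3 := ae_of_ae_map hcm.aemeasurable (h1.and h2)
  filter_upwards [h3] with s hs
  obtain ⟨hs1, hs2⟩ := hs
  have hball : ∀ r : ℝ, c ⁻¹' Metric.closedBall (c s) r = {u : Horizon T | |(u.1 : ℝ) - s.1| ≤ r} :=
    fun r => by
      ext u
      simp only [mem_preimage, Metric.mem_closedBall, Real.dist_eq, mem_ofPred_eq, hc]
  have hr : Tendsto (fun n : ℕ => 1 / ((n : ℝ) + 1)) atTop (𝓝[>] 0) :=
    tendsto_nhdsWithin_iff.2 ⟨tendsto_one_div_add_atTop_nhds_zero_nat,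
      Eventually.of_forall fun n => by simp only [mem_Ioi]; positivity⟩
  have hv := (Besicovitch.tendsto_filterAt (m.map c) (c s)).comp hr
  constructor
  · intro n
    obtain ⟨k, hk, hnk⟩ := ((hv.eventually hs2).and (eventually_ge_atTop n)).exists
    rw [Function.comp_apply, Measure.map_apply hcm Metric.isClosed_closedBall.measurableSet,
      hball] at hk
    refine hk.trans_le (measure_mono fun u (hu : |(u.1 : ℝ) - s.1| ≤ _) => hu.trans ?_)
    exact one_div_le_one_div_of_le (by positivity) (by exact_mod_cast Nat.succ_le_succ hnk)
  · have h4 := hs1.comp hv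
    rw [hσc] at h4
    refine h4.congr fun n => ?_
    simp only [Function.comp_apply]
    rw [setAverage_eq, setAverage_eq, measureReal_def, measureReal_def,
      Measure.map_apply hcm Metric.isClosed_closedBall.measurableSet, hball,
      hce.setIntegral_map, hball]
    simp only [hσc]

/-- The density is almost everywhere an iterated limit of difference quotients of the path. -/
lemma ae_tendsto_quotient (hm : ∀ t, m (Iic t) < ∞)
    (hρ : ∀ t, IntegrableOn ρ (Iic t) m) (hf : ∀ t, f t = ∫ s in Iic t, ρ s ∂m) :
    ∀ᵐ s ∂m, ∃ L : ℕ → E, (∀ n, Tendsto (fun k => quotient (fun t => m.real (Iic t)) f n k s)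
      atTop (𝓝 (L n))) ∧ Tendsto L atTop (𝓝 (ρ s)) := by
  filter_upwards [ae_tendsto_average_closedBall hm hρ] with s hs
  refine ⟨_, fun n => ?_, hs.2⟩
  set r : ℝ := 1 / ((n : ℝ) + 1) with hr
  have hr0 : 0 < r := by positivity
  set A : ℕ → Set (Horizon T) := fun k =>
    {u | (u.1 : ℝ) ≤ s.1 + r} \ {u | (u.1 : ℝ) ≤ s.1 - r - 1 / ((k : ℝ) + 1)} with hA
  have hmeas : ∀ x : ℝ, MeasurableSet {u : Horizon T | (u.1 : ℝ) ≤ x} := fun x =>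
    measurableSet_le Horizon.measurable_coe measurable_const
  have hAm : ∀ k, MeasurableSet (A k) := fun k => (hmeas _).diff (hmeas _)
  have hanti : Antitone A := fun i j hij => by
    refine sdiff_subset_sdiff_right fun u (hu : (u.1 : ℝ) ≤ _) => hu.trans ?_
    have : 1 / ((j : ℝ) + 1) ≤ 1 / ((i : ℝ) + 1) :=
      one_div_le_one_div_of_le (by positivity) (by exact_mod_cast Nat.succ_le_succ hij)
    linarith
  have hInter : ⋂ k, A k = {u : Horizon T | |(u.1 : ℝ) - s.1| ≤ r} := by
    ext u
    simp only [hA, mem_iInter, Set.mem_sdiff, mem_ofPred_eq, not_le, abs_le]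
    constructor
    · intro h
      refine ⟨?_, by linarith [(h 0).1]⟩
      refine le_of_forall_pos_lt_add fun ε hε => ?_
      obtain ⟨k, hk⟩ := exists_nat_one_div_lt hε
      linarith [(h k).2]
    · rintro ⟨h1, h2⟩ k
      have : 0 < 1 / ((k : ℝ) + 1) := by positivity
      exact ⟨by linarith, by linarith⟩
  have hup : {u : Horizon T | (u.1 : ℝ) ≤ s.1 + r} =
      Iic (Horizon.clip T ((s.1 : ℝ) + r).toNNReal) :=
    Horizon.preimage_Iic_of_nonneg (by positivity)
  have hUfin : m {u : Horizon T | (u.1 : ℝ) ≤ s.1 + r} ≠ ∞ := by rw [hup]; exact (hm _).ne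
  have hUint : IntegrableOn ρ {u : Horizon T | (u.1 : ℝ) ≤ s.1 + r} m := by rw [hup]; exact hρ _
  have hsub : ∀ k : ℕ, {u : Horizon T | (u.1 : ℝ) ≤ s.1 - r - 1 / ((k : ℝ) + 1)} ⊆
      {u | (u.1 : ℝ) ≤ s.1 + r} := fun k u hu => by
    have : 0 < 1 / ((k : ℝ) + 1) := by positivity
    simp only [mem_ofPred_eq] at hu ⊢
    linarith
  have hmR : ∀ k, m.real (A k) = lineExtension (fun t => m.real (Iic t)) (s.1 + r) -
      lineExtension (fun t => m.real (Iic t)) (s.1 - r - 1 / ((k : ℝ) + 1)) := fun k => by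
    rw [← measureReal_le_eq_lineExtension, ← measureReal_le_eq_lineExtension, hA]
    exact measureReal_sdiff (hsub k) (hmeas _) hUfin
  have hIR : ∀ k, ∫ u in A k, ρ u ∂m = lineExtension f (s.1 + r) -
      lineExtension f (s.1 - r - 1 / ((k : ℝ) + 1)) := fun k => by
    rw [← setIntegral_le_eq_lineExtension hf, ← setIntegral_le_eq_lineExtension hf, hA]
    exact setIntegral_sdiff (hmeas _) hUint (hsub k)
  have hq : ∀ k, quotient (fun t => m.real (Iic t)) f n k s =
      (m.real (A k))⁻¹ • ∫ u in A k, ρ u ∂m := fun k => by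
    rw [hmR, hIR, quotient]
  have hAfin : m (A 0) ≠ ∞ := ne_top_of_le_ne_top hUfin (measure_mono sdiff_subset)
  have hlim1 : Tendsto (fun k => m.real (A k)) atTop
      (𝓝 (m.real {u : Horizon T | |(u.1 : ℝ) - s.1| ≤ r})) := by
    have := tendsto_measure_iInter_atTop (μ := m) (s := A) (fun k => (hAm k).nullMeasurableSet)
      hanti ⟨0, hAfin⟩
    rw [hInter] at this
    exact (ENNReal.tendsto_toReal (ne_top_of_le_ne_top hAfin
      (measure_mono (hInter ▸ iInter_subset A 0)))).comp this
  have hlim2 : Tendsto (fun k => ∫ u in A k, ρ u ∂m) atTop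
      (𝓝 (∫ u in {u : Horizon T | |(u.1 : ℝ) - s.1| ≤ r}, ρ u ∂m)) := by
    have := hanti.tendsto_setIntegral hAm (hUint.mono_set sdiff_subset)
    rwa [hInter] at this
  have hpos : m.real {u : Horizon T | |(u.1 : ℝ) - s.1| ≤ r} ≠ 0 :=
    (ENNReal.toReal_pos (hs.1 n).ne' (ne_top_of_le_ne_top hAfin
      (measure_mono (hInter ▸ iInter_subset A 0)))).ne'
  simp only [hq]
  rw [setAverage_eq]
  exact (hlim1.inv₀ hpos).smul hlim2

lemma monotone_lineExtension [PartialOrder E] {f : Horizon T → E} (h0 : ∀ t, 0 ≤ f t)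
    (hf : Monotone f) : Monotone (lineExtension f) := fun x y hxy => by
  unfold lineExtension
  split_ifs with h1 h2 h2
  · exact le_rfl
  · exact h0 _
  · exact absurd (hxy.trans_lt h2) h1
  · exact hf (Horizon.clip_mono (Real.toNNReal_le_toNNReal hxy))

lemma monotone_measureReal_Iic (hm : ∀ t, m (Iic t) < ∞) : Monotone fun t => m.real (Iic t) :=
  fun _ t h => measureReal_mono (Iic_subset_Iic.2 h) (hm t).ne

variable [PartialOrder E] [IsOrderedAddMonoid E] [IsOrderedModule ℝ E] [OrderClosedTopology E]

lemma quotient_nonneg {V : Horizon T → ℝ} (hV0 : ∀ t, 0 ≤ V t) (hV : Monotone V)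
    (hf0 : ∀ t, 0 ≤ f t) (hf : Monotone f) (n k : ℕ) (s : Horizon T) : 0 ≤ quotient V f n k s := by
  have h : (s.1 : ℝ) - 1 / ((n : ℝ) + 1) - 1 / ((k : ℝ) + 1) ≤ s.1 + 1 / ((n : ℝ) + 1) := by
    have h1 : 0 < 1 / ((k : ℝ) + 1) := by positivity
    have h2 : 0 < 1 / ((n : ℝ) + 1) := by positivity
    linarith
  exact smul_nonneg (inv_nonneg.2 (sub_nonneg.2 (monotone_lineExtension hV0 hV h)))
    (sub_nonneg.2 (monotone_lineExtension hf0 hf h))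

/-- A nonnegative nondecreasing path has a nonnegative density, because its difference quotients lie
in the closed positive cone. -/
lemma ae_nonneg_density (hm : ∀ t, m (Iic t) < ∞)
    (hρ : ∀ t, IntegrableOn ρ (Iic t) m) (hf : ∀ t, f t = ∫ s in Iic t, ρ s ∂m)
    (hf0 : ∀ t, 0 ≤ f t) (hmono : Monotone f) : ∀ᵐ s ∂m, 0 ≤ ρ s := by
  filter_upwards [ae_tendsto_quotient hm hρ hf] with s hs
  obtain ⟨L, h1, h2⟩ := hs
  refine ge_of_tendsto' h2 fun n => ge_of_tendsto' (h1 n) fun k => ?_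
  exact quotient_nonneg (fun _ => measureReal_nonneg) (monotone_measureReal_Iic hm) hf0 hmono n k s

end Differentiation

/-! ### Linear combinations of paths -/

section Polar

/-- Right-continuous paths of finite variation in `E` have a Bochner density with respect to their
variation measure. -/
class HasPathDensity (E : Type*) [NormedAddCommGroup E] [NormedSpace ℝ E] : Prop where
  exists_isPolar : ∀ {T : ℝ≥0∞} {f : Horizon T → E} (hf : IsPath f), ∃ ρ, IsPolar f hf.measure ρ

variable {T : ℝ≥0∞} {E : Type*} [NormedAddCommGroup E] [NormedSpace ℝ E] [CompleteSpace E]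
  {f g h ρ : Horizon T → E} {m : Measure (Horizon T)}

lemma IsPath.isPolar [HasPathDensity E] (hf : IsPath f) :
    IsPolar f (variationMeasure f) (polarDensity f) := by
  have h : ∃ z : Measure (Horizon T) × (Horizon T → E), IsPolar f z.1 z.2 :=
    let ⟨ρ, hρ⟩ := HasPathDensity.exists_isPolar hf
    ⟨(hf.measure, ρ), hρ⟩
  rw [variationMeasure, polarDensity, polar, dif_pos h]
  exact h.choose_spec

lemma IsPolar.measure_Iic_lt_top (h : IsPolar f m ρ) (hf : IsPath f) (t : Horizon T) :
    m (Iic t) < ∞ := by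
  rw [h.mass, ← hf.measure_Iic]
  exact hf.measure_Iic_lt_top t

lemma IsPath.variationMeasure_Iic_lt_top [HasPathDensity E] (hf : IsPath f) (t : Horizon T) :
    variationMeasure f (Iic t) < ∞ := hf.isPolar.measure_Iic_lt_top hf t

lemma IsPath.sigmaFinite [HasPathDensity E] (hf : IsPath f) : SigmaFinite (variationMeasure f) :=
  sigmaFinite_of_Iic hf.variationMeasure_Iic_lt_top

lemma setIntegral_rnDeriv_smul {F : Type*} [NormedAddCommGroup F] [NormedSpace ℝ F]
    {m M : Measure (Horizon T)} [SigmaFinite m] [SigmaFinite M]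
    (hac : m ≪ M) (ρ : Horizon T → F) {A : Set (Horizon T)} (hA : MeasurableSet A) :
    ∫ s in A, (m.rnDeriv M s).toReal • ρ s ∂M = ∫ s in A, ρ s ∂m := by
  rw [← integral_indicator hA, ← integral_indicator hA, ← integral_rnDeriv_smul hac]
  congr 1
  funext s
  by_cases hs : s ∈ A <;> simp [hs]

lemma integrableOn_rnDeriv_smul {F : Type*} [NormedAddCommGroup F] [NormedSpace ℝ F]
    {m M : Measure (Horizon T)} [SigmaFinite m] [SigmaFinite M]
    (hac : m ≪ M) {ρ : Horizon T → F} {A : Set (Horizon T)} (hA : MeasurableSet A)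
    (hρ : IntegrableOn ρ A m) : IntegrableOn (fun s => (m.rnDeriv M s).toReal • ρ s) A M := by
  rw [← integrable_indicator_iff hA] at hρ ⊢
  refine ((integrable_rnDeriv_smul_iff hac).2 hρ).congr (ae_of_all _ fun s => ?_)
  by_cases hs : s ∈ A <;> simp [hs]

/-- The densities of a linear combination of paths combine linearly with respect to a common
dominating measure. -/
lemma exists_common_density [HasPathDensity E] (hf : IsPath f) (hg : IsPath g) (hh : IsPath h)
    {a b : ℝ} (hsum : ∀ t, h t = a • f t + b • g t) :
    ∃ M : Measure (Horizon T), SigmaFinite M ∧ variationMeasure f ≪ M ∧ variationMeasure g ≪ M ∧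
      variationMeasure h ≪ M ∧
      ∀ᵐ s ∂M, ((variationMeasure h).rnDeriv M s).toReal • polarDensity h s =
        a • ((variationMeasure f).rnDeriv M s).toReal • polarDensity f s +
        b • ((variationMeasure g).rnDeriv M s).toReal • polarDensity g s := by
  set M := variationMeasure f + variationMeasure g + variationMeasure h with hM
  have hMfin : ∀ t, M (Iic t) < ∞ := fun t => by
    rw [hM, Measure.add_apply, Measure.add_apply]
    exact ENNReal.add_lt_top.2 ⟨ENNReal.add_lt_top.2 ⟨hf.variationMeasure_Iic_lt_top t,
      hg.variationMeasure_Iic_lt_top t⟩, hh.variationMeasure_Iic_lt_top t⟩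
  have hσ : SigmaFinite M := sigmaFinite_of_Iic hMfin
  have hσf := hf.sigmaFinite
  have hσg := hg.sigmaFinite
  have hσh := hh.sigmaFinite
  have hfM : variationMeasure f ≪ M :=
    (Measure.le_add_right (Measure.le_add_right le_rfl)).absolutelyContinuous
  have hgM : variationMeasure g ≪ M :=
    (Measure.le_add_right (Measure.le_add_left le_rfl)).absolutelyContinuous
  have hhM : variationMeasure h ≪ M := (Measure.le_add_left le_rfl).absolutelyContinuous
  refine ⟨M, hσ, hfM, hgM, hhM, ?_⟩
  have hfi := fun t => integrableOn_rnDeriv_smul hfM (measurableSet_Iic (a := t))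
    (hf.isPolar.integrableOn t)
  have hgi := fun t => integrableOn_rnDeriv_smul hgM (measurableSet_Iic (a := t))
    (hg.isPolar.integrableOn t)
  have hhi := fun t => integrableOn_rnDeriv_smul hhM (measurableSet_Iic (a := t))
    (hh.isPolar.integrableOn t)
  refine ae_eq_of_setIntegral_Iic_eq hhi
    (fun t => ((hfi t).smul a).add ((hgi t).smul b)) fun t => ?_
  have h1 := integral_add ((hfi t).smul a) ((hgi t).smul b)
  simp only [Pi.smul_apply] at h1
  rw [h1, integral_smul, integral_smul, setIntegral_rnDeriv_smul hfM _ measurableSet_Iic,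
    setIntegral_rnDeriv_smul hgM _ measurableSet_Iic,
    setIntegral_rnDeriv_smul hhM _ measurableSet_Iic, ← hf.isPolar.density, ← hg.isPolar.density,
    ← hh.isPolar.density, hsum]

end Polar

lemma measurable_apply {E : Type*} [NormedAddCommGroup E]
    [NormedSpace ℝ E] {α : Type*} [MeasurableSpace α] {φ : α → StrongDual ℝ E} {v : α → E}
    (hφ : StronglyMeasurable φ) (hv : StronglyMeasurable v) : Measurable fun a => φ a (v a) :=
  (isBoundedBilinearMap_apply.continuous.comp_stronglyMeasurable (hφ.prodMk hv)).measurable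

/-! ### Integration against nondecreasing paths -/

section PositivePairing

variable {T : ℝ≥0∞} {E : Type*} [NormedAddCommGroup E] [NormedSpace ℝ E] [CompleteSpace E]
  [PartialOrder E] [IsOrderedAddMonoid E] [IsOrderedModule ℝ E] [OrderClosedTopology E]
  [HasPathDensity E] {f g h : Horizon T → E}

/-- A nondecreasing, nonnegative, right-continuous path of finite variation on each `[0, t]`. -/
structure IsMonotonePath (f : Horizon T → E) : Prop extends IsPath f where
  nonneg : ∀ t, 0 ≤ f t
  monotone : Monotone f

lemma IsMonotonePath.ae_nonneg (hf : IsMonotonePath f) :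
    ∀ᵐ s ∂(variationMeasure f), 0 ≤ polarDensity f s :=
  ae_nonneg_density hf.variationMeasure_Iic_lt_top
    hf.isPolar.integrableOn hf.isPolar.density hf.nonneg hf.monotone

lemma IsMonotonePath.add_smul (hf : IsMonotonePath f) (hg : IsMonotonePath g) {a b : ℝ}
    (ha : 0 ≤ a) (hb : 0 ≤ b) : IsMonotonePath fun t => a • f t + b • g t where
  rightContinuous t := ((hf.rightContinuous t).const_smul a).add ((hg.rightContinuous t).const_smul b)
  finiteVariation t := by
    have key : eVariationOn (fun t => a • f t + b • g t) (Iic t) ≤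
        ‖a‖ₑ * eVariationOn f (Iic t) + ‖b‖ₑ * eVariationOn g (Iic t) := by
      refine iSup_le fun ⟨n, u, hu, hut⟩ => ?_
      calc ∑ i ∈ Finset.range n, edist (a • f (u (i + 1)) + b • g (u (i + 1)))
            (a • f (u i) + b • g (u i))
          ≤ ∑ i ∈ Finset.range n, (‖a‖ₑ * edist (f (u (i + 1))) (f (u i)) +
              ‖b‖ₑ * edist (g (u (i + 1))) (g (u i))) := by
            refine Finset.sum_le_sum fun i _ => ?_
            refine (edist_add_add_le _ _ _ _).trans (add_le_add ?_ ?_) <;>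
            · rw [edist_eq_enorm_sub, ← smul_sub, enorm_smul, edist_eq_enorm_sub]
        _ = ‖a‖ₑ * ∑ i ∈ Finset.range n, edist (f (u (i + 1))) (f (u i)) +
              ‖b‖ₑ * ∑ i ∈ Finset.range n, edist (g (u (i + 1))) (g (u i)) := by
            rw [Finset.sum_add_distrib, Finset.mul_sum, Finset.mul_sum]
        _ ≤ _ := by
            gcongr
            · exact eVariationOn.sum_le hu hut
            · exact eVariationOn.sum_le hu hut
    exact ne_top_of_le_ne_top (ENNReal.add_ne_top.2
      ⟨ENNReal.mul_ne_top enorm_ne_top (hf.finiteVariation t),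
        ENNReal.mul_ne_top enorm_ne_top (hg.finiteVariation t)⟩) key
  nonneg t := add_nonneg (smul_nonneg ha (hf.nonneg t)) (smul_nonneg hb (hg.nonneg t))
  monotone s t hst := add_le_add (smul_le_smul_of_nonneg_left (hf.monotone hst) ha)
    (smul_le_smul_of_nonneg_left (hg.monotone hst) hb)

/-- The integral `∫ ⟨φ, df⟩` of a positive functional against a nondecreasing path, as an element
of `[0, ∞]`. -/
def pairing (φ : Horizon T → StrongDual ℝ E) (f : Horizon T → E) : ℝ≥0∞ :=
  ∫⁻ s, ENNReal.ofReal (φ s (polarDensity f s)) ∂(variationMeasure f)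

lemma lintegral_eq_lintegral_rnDeriv {M m : Measure (Horizon T)} [SigmaFinite M] [SigmaFinite m]
    (hac : m ≪ M) {φ : Horizon T → StrongDual ℝ E} (hφ : StronglyMeasurable φ)
    {ρ : Horizon T → E} (hρ : StronglyMeasurable ρ) :
    ∫⁻ s, ENNReal.ofReal (φ s (ρ s)) ∂m =
      ∫⁻ s, ENNReal.ofReal (φ s ((m.rnDeriv M s).toReal • ρ s)) ∂M := by
  rw [← lintegral_rnDeriv_mul hac (measurable_apply hφ hρ).ennreal_ofReal.aemeasurable]
  refine lintegral_congr_ae ?_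
  filter_upwards [Measure.rnDeriv_lt_top m M] with s hs
  rw [map_smul, smul_eq_mul, ENNReal.ofReal_mul ENNReal.toReal_nonneg, ENNReal.ofReal_toReal hs.ne]

lemma IsMonotonePath.ae_rnDeriv_smul_nonneg (hf : IsMonotonePath f) {M : Measure (Horizon T)}
    [SigmaFinite M] (hac : variationMeasure f ≪ M) :
    ∀ᵐ s ∂M, 0 ≤ ((variationMeasure f).rnDeriv M s).toReal • polarDensity f s := by
  have hσ := hf.sigmaFinite
  have h1 := hf.ae_nonneg
  rw [← Measure.withDensity_rnDeriv_eq _ _ hac,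
    ae_withDensity_iff (Measure.measurable_rnDeriv _ _)] at h1
  filter_upwards [h1] with s hs
  by_cases h0 : (variationMeasure f).rnDeriv M s = 0
  · simp [h0]
  · exact smul_nonneg ENNReal.toReal_nonneg (hs h0)

/-- The pairing is additive in the path, although neither the variation measure nor the density is. -/
lemma pairing_add_smul (hf : IsMonotonePath f) (hg : IsMonotonePath g) {a b : ℝ} (ha : 0 ≤ a)
    (hb : 0 ≤ b) {φ : Horizon T → StrongDual ℝ E} (hφ : StronglyMeasurable φ)
    (hφ0 : ∀ s v, 0 ≤ v → 0 ≤ φ s v) :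
    pairing φ (fun t => a • f t + b • g t) =
      ENNReal.ofReal a * pairing φ f + ENNReal.ofReal b * pairing φ g := by
  have hh := hf.add_smul hg ha hb
  obtain ⟨M, hσ, hfM, hgM, hhM, hae⟩ := exists_common_density hf.toIsPath hg.toIsPath hh.toIsPath
    fun t => rfl
  have hσf := hf.sigmaFinite
  have hσg := hg.sigmaFinite
  have hσh := hh.sigmaFinite
  have hmeas : ∀ {k : Horizon T → E}, IsMonotonePath k → Measurable fun s => ENNReal.ofReal
      (φ s (((variationMeasure k).rnDeriv M s).toReal • polarDensity k s)) := fun {k} hk =>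
    (measurable_apply hφ ((Measure.measurable_rnDeriv _ _).ennreal_toReal.stronglyMeasurable.smul
      hk.isPolar.stronglyMeasurable)).ennreal_ofReal
  rw [pairing, pairing, pairing, lintegral_eq_lintegral_rnDeriv hfM hφ hf.isPolar.stronglyMeasurable,
    lintegral_eq_lintegral_rnDeriv hgM hφ hg.isPolar.stronglyMeasurable,
    lintegral_eq_lintegral_rnDeriv hhM hφ hh.isPolar.stronglyMeasurable,
    ← lintegral_const_mul _ (hmeas hf), ← lintegral_const_mul _ (hmeas hg),
    ← lintegral_add_left ((hmeas hf).const_mul _)]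
  refine lintegral_congr_ae ?_
  filter_upwards [hae, hf.ae_rnDeriv_smul_nonneg hfM, hg.ae_rnDeriv_smul_nonneg hgM]
    with s h1 h2 h3
  rw [h1, map_add, map_smul, map_smul (φ s) b, smul_eq_mul, smul_eq_mul,
    ENNReal.ofReal_add (mul_nonneg ha (hφ0 s _ h2)) (mul_nonneg hb (hφ0 s _ h3)),
    ENNReal.ofReal_mul ha, ENNReal.ofReal_mul hb]

end PositivePairing

/-! ### Convolution with the semigroup -/

section Semigroup

variable {T : ℝ≥0∞} {E : Type*} [NormedAddCommGroup E] [NormedSpace ℝ E] [CompleteSpace E]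
  {S : ℝ≥0 → E →L[ℝ] E}

/-- A strongly continuous family is bounded on bounded time intervals, by the uniform boundedness
principle. -/
lemma exists_norm_semigroup_le (hS : ∀ x, Continuous fun t => S t x) (r : ℝ≥0) :
    ∃ C, 0 ≤ C ∧ ∀ t ≤ r, ‖S t‖ ≤ C := by
  obtain ⟨C, hC⟩ := banach_steinhaus (g := fun t : Iic r => S t.1) fun x => by
    have hI : IsCompact (Iic r) := by
      rw [← Icc_bot]; exact isCompact_Icc
    obtain ⟨C, hC⟩ := hI.exists_bound_of_continuousOn (hS x).continuousOn
    exact ⟨C, fun t => hC t.1 t.2⟩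
  exact ⟨C, (norm_nonneg _).trans (hC ⟨0, mem_Iic.2 zero_le⟩), fun t ht => hC ⟨t, ht⟩⟩

lemma continuous_semigroup_apply (hS : ∀ x, Continuous fun t => S t x) :
    Continuous fun z : ℝ≥0 × E => S z.1 z.2 := by
  refine continuous_iff_continuousAt.2 fun ⟨t, x⟩ => ?_
  obtain ⟨C, hC0, hC⟩ := exists_norm_semigroup_le hS (t + 1)
  have h1 : Tendsto (fun z : ℝ≥0 × E => S z.1 (z.2 - x)) (𝓝 (t, x)) (𝓝 0) := by
    refine squeeze_zero_norm' (a := fun z : ℝ≥0 × E => C * ‖z.2 - x‖) ?_ ?_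
    · filter_upwards [continuous_fst.continuousAt.preimage_mem_nhds
        (Iio_mem_nhds (show ((t, x) : ℝ≥0 × E).1 < t + 1 from lt_add_one t))] with z hz
      exact ((S z.1).le_opNorm _).trans
        (mul_le_mul_of_nonneg_right (hC z.1 (le_of_lt hz)) (norm_nonneg _))
    · have : Continuous fun z : ℝ≥0 × E => C * ‖z.2 - x‖ := by fun_prop
      simpa using this.tendsto (t, x)
  have h2 : Tendsto (fun z : ℝ≥0 × E => S z.1 x) (𝓝 (t, x)) (𝓝 (S t x)) :=
    ((hS x).comp continuous_fst).tendsto (t, x)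
  have h3 := h1.add h2
  rw [zero_add] at h3
  refine h3.congr fun z => ?_
  rw [map_sub, sub_add_cancel]

lemma stronglyMeasurable_semigroup_apply {α : Type*} [MeasurableSpace α]
    (hS : ∀ x, Continuous fun t => S t x) {r : α → ℝ≥0} (hr : Measurable r) {v : α → E}
    (hv : StronglyMeasurable v) : StronglyMeasurable fun a => S (r a) (v a) :=
  (continuous_semigroup_apply hS).comp_stronglyMeasurable (hr.stronglyMeasurable.prodMk hv)

/-- The contribution `∫_{[0,t]} e^{(t-s)A} ρ_s m(ds)` of a control to the state. -/
def convolution (S : ℝ≥0 → E →L[ℝ] E) (m : Measure (Horizon T)) (ρ : Horizon T → E)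
    (t : Horizon T) : E :=
  ∫ s in Iic t, S (t.1 - s.1) (ρ s) ∂m

lemma integrableOn_semigroup_apply (hS : ∀ x, Continuous fun t => S t x) {m : Measure (Horizon T)}
    {ρ : Horizon T → E} (hρm : StronglyMeasurable ρ) {t : Horizon T}
    (hρ : IntegrableOn ρ (Iic t) m) :
    IntegrableOn (fun s => S (t.1 - s.1) (ρ s)) (Iic t) m := by
  obtain ⟨C, hC0, hC⟩ := exists_norm_semigroup_le hS t.1
  refine Integrable.mono' (hρ.norm.const_mul C)
    (stronglyMeasurable_semigroup_apply hS (measurable_const.sub measurable_subtype_coe)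
      hρm).aestronglyMeasurable (ae_of_all _ fun s => ?_)
  exact ((S _).le_opNorm _).trans (mul_le_mul_of_nonneg_right (hC _ tsub_le_self) (norm_nonneg _))

variable [HasPathDensity E] {f g h : Horizon T → E}

lemma convolution_congr {m : Measure (Horizon T)} {ρ σ : Horizon T → E} (h : ρ =ᵐ[m] σ)
    (t : Horizon T) : convolution S m ρ t = convolution S m σ t :=
  integral_congr_ae (ae_restrict_of_ae (h.mono fun _ hs => by beta_reduce; rw [hs]))

lemma convolution_add_smul (hS : ∀ x, Continuous fun t => S t x) (hf : IsPath f) (hg : IsPath g)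
    (hh : IsPath h) {a b : ℝ} (hsum : ∀ t, h t = a • f t + b • g t) (t : Horizon T) :
    convolution S (variationMeasure h) (polarDensity h) t =
      a • convolution S (variationMeasure f) (polarDensity f) t +
      b • convolution S (variationMeasure g) (polarDensity g) t := by
  obtain ⟨M, hσ, hfM, hgM, hhM, hae⟩ := exists_common_density hf hg hh hsum
  have hσf := hf.sigmaFinite
  have hσg := hg.sigmaFinite
  have hσh := hh.sigmaFinite
  have hfi := integrableOn_rnDeriv_smul hfM (measurableSet_Iic (a := t))
    (integrableOn_semigroup_apply hS hf.isPolar.stronglyMeasurable (hf.isPolar.integrableOn t))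
  have hgi := integrableOn_rnDeriv_smul hgM (measurableSet_Iic (a := t))
    (integrableOn_semigroup_apply hS hg.isPolar.stronglyMeasurable (hg.isPolar.integrableOn t))
  have h1 := integral_add (hfi.smul a) (hgi.smul b)
  simp only [Pi.smul_apply] at h1
  rw [convolution, convolution, convolution, ← setIntegral_rnDeriv_smul hfM _ measurableSet_Iic,
    ← setIntegral_rnDeriv_smul hgM _ measurableSet_Iic,
    ← setIntegral_rnDeriv_smul hhM _ measurableSet_Iic, ← integral_smul, ← integral_smul, ← h1]
  refine integral_congr_ae (ae_restrict_of_ae ?_)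
  filter_upwards [hae] with s hs
  rw [← map_smul, hs, map_add, map_smul, map_smul, map_smul, map_smul]

lemma convolution_nonneg [PartialOrder E] [IsOrderedAddMonoid E] [IsOrderedModule ℝ E]
    [OrderClosedTopology E] (hS0 : ∀ t x, 0 ≤ x → 0 ≤ S t x) {m : Measure (Horizon T)}
    {ρ : Horizon T → E} (hρ : ∀ᵐ s ∂m, 0 ≤ ρ s) (t : Horizon T) : 0 ≤ convolution S m ρ t :=
  integral_nonneg_of_ae (ae_restrict_of_ae (hρ.mono fun _ hs => hS0 _ _ hs))

end Semigroup

/-! ### Right-continuous processes -/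

section RightContinuousProcess

variable {T : ℝ≥0∞} {Ω : Type*} {E : Type*}

/-- The grid `i / (n + 1)`, stopped at `t`. -/
def Horizon.gridPoint (t : Horizon T) (n i : ℕ) : Horizon T :=
  Horizon.clip T ((i : ℝ≥0) / ((n : ℝ≥0) + 1)) ⊓ t

/-- The next point of the grid `i / (n + 1)` strictly after `s`, stopped at `t`. -/
def Horizon.roundUp (t : Horizon T) (n : ℕ) (s : Horizon T) : Horizon T :=
  Horizon.gridPoint t n (⌊s.1 * ((n : ℝ≥0) + 1)⌋₊ + 1)

lemma Horizon.gridPoint_le (t : Horizon T) (n i : ℕ) : Horizon.gridPoint t n i ≤ t := inf_le_right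

lemma Horizon.monotone_gridPoint (t : Horizon T) (n : ℕ) : Monotone (Horizon.gridPoint t n) :=
  fun i j hij => inf_le_inf_right _ (Horizon.clip_mono (by gcongr))

lemma Horizon.monotone_roundUp (t : Horizon T) (n : ℕ) : Monotone (Horizon.roundUp t n) :=
  fun s s' hs => Horizon.monotone_gridPoint t n (Nat.succ_le_succ (Nat.floor_mono (by
    have : s.1 ≤ s'.1 := hs
    gcongr)))

lemma Horizon.le_roundUp {t s : Horizon T} (hs : s ≤ t) (n : ℕ) : s ≤ Horizon.roundUp t n s := by
  refine le_inf (Horizon.le_clip_iff.2 ?_) hs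
  rw [le_div_iff₀ (by positivity)]
  exact_mod_cast (Nat.lt_floor_add_one _).le

lemma Horizon.tendsto_roundUp {t s : Horizon T} (hs : s ≤ t) :
    Tendsto (fun n => Horizon.roundUp t n s) atTop (𝓝[Ici s] s) := by
  refine tendsto_nhdsWithin_iff.2 ⟨?_, Eventually.of_forall fun n => Horizon.le_roundUp hs n⟩
  have h1 : Tendsto (fun n : ℕ => ((⌊s.1 * ((n : ℝ≥0) + 1)⌋₊ + 1 : ℕ) : ℝ≥0) / ((n : ℝ≥0) + 1))
      atTop (𝓝 s.1) := by
    have hlim : Tendsto (fun n : ℕ => s.1 + 1 / ((n : ℝ≥0) + 1)) atTop (𝓝 s.1) := by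
      have : Tendsto (fun n : ℕ => 1 / ((n : ℝ≥0) + 1)) atTop (𝓝 0) := by
        rw [← NNReal.tendsto_coe]
        push_cast
        exact tendsto_one_div_add_atTop_nhds_zero_nat
      simpa using tendsto_const_nhds.add this
    refine tendsto_of_tendsto_of_tendsto_of_le_of_le tendsto_const_nhds hlim (fun n => ?_)
      fun n => ?_
    · beta_reduce
      rw [le_div_iff₀ (by positivity)]
      exact_mod_cast (Nat.lt_floor_add_one _).le
    · beta_reduce
      rw [div_le_iff₀ (by positivity), add_mul, one_div, inv_mul_cancel₀ (by positivity)]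
      push_cast
      exact add_le_add_left (Nat.floor_le bot_le) 1
  have h2 := ((Horizon.continuous_clip (T := T)).tendsto s.1).comp h1
  rw [Horizon.clip_coe] at h2
  have h3 := h2.min (tendsto_const_nhds (x := t))
  rwa [min_eq_left hs] at h3

variable [TopologicalSpace E] [TopologicalSpace.PseudoMetrizableSpace E]

lemma stronglyMeasurable_restrict_of_rightContinuous {m : MeasurableSpace Ω}
    {X : Horizon T → Ω → E} (t : Horizon T) (hX : ∀ s ≤ t, StronglyMeasurable[m] (X s))
    (hc : ∀ ω s, ContinuousWithinAt (fun r => X r ω) (Ici s) s) :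
    StronglyMeasurable fun p : Iic t × Ω => X p.1 p.2 := by
  refine stronglyMeasurable_of_tendsto (f := fun n (p : Iic t × Ω) =>
    X (Horizon.roundUp t n p.1) p.2) atTop (fun n => ?_) (tendsto_pi_nhds.2 fun p => ?_)
  · have h1 : StronglyMeasurable (Function.uncurry fun (i : ℕ) (ω : Ω) =>
        X (Horizon.gridPoint t n i) ω) :=
      stronglyMeasurable_uncurry_of_continuous_of_stronglyMeasurable
        (fun ω => continuous_of_discreteTopology) fun i => hX _ (Horizon.gridPoint_le t n i)
    have h2 : Measurable fun p : Iic t × Ω =>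
        ((⌊p.1.1.1 * ((n : ℝ≥0) + 1)⌋₊ + 1 : ℕ), p.2) := by
      refine Measurable.prodMk ?_ measurable_snd
      refine Measurable.add_const (Nat.measurable_floor.comp ?_) 1
      exact (measurable_subtype_coe.comp (measurable_subtype_coe.comp measurable_fst)).mul_const _
    have h3 := h1.comp_measurable h2
    simp only [Function.comp_def, Function.uncurry] at h3
    exact h3
  · exact (hc p.2 p.1).tendsto.comp (Horizon.tendsto_roundUp p.1.2)

lemma stronglyMeasurable_of_restrict_grid {m : MeasurableSpace Ω} {X : Horizon T → Ω → E}
    (h : ∀ n, StronglyMeasurable fun p : Iic (Horizon.grid T n) × Ω => X p.1 p.2) :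
    StronglyMeasurable fun p : Horizon T × Ω => X p.1 p.2 := by
  refine stronglyMeasurable_of_tendsto (f := fun n (p : Horizon T × Ω) =>
    X (p.1 ⊓ Horizon.grid T n) p.2) atTop (fun n => ?_) (tendsto_pi_nhds.2 fun p => ?_)
  · have h2 : Measurable fun p : Horizon T × Ω =>
        ((⟨p.1 ⊓ Horizon.grid T n, mem_Iic.2 inf_le_right⟩ : Iic (Horizon.grid T n)), p.2) :=
      Measurable.prodMk (Measurable.subtype_mk (measurable_fst.min measurable_const)) measurable_snd
    exact (h n).comp_measurable h2
  · refine tendsto_const_nhds.congr' ?_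
    obtain ⟨n, hn⟩ := p.1.exists_le_grid
    filter_upwards [eventually_ge_atTop n] with k hk
    rw [inf_eq_left.2 (hn.trans (Horizon.grid_mono hk))]

lemma _root_.MeasureTheory.IsStronglyProgressive.stronglyMeasurable_uncurry {mΩ : MeasurableSpace Ω}
    {𝓕 : Filtration (Horizon T) mΩ} {X : Horizon T → Ω → E} (h : IsStronglyProgressive 𝓕 X) :
    StronglyMeasurable fun p : Horizon T × Ω => X p.1 p.2 :=
  stronglyMeasurable_of_restrict_grid fun _ => (h _).mono
    (sup_le_sup_left (MeasurableSpace.comap_mono (𝓕.le _)) _)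

end RightContinuousProcess

lemma continuousWithinAt_measureReal_Iic {T : ℝ≥0∞} {m : Measure (Horizon T)}
    (hm : ∀ t, m (Iic t) < ∞) (t : Horizon T) :
    ContinuousWithinAt (fun t => m.real (Iic t)) (Ici t) t := by
  refine continuousWithinAt_Ioi_iff_Ici.1 ?_
  by_cases ht : IsMax t
  · rw [ht.Ioi_eq]
    simp [ContinuousWithinAt]
  obtain ⟨u, hu⟩ := not_isMax_iff.1 ht
  have h1 := tendsto_measure_biInter_gt (μ := m) (s := Iic) (a := t)
    (fun r _ => measurableSet_Iic.nullMeasurableSet) (fun i j _ hij => Iic_subset_Iic.2 hij)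
    ⟨u, hu, (hm u).ne⟩
  have h2 : ⋂ r > t, Iic r = Iic t := by
    ext s
    simp only [mem_iInter, mem_Iic]
    exact ⟨fun h => le_of_forall_gt_imp_ge_of_dense h, fun h r hr => h.trans hr.le⟩
  rw [h2] at h1
  exact (ENNReal.tendsto_toReal (hm t).ne).comp h1

/-! ### Measurability of the variation -/

section VariationProcess

variable {T : ℝ≥0∞} {Ω : Type*} {E : Type*} [NormedAddCommGroup E]

/-- The variation of a right-continuous path is the supremum of its variations along the grids. -/
lemma eVariationOn_Iic_eq_iSup {f : Horizon T → E}
    (hf : ∀ s, ContinuousWithinAt f (Ici s) s) (t : Horizon T) :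
    eVariationOn f (Iic t) = ⨆ n : ℕ, ∑ i ∈ Finset.range (⌊t.1 * ((n : ℝ≥0) + 1)⌋₊ + 1),
      edist (f (Horizon.gridPoint t n i)) (f (Horizon.gridPoint t n (i + 1))) := by
  simp_rw [← eVariationOn.image_range_of_monotone f (Horizon.monotone_gridPoint t _)]
  refine le_antisymm ?_ (iSup_le fun n => eVariationOn.mono _ ?_)
  · refine le_of_forall_lt fun v hv => ?_
    have h1 := eVariationOn.lowerSemicontinuous_aux (F := fun n => f ∘ Horizon.roundUp t n)
      (p := atTop) (fun s hs => (hf s).tendsto.comp (Horizon.tendsto_roundUp hs)) hv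
    obtain ⟨n, hn⟩ := h1.exists
    refine hn.trans_le ((eVariationOn.comp_le_of_monotoneOn f _
      ((Horizon.monotone_roundUp t n).monotoneOn _) fun s hs => ?_).trans
      (le_iSup (fun n : ℕ => eVariationOn f
        (Horizon.gridPoint t n '' Iic (⌊t.1 * ((n : ℝ≥0) + 1)⌋₊ + 1))) n))
    refine ⟨_, mem_Iic.2 (Nat.succ_le_succ (Nat.floor_mono ?_)), rfl⟩
    have : s.1 ≤ t.1 := hs
    gcongr
  · rintro _ ⟨i, _, rfl⟩
    exact Horizon.gridPoint_le t n i

lemma measurable_eVariationOn {m : MeasurableSpace Ω} {X : Horizon T → Ω → E} (t : Horizon T)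
    (hX : ∀ s ≤ t, StronglyMeasurable[m] (X s))
    (hc : ∀ ω s, ContinuousWithinAt (fun r => X r ω) (Ici s) s) :
    Measurable fun ω => eVariationOn (fun s => X s ω) (Iic t) := by
  simp_rw [fun ω => eVariationOn_Iic_eq_iSup (hc ω) t]
  refine Measurable.iSup fun n => Finset.measurable_fun_sum _ fun i _ => ?_
  simp_rw [edist_eq_enorm_sub]
  exact ((hX _ (Horizon.gridPoint_le t n i)).sub (hX _ (Horizon.gridPoint_le t n (i + 1)))).enorm

end VariationProcess

/-! ### Controls with regular paths and their densities -/

section RegularControl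

variable {T : ℝ≥0∞} {Ω : Type*} {mΩ : MeasurableSpace Ω} {E : Type*} [NormedAddCommGroup E]
  [NormedSpace ℝ E] [PartialOrder E]

/-- An adapted process all of whose paths, and not only almost all, are nonnegative, nondecreasing,
right-continuous and of finite variation. -/
structure IsRegularControl (𝓕 : Filtration (Horizon T) mΩ) (ν : Horizon T → Ω → E) : Prop where
  adapted : StronglyAdapted 𝓕 ν
  path : ∀ ω, IsMonotonePath fun t => ν t ω

/-- The variation on `[0, t]` as a process. -/
def variationProcess (ν : Horizon T → Ω → E) (t : Horizon T) (ω : Ω) : ℝ :=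
  (variationMeasure fun s => ν s ω).real (Iic t)

variable [CompleteSpace E] [HasPathDensity E] {𝓕 : Filtration (Horizon T) mΩ}
  {ν : Horizon T → Ω → E}

lemma IsRegularControl.stronglyAdapted_variationProcess (hν : IsRegularControl 𝓕 ν) :
    StronglyAdapted 𝓕 (variationProcess ν) := by
  intro t
  have h : variationProcess ν t = fun ω =>
      (‖ν (Horizon.zero T) ω‖ₑ + eVariationOn (fun s => ν s ω) (Iic t)).toReal := by
    funext ω
    rw [variationProcess, measureReal_def, (hν.path ω).isPolar.mass]
  have h1 : Measurable[𝓕 t] fun ω => ‖ν (Horizon.zero T) ω‖ₑ :=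
    ((hν.adapted _).mono (𝓕.mono (Horizon.zero_le t))).enorm
  have h2 : Measurable[𝓕 t] fun ω => eVariationOn (fun s => ν s ω) (Iic t) :=
    measurable_eVariationOn t (fun s hs => (hν.adapted s).mono (𝓕.mono hs))
      fun ω => (hν.path ω).rightContinuous
  rw [h]
  exact (h1.add h2).ennreal_toReal.stronglyMeasurable

lemma stronglyMeasurable_lineExtension {F : Type*} [NormedAddCommGroup F] [NormedSpace ℝ F]
    {X : Horizon T → Ω → F} (hX : StronglyAdapted 𝓕 X)
    (hc : ∀ ω s, ContinuousWithinAt (fun r => X r ω) (Ici s) s) {a t : Horizon T}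
    {r : Iic a → ℝ} (hr : Measurable r) (hrt : ∀ s, Horizon.clip T (r s).toNNReal ≤ t) :
    StronglyMeasurable[Subtype.instMeasurableSpace.prod (𝓕 t)] fun p : Iic a × Ω =>
      lineExtension (fun s => X s p.2) (r p.1) := by
  let _ : MeasurableSpace Ω := 𝓕 t
  refine StronglyMeasurable.ite (measurableSet_lt (hr.comp measurable_fst) measurable_const)
    stronglyMeasurable_const ?_
  have h1 := stronglyMeasurable_restrict_of_rightContinuous (m := 𝓕 t) t
    (fun s hs => (hX s).mono (𝓕.mono hs)) hc
  have h2 : Measurable fun p : Iic a × Ω =>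
      ((⟨Horizon.clip T (r p.1).toNNReal, hrt p.1⟩ : Iic t), p.2) :=
    Measurable.prodMk (Measurable.subtype_mk (Horizon.continuous_clip.measurable.comp
      (hr.comp measurable_fst).real_toNNReal)) measurable_snd
  exact h1.comp_measurable h2

lemma IsRegularControl.stronglyMeasurable_quotient (hν : IsRegularControl 𝓕 ν) {a t : Horizon T}
    {n : ℕ} (hat : Horizon.clip T ((a.1 : ℝ) + 1 / ((n : ℝ) + 1)).toNNReal ≤ t) (k : ℕ) :
    StronglyMeasurable[Subtype.instMeasurableSpace.prod (𝓕 t)] fun p : Iic a × Ω =>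
      quotient (fun s => variationProcess ν s p.2) (fun s => ν s p.2) n k p.1 := by
  let _ : MeasurableSpace Ω := 𝓕 t
  have hcoe : Measurable fun s : Iic a => (s.1.1 : ℝ) :=
    Horizon.measurable_coe.comp measurable_subtype_coe
  have h1 : ∀ s : Iic a, Horizon.clip T ((s.1.1 : ℝ) + 1 / ((n : ℝ) + 1)).toNNReal ≤ t := fun s =>
    (Horizon.clip_mono (Real.toNNReal_le_toNNReal (by
      have : (s.1.1 : ℝ) ≤ a.1 := s.2
      linarith))).trans hat
  have h2 : ∀ s : Iic a, Horizon.clip T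
      ((s.1.1 : ℝ) - 1 / ((n : ℝ) + 1) - 1 / ((k : ℝ) + 1)).toNNReal ≤ t := fun s =>
    (Horizon.clip_mono (Real.toNNReal_le_toNNReal (by
      have h3 : 0 < 1 / ((n : ℝ) + 1) := by positivity
      have h4 : 0 < 1 / ((k : ℝ) + 1) := by positivity
      linarith))).trans (h1 s)
  have hVc : ∀ ω s, ContinuousWithinAt (fun r => variationProcess ν r ω) (Ici s) s :=
    fun ω s =>
      continuousWithinAt_measureReal_Iic (hν.path ω).variationMeasure_Iic_lt_top s
  have hνc : ∀ ω s, ContinuousWithinAt (fun r => ν r ω) (Ici s) s :=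
    fun ω s => (hν.path ω).rightContinuous s
  have hV := hν.stronglyAdapted_variationProcess
  exact ((stronglyMeasurable_lineExtension hV hVc (hcoe.add_const _) h1).sub
    (stronglyMeasurable_lineExtension hV hVc
      ((hcoe.sub_const _).sub_const _) h2)).measurable.inv.stronglyMeasurable.smul
    ((stronglyMeasurable_lineExtension hν.adapted hνc (hcoe.add_const _) h1).sub
    (stronglyMeasurable_lineExtension hν.adapted hνc ((hcoe.sub_const _).sub_const _) h2))

/-- A version of the density of a control which is measurable in time and randomness: the limit of
the difference quotients over shrinking neighbourhoods. -/
def densityProcess (ν : Horizon T → Ω → E) (s : Horizon T) (ω : Ω) : E :=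
  limUnder atTop fun n => limUnder atTop fun k =>
    quotient (fun t => variationProcess ν t ω) (fun t => ν t ω) n k s

lemma IsRegularControl.densityProcess_ae_eq (hν : IsRegularControl 𝓕 ν) (ω : Ω) :
    (fun s => densityProcess ν s ω) =ᵐ[variationMeasure fun s => ν s ω]
      polarDensity fun s => ν s ω := by
  filter_upwards [ae_tendsto_quotient (hν.path ω).variationMeasure_Iic_lt_top
    (hν.path ω).isPolar.integrableOn (hν.path ω).isPolar.density] with s hs
  obtain ⟨L, h1, h2⟩ := hs
  have h3 : (fun n => limUnder atTop fun k =>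
      quotient (fun t => variationProcess ν t ω) (fun t => ν t ω) n k s) = L :=
    funext fun n => (h1 n).limUnder_eq
  rw [densityProcess, h3]
  exact h2.limUnder_eq

lemma limUnder_atTop_add {F : Type*} [TopologicalSpace F] [Nonempty F] (f : ℕ → F) (k : ℕ) :
    (limUnder atTop fun n => f (n + k)) = limUnder atTop f := by
  unfold limUnder
  congr 1
  exact (Filter.map_map (m := (· + k)) (m' := f) (f := atTop)).symm.trans
    (by rw [Filter.map_add_atTop_eq_nat])

/-- Up to time `a`, the density is measurable with respect to the information at each later time `t`;
the difference quotients of `densityProcess` look ahead, but eventually not beyond `t`. -/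
lemma IsRegularControl.stronglyMeasurable_densityProcess_restrict (hν : IsRegularControl 𝓕 ν)
    {a t : Horizon T} (hat : a < t ∨ (a = t ∧ IsMax t)) :
    StronglyMeasurable[Subtype.instMeasurableSpace.prod (𝓕 t)] fun p : Iic a × Ω =>
      densityProcess ν p.1 p.2 := by
  let _ : MeasurableSpace Ω := 𝓕 t
  obtain ⟨n₀, hn₀⟩ : ∃ n₀ : ℕ, ∀ n,
      Horizon.clip T ((a.1 : ℝ) + 1 / (((n + n₀ : ℕ) : ℝ) + 1)).toNNReal ≤ t := by
    rcases hat with h | ⟨rfl, h⟩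
    · have h' : (0 : ℝ) < t.1 - a.1 := by
        have : (a.1 : ℝ) < t.1 := h
        linarith
      obtain ⟨n₀, hn₀⟩ := exists_nat_one_div_lt h'
      refine ⟨n₀, fun n => ?_⟩
      refine Subtype.coe_le_coe.1 ((Horizon.clip_le _).trans ?_)
      rw [Real.toNNReal_le_iff_le_coe]
      have : 1 / (((n + n₀ : ℕ) : ℝ) + 1) ≤ 1 / ((n₀ : ℝ) + 1) :=
        one_div_le_one_div_of_le (by positivity) (by push_cast; linarith [n.cast_nonneg (α := ℝ)])
      linarith
    · exact ⟨0, fun n => (le_total _ a).elim id fun h1 => h h1⟩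
  have h1 : ∀ n, StronglyMeasurable fun p : Iic a × Ω => limUnder atTop fun k =>
      quotient (fun s => variationProcess ν s p.2) (fun s => ν s p.2) (n + n₀) k p.1 :=
    fun n => StronglyMeasurable.limUnder fun k => hν.stronglyMeasurable_quotient (hn₀ n) k
  have h2 := StronglyMeasurable.limUnder (l := atTop) h1
  have h3 : (fun p : Iic a × Ω => densityProcess ν p.1 p.2) = fun p => limUnder atTop fun n =>
      limUnder atTop fun k =>
        quotient (fun s => variationProcess ν s p.2) (fun s => ν s p.2) (n + n₀) k p.1 :=
    funext fun p => (limUnder_atTop_add (fun n => limUnder atTop fun k =>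
      quotient (fun s => variationProcess ν s p.2) (fun s => ν s p.2) n k p.1) n₀).symm
  rw [h3]
  exact h2

/-- For a right-continuous filtration, the limit of difference quotients over intervals which extend
beyond the present does not anticipate. -/
lemma IsRegularControl.stronglyProgressive_densityProcess [𝓕.IsRightContinuous]
    (hν : IsRegularControl 𝓕 ν) : IsStronglyProgressive 𝓕 (densityProcess ν) := by
  intro t
  by_cases ht : IsMax t
  · exact hν.stronglyMeasurable_densityProcess_restrict (Or.inr ⟨rfl, ht⟩)
  have hsec : ∀ u, t < u → StronglyMeasurable[𝓕 u] (densityProcess ν t) := fun u hu => by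
    let _ : MeasurableSpace Ω := 𝓕 u
    exact (hν.stronglyMeasurable_densityProcess_restrict (Or.inl hu)).comp_measurable
      (g := fun ω : Ω => ((⟨t, mem_Iic.2 le_rfl⟩ : Iic t), ω))
      (measurable_const.prodMk measurable_id)
  -- the value at the present time is known immediately after it, hence at it by right continuity
  have hadapt : StronglyMeasurable[𝓕 t] (densityProcess ν t) := by
    borelize E
    obtain ⟨u, hu⟩ := not_isMax_iff.1 ht
    refine (@stronglyMeasurable_iff_measurable_separable _ _ (densityProcess ν t) (𝓕 t) _ _ _ _).2
      ⟨fun B hB => ?_, (hsec u hu).isSeparable_range⟩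
    refine Filtration.IsRightContinuous.measurableSet ?_
    rw [Filtration.rightCont_eq_of_not_isMax _ ht]
    simp only [MeasurableSpace.measurableSet_iInf]
    exact fun u hu => (hsec u hu).measurable hB
  let _ : MeasurableSpace Ω := 𝓕 t
  have hconst : StronglyMeasurable fun p : Iic t × Ω => densityProcess ν t p.2 :=
    hadapt.comp_measurable measurable_snd
  rcases (Horizon.zero_le t).eq_or_lt with h0 | h0
  · have h1 : (fun p : Iic t × Ω => densityProcess ν p.1 p.2) = fun p => densityProcess ν t p.2 :=
      funext fun p => by
        rw [le_antisymm (show p.1.1 ≤ t from p.1.2) (h0.ge.trans (Horizon.zero_le _))]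
    rw [h1]
    exact hconst
  -- strictly before `t` the process is a limit of its restrictions to `[0, a n]` with `a n < t`
  obtain ⟨a, -, hat, ha⟩ := exists_seq_strictMono_tendsto' h0
  refine stronglyMeasurable_of_tendsto (f := fun n (p : Iic t × Ω) =>
    if p.1.1 ≤ a n then densityProcess ν (p.1.1 ⊓ a n) p.2 else densityProcess ν t p.2) atTop
    (fun n => ?_) (tendsto_pi_nhds.2 fun p => ?_)
  · refine StronglyMeasurable.ite (measurableSet_le (measurable_subtype_coe.comp measurable_fst)
      measurable_const) ?_ hconst
    have h2 : Measurable fun p : Iic t × Ω =>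
        ((⟨p.1.1 ⊓ a n, mem_Iic.2 inf_le_right⟩ : Iic (a n)), p.2) :=
      Measurable.prodMk (Measurable.subtype_mk
        ((measurable_subtype_coe.comp measurable_fst).min measurable_const)) measurable_snd
    have h3 := (hν.stronglyMeasurable_densityProcess_restrict (Or.inl (hat n).2)).comp_measurable h2
    simp only [Function.comp_def] at h3
    exact h3
  · refine tendsto_const_nhds.congr' ?_
    rcases eq_or_lt_of_le (show p.1.1 ≤ t from p.1.2) with hp | hp
    · refine Eventually.of_forall fun n => ?_
      beta_reduce
      rw [if_neg (by rw [hp]; exact (hat n).2.not_ge), hp]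
    · filter_upwards [ha.eventually (eventually_ge_nhds hp)] with n hn
      rw [if_pos hn, inf_eq_left.2 hn]

end RegularControl

/-! ### Time change by hitting times -/

section TimeChange

variable {T : ℝ≥0∞} {V : Horizon T → ℝ} {m : Measure (Horizon T)}

/-- The times at which `V` has reached the level `u`, or which are not before `N`, form a closed
upward ray. -/
lemma Horizon.exists_hitting (hV : Monotone V) (hc : ∀ t, ContinuousWithinAt V (Ici t) t)
    (N : Horizon T) (u : ℝ) : ∃ τ : Horizon T, ∀ t, τ ≤ t ↔ u ≤ V t ∨ N ≤ t := by
  set A : Set (Horizon T) := {t | u ≤ V t ∨ N ≤ t} with hA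
  have hclosed : IsClosed A := by
    rw [← isOpen_compl_iff, isOpen_iff_mem_nhds]
    intro t ht
    simp only [hA, mem_compl_iff, mem_ofPred_eq, not_or, not_le] at ht
    rw [← nhdsLE_sup_nhdsGE]
    refine ⟨?_, ?_⟩
    · filter_upwards [self_mem_nhdsWithin] with s hs
      simp only [hA, mem_compl_iff, mem_ofPred_eq, not_or, not_le]
      exact ⟨(hV hs).trans_lt ht.1, lt_of_le_of_lt hs ht.2⟩
    · filter_upwards [(hc t).eventually (eventually_lt_nhds ht.1),
        mem_nhdsWithin_of_mem_nhds (Iio_mem_nhds ht.2)] with s h1 h2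
      simp only [hA, mem_compl_iff, mem_ofPred_eq, not_or, not_le]
      exact ⟨h1, h2⟩
  obtain ⟨τ, hτ, hmin⟩ := (isCompact_Icc (a := Horizon.zero T) (b := N)).inter_right hclosed
    |>.exists_isLeast ⟨N, ⟨Horizon.zero_le N, le_rfl⟩, Or.inr le_rfl⟩
  refine ⟨τ, fun t => ⟨fun h => ?_, fun h => ?_⟩⟩
  · exact hτ.2.imp (fun h1 => h1.trans (hV h)) fun h1 => h1.trans h
  · rcases le_total t N with h1 | h1
    · exact hmin ⟨⟨Horizon.zero_le t, h1⟩, h⟩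
    · exact hτ.1.2.trans h1

open Classical in
/-- The first time before `N` at which the nondecreasing function `V` reaches the level `u`; it is
`N` if the level is not reached. -/
def hitting (V : Horizon T → ℝ) (N : Horizon T) (u : ℝ) : Horizon T :=
  if h : ∃ τ : Horizon T, ∀ t, τ ≤ t ↔ u ≤ V t ∨ N ≤ t then h.choose else N

lemma hitting_le_iff (hV : Monotone V) (hc : ∀ t, ContinuousWithinAt V (Ici t) t)
    (N : Horizon T) (u : ℝ) (t : Horizon T) : hitting V N u ≤ t ↔ u ≤ V t ∨ N ≤ t := by
  have h := Horizon.exists_hitting hV hc N u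
  rw [hitting, dif_pos h]
  exact h.choose_spec t

lemma measurable_hitting {α : Type*} [MeasurableSpace α] {V : α → Horizon T → ℝ}
    (hV : ∀ a, Monotone (V a)) (hc : ∀ a t, ContinuousWithinAt (V a) (Ici t) t)
    (hVm : ∀ t, Measurable fun a => V a t) (N : Horizon T) :
    Measurable fun p : α × ℝ => hitting (V p.1) N p.2 := by
  refine measurable_of_Iic fun t => ?_
  have h : (fun p : α × ℝ => hitting (V p.1) N p.2) ⁻¹' Iic t =
      {p | p.2 ≤ V p.1 t} ∪ {_p | N ≤ t} := by
    ext p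
    exact hitting_le_iff (hV _) (hc _) _ _ _
  rw [h]
  exact (measurableSet_le measurable_snd ((hVm t).comp measurable_fst)).union (.const _)

/-- Time change: the variation measure is the image of Lebesgue measure under the hitting times of
its distribution function. -/
lemma map_hitting (hm : ∀ t, m (Iic t) < ∞) (N : Horizon T) :
    (volume.restrict (Ioc 0 (m.real (Iic N)))).map (hitting (fun t => m.real (Iic t)) N) =
      m.restrict (Iic N) := by
  have hV := monotone_measureReal_Iic hm
  have hc := continuousWithinAt_measureReal_Iic hm
  have hmeas : Measurable (hitting (fun t => m.real (Iic t)) N) :=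
    (measurable_hitting (α := Unit) (V := fun _ t => m.real (Iic t)) (fun _ => hV) (fun _ => hc)
      (fun _ => measurable_const) N).comp ((measurable_const (a := ())).prodMk measurable_id)
  symm
  refine measure_ext_of_Iic (fun t => (Measure.restrict_apply_le _ _).trans_lt (hm t)) fun t => ?_
  rw [Measure.map_apply hmeas measurableSet_Iic,
    Measure.restrict_apply measurableSet_Iic, Measure.restrict_apply (hmeas measurableSet_Iic)]
  have hpre : hitting (fun t => m.real (Iic t)) N ⁻¹' Iic t = {u | u ≤ m.real (Iic t) ∨ N ≤ t} :=
    ext fun u => hitting_le_iff hV hc N u t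
  rw [hpre, Iic_inter_Iic]
  have hset : {u | u ≤ m.real (Iic t) ∨ N ≤ t} ∩ Ioc 0 (m.real (Iic N)) =
      Ioc 0 (m.real (Iic (t ⊓ N))) := by
    ext u
    rcases le_total N t with h | h
    · simp [h]
    · rw [inf_eq_left.2 h]
      rcases h.eq_or_lt with rfl | h'
      · simp
      · simp only [not_le.2 h', or_false, mem_inter_iff, mem_ofPred_eq, mem_Ioc]
        exact ⟨fun h1 => ⟨h1.2.1, h1.1⟩, fun h1 => ⟨h1.2, h1.1, h1.2.trans (hV h)⟩⟩
  rw [hset, Real.volume_Ioc, sub_zero, ofReal_measureReal (hm _).ne]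

end TimeChange

/-! ### Integrals against measures that depend on a parameter -/

section Parameter

variable {T : ℝ≥0∞} {α : Type*} [MeasurableSpace α] {m : α → Measure (Horizon T)}
  (hm : ∀ a t, m a (Iic t) < ∞) (hmm : ∀ t, Measurable fun a => (m a).real (Iic t))

include hm hmm

lemma measurable_hitting_measureReal (N : Horizon T) :
    Measurable fun p : α × ℝ => hitting (fun t => (m p.1).real (Iic t)) N p.2 :=
  measurable_hitting (V := fun a t => (m a).real (Iic t)) (fun a => monotone_measureReal_Iic (hm a))
    (fun a => continuousWithinAt_measureReal_Iic (hm a)) hmm N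

/-- The time change turns an integral against a measure that depends on a parameter into a Lebesgue
integral of a function that depends on it. Joint measurability questions thus reduce to products with
a fixed measure, and no kernel is needed. -/
lemma setLIntegral_Iic_eq_hitting {H : Horizon T → ℝ≥0∞} (hH : Measurable H) (N : Horizon T)
    (a : α) : ∫⁻ s in Iic N, H s ∂(m a) = ∫⁻ u, (Ioc 0 ((m a).real (Iic N))).indicator
      (fun u => H (hitting (fun t => (m a).real (Iic t)) N u)) u := by
  have h1 : Measurable fun u => hitting (fun t => (m a).real (Iic t)) N u :=
    (measurable_hitting_measureReal hm hmm N).comp measurable_prodMk_left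
  rw [← map_hitting (hm a) N, lintegral_map hH h1, lintegral_indicator measurableSet_Ioc]

lemma measurable_setLIntegral_Iic {H : α × Horizon T → ℝ≥0∞} (hH : Measurable H) (N : Horizon T) :
    Measurable fun a => ∫⁻ s in Iic N, H (a, s) ∂(m a) := by
  have h2 := measurable_hitting_measureReal hm hmm N
  have h : ∀ a, ∫⁻ s in Iic N, H (a, s) ∂(m a) = ∫⁻ u, (Ioc 0 ((m a).real (Iic N))).indicator
      (fun u => H (a, hitting (fun t => (m a).real (Iic t)) N u)) u := fun a =>
    setLIntegral_Iic_eq_hitting hm hmm (H := fun s => H (a, s)) (hH.comp measurable_prodMk_left) N a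
  simp_rw [h]
  have h3 : MeasurableSet {p : α × ℝ | p.2 ∈ Ioc 0 ((m p.1).real (Iic N))} :=
    (measurableSet_lt measurable_const measurable_snd).inter
      (measurableSet_le measurable_snd ((hmm N).comp measurable_fst))
  exact Measurable.lintegral_prod_right'
    ((hH.comp (measurable_fst.prodMk h2)).indicator h3)

lemma measurable_lintegral_family {H : α × Horizon T → ℝ≥0∞} (hH : Measurable H) :
    Measurable fun a => ∫⁻ s, H (a, s) ∂(m a) := by
  have h : ∀ a, ∫⁻ s, H (a, s) ∂(m a) = ⨆ n, ∫⁻ s in Iic (Horizon.grid T n), H (a, s) ∂(m a) :=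
    fun a => by
      rw [← setLIntegral_univ, ← Horizon.iUnion_Iic_grid, setLIntegral_iUnion_of_directed]
      exact (monotone_Iic.comp Horizon.grid_mono).directed_le
  simp_rw [h]
  exact Measurable.iSup fun n => measurable_setLIntegral_Iic hm hmm hH _

lemma stronglyMeasurable_setIntegral_Iic {F : Type*} [NormedAddCommGroup F] [NormedSpace ℝ F]
    {H : α × Horizon T → F} (hH : StronglyMeasurable H) (N : Horizon T) :
    StronglyMeasurable fun a => ∫ s in Iic N, H (a, s) ∂(m a) := by
  have h2 := measurable_hitting_measureReal hm hmm N
  have h1 : ∀ a, Measurable fun u => hitting (fun t => (m a).real (Iic t)) N u :=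
    fun a => h2.comp measurable_prodMk_left
  have h : ∀ a, ∫ s in Iic N, H (a, s) ∂(m a) = ∫ u, (Ioc 0 ((m a).real (Iic N))).indicator
      (fun u => H (a, hitting (fun t => (m a).real (Iic t)) N u)) u := fun a => by
    rw [← map_hitting (hm a) N, integral_map (f := fun s => H (a, s)) (h1 a).aemeasurable
      (hH.comp_measurable measurable_prodMk_left).aestronglyMeasurable,
      integral_indicator measurableSet_Ioc]
  simp_rw [h]
  have h3 : MeasurableSet {p : α × ℝ | p.2 ∈ Ioc 0 ((m p.1).real (Iic N))} :=
    (measurableSet_lt measurable_const measurable_snd).inter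
      (measurableSet_le measurable_snd ((hmm N).comp measurable_fst))
  exact StronglyMeasurable.integral_prod_right'
    ((hH.comp_measurable (measurable_fst.prodMk h2)).indicator h3)

end Parameter

/-! ### Conditional expectations in the dual -/

section ConditionalExpectation

variable {Ω : Type*} {𝓖 mΩ : MeasurableSpace Ω} {E : Type*} [NormedAddCommGroup E]
  [NormedSpace ℝ E] [Lattice E] [HasSolidNorm E] [IsOrderedAddMonoid E]

/-- A random map on the positive cone with values in `[0, ∞]`, of the kind given by a positive
functional or by a superposition of such functionals. -/
structure IsPositiveIntegrand {Ω : Type*} [MeasurableSpace Ω] {E : Type*} [NormedAddCommGroup E]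
    [PartialOrder E] (g : Ω → E → ℝ≥0∞) : Prop where
  measurable : ∀ Z : Ω → E, StronglyMeasurable Z → 0 ≤ Z → Measurable fun ω => g ω (Z ω)
  add : ∀ ω v w, 0 ≤ v → 0 ≤ w → g ω (v + w) = g ω v + g ω w
  le_liminf : ∀ ω (v : ℕ → E) w, (∀ k, 0 ≤ v k) → 0 ≤ w → Tendsto v atTop (𝓝 w) →
    g ω w ≤ liminf (fun k => g ω (v k)) atTop

lemma IsPositiveIntegrand.mono {Ω : Type*} [MeasurableSpace Ω] {g : Ω → E → ℝ≥0∞}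
    (hg : IsPositiveIntegrand g) {ω : Ω} {v w : E} (hv : 0 ≤ v) (hvw : v ≤ w) : g ω v ≤ g ω w := by
  have h := hg.add ω v (w - v) hv (sub_nonneg.2 hvw)
  rw [add_sub_cancel] at h
  rw [h]
  exact le_self_add

lemma continuous_abs_of_solidNorm : Continuous fun v : E => |v| := continuous_id.sup continuous_neg

variable [CompleteSpace E] {P : Measure Ω} [IsFiniteMeasure P] {Γ : Ω → StrongDual ℝ E}
  {g : Ω → E → ℝ≥0∞}

lemma setLIntegral_condExp_const (h𝓖 : 𝓖 ≤ mΩ) {v : E}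
    (h : (fun ω => ENNReal.ofReal (Γ ω v)) =ᵐ[P] condLExp 𝓖 P (fun ω => g ω v)) {C : Set Ω}
    (hC : MeasurableSet[𝓖] C) :
    ∫⁻ ω in C, ENNReal.ofReal (Γ ω v) ∂P = ∫⁻ ω in C, g ω v ∂P := by
  rw [lintegral_congr_ae (ae_restrict_of_ae h), setLIntegral_condLExp h𝓖 P _ hC]

lemma setLIntegral_condExp_simpleFunc (h𝓖 : 𝓖 ≤ mΩ)
    (h : ∀ v, 0 ≤ v → (fun ω => ENNReal.ofReal (Γ ω v)) =ᵐ[P] condLExp 𝓖 P (fun ω => g ω v))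
    {C : Set Ω} (hC : MeasurableSet[𝓖] C) (Z : @SimpleFunc Ω 𝓖 E) (hZ : ∀ ω, 0 ≤ Z ω) :
    ∫⁻ ω in C, ENNReal.ofReal (Γ ω (Z ω)) ∂P = ∫⁻ ω in C, g ω (Z ω) ∂P := by
  have hm : ∀ x, MeasurableSet[𝓖] (C ∩ Z ⁻¹' {x}) := fun x =>
    hC.inter (@SimpleFunc.measurableSet_fiber _ _ 𝓖 Z x)
  have key : ∀ f : Ω → ℝ≥0∞, ∫⁻ ω in C, f ω ∂P =
      ∑ x ∈ @SimpleFunc.range _ _ 𝓖 Z, ∫⁻ ω in C ∩ Z ⁻¹' {x}, f ω ∂P := fun f => by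
    rw [← lintegral_biUnion_finset]
    · congr 2
      ext ω
      simp
    · intro x _ y _ hxy
      refine Set.disjoint_left.2 fun ω h1 h2 => hxy ?_
      exact (h1.2 : Z ω = x).symm.trans h2.2
    · exact fun x _ => h𝓖 _ (hm x)
  rw [key, key]
  refine Finset.sum_congr rfl fun x hx => ?_
  obtain ⟨ω₀, rfl⟩ := (@SimpleFunc.mem_range _ _ 𝓖 Z x).1 hx
  have h1 : ∀ f : Ω → E → ℝ≥0∞, ∫⁻ ω in C ∩ Z ⁻¹' {Z ω₀}, f ω (Z ω) ∂P =
      ∫⁻ ω in C ∩ Z ⁻¹' {Z ω₀}, f ω (Z ω₀) ∂P := fun f =>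
    setLIntegral_congr_fun (h𝓖 _ (hm _)) fun ω hω => by
      rw [show Z ω = Z ω₀ from hω.2]
  rw [h1 fun ω v => ENNReal.ofReal (Γ ω v), h1 g]
  exact setLIntegral_condExp_const h𝓖 (h _ (hZ ω₀)) (hm _)

/-- Integration of a conditional expectation in the dual against a random element of the positive
cone that is measurable for the conditioning σ-algebra. The function `g` is only lower
semicontinuous, so that the passage from simple elements `Z k` to the limit `Z` uses Fatou's lemma in
one direction and the bound `g (Z k) ≤ g Z + g |Z k - Z|` in the other. -/
lemma setLIntegral_condExp_apply (h𝓖 : 𝓖 ≤ mΩ) (hg : @IsPositiveIntegrand Ω mΩ E _ _ g)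
    (hΓm : StronglyMeasurable[𝓖] Γ)
    (h : ∀ v, 0 ≤ v → (fun ω => ENNReal.ofReal (Γ ω v)) =ᵐ[P] condLExp 𝓖 P (fun ω => g ω v))
    {C : Set Ω} (hC : MeasurableSet[𝓖] C) {Z : Ω → E} (hZ : StronglyMeasurable[𝓖] Z)
    (hZ0 : 0 ≤ Z) :
    ∫⁻ ω in C, ENNReal.ofReal (Γ ω (Z ω)) ∂P = ∫⁻ ω in C, g ω (Z ω) ∂P := by
  -- positive simple approximations which stay bounded by `c`
  have happrox : ∀ W : Ω → E, ∀ hW : StronglyMeasurable[𝓖] W, 0 ≤ W → ∀ c : ℝ, 0 ≤ c →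
      ∃ Zk : ℕ → @SimpleFunc Ω 𝓖 E, (∀ k ω, 0 ≤ Zk k ω) ∧ (∀ k ω, ‖Zk k ω‖ ≤ c) ∧
        ∀ ω, ‖W ω‖ ≤ c → Tendsto (fun k => Zk k ω) atTop (𝓝 (W ω)) := by
    intro W hW hW0 c hc
    refine ⟨fun k => @SimpleFunc.map _ _ _ 𝓖 (fun v => v⁺) (hW.approxBounded c k), ?_, ?_, ?_⟩
    · exact fun k ω => posPart_nonneg _
    · exact fun k ω => ((norm_le_norm_of_abs_le_abs (by
        refine (abs_of_nonneg (posPart_nonneg (hW.approxBounded c k ω))).trans_le ?_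
        exact sup_le (le_abs_self _) (abs_nonneg _))).trans (hW.norm_approxBounded_le hc k ω))
    · intro ω hω
      have h1 := ((continuous_posPart (α := E)).tendsto _).comp
        (hW.tendsto_approxBounded_of_norm_le hω)
      rwa [posPart_of_nonneg (hW0 ω)] at h1
  have hmeasΓ : ∀ W : Ω → E, StronglyMeasurable[𝓖] W →
      Measurable fun ω => ENNReal.ofReal (Γ ω (W ω)) := fun W hW =>
    (measurable_apply (hΓm.mono h𝓖) (hW.mono h𝓖)).ennreal_ofReal
  -- dominated convergence for the bounded conditional expectation
  have hlim : ∀ (B : Set Ω) (c : ℝ), MeasurableSet B → (∀ ω ∈ B, ‖Γ ω‖ ≤ c) →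
      ∀ (Wk : ℕ → Ω → E) (W : Ω → E), (∀ k, StronglyMeasurable[𝓖] (Wk k)) →
      ∀ b : ℝ, (∀ k, ∀ ω ∈ B, ‖Wk k ω‖ ≤ b) →
      (∀ ω ∈ B, Tendsto (fun k => Wk k ω) atTop (𝓝 (W ω))) →
      Tendsto (fun k => ∫⁻ ω in B, ENNReal.ofReal (Γ ω (Wk k ω)) ∂P) atTop
        (𝓝 (∫⁻ ω in B, ENNReal.ofReal (Γ ω (W ω)) ∂P)) := by
    intro B c hB hΓB Wk W hWk b hb hT
    refine tendsto_lintegral_of_dominated_convergence (fun _ => ENNReal.ofReal (c * b))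
      (fun k => hmeasΓ _ (hWk k)) (fun k => ?_) ?_ ?_
    · filter_upwards [ae_restrict_mem hB] with ω hω
      refine ENNReal.ofReal_le_ofReal ((le_abs_self _).trans (((Γ ω).le_opNorm _).trans ?_))
      exact mul_le_mul (hΓB ω hω) (hb k ω hω) (norm_nonneg _) ((norm_nonneg _).trans (hΓB ω hω))
    · rw [lintegral_const]
      exact ENNReal.mul_ne_top ENNReal.ofReal_ne_top (measure_ne_top _ _)
    · filter_upwards [ae_restrict_mem hB] with ω hω
      exact ENNReal.tendsto_ofReal (((Γ ω).continuous.tendsto _).comp (hT ω hω))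
  -- Fatou's lemma for the merely lower semicontinuous function `g`
  have hle : ∀ (B : Set Ω) (c : ℝ), MeasurableSet[𝓖] B → 0 ≤ c → (∀ ω ∈ B, ‖Γ ω‖ ≤ c) →
      ∀ W : Ω → E, StronglyMeasurable[𝓖] W → 0 ≤ W → (∀ ω ∈ B, ‖W ω‖ ≤ c) →
      ∫⁻ ω in B, g ω (W ω) ∂P ≤ ∫⁻ ω in B, ENNReal.ofReal (Γ ω (W ω)) ∂P := by
    intro B c hB hc hΓB W hW hW0 hWB
    obtain ⟨Zk, hZk0, hZkc, hZkT⟩ := happrox W hW hW0 c hc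
    have hZkm : ∀ k, StronglyMeasurable[𝓖] (Zk k) := fun k =>
      @SimpleFunc.stronglyMeasurable _ _ 𝓖 _ (Zk k)
    have h1 := hlim B c (h𝓖 _ hB) hΓB (fun k => Zk k) W hZkm c (fun k ω _ => hZkc k ω)
      fun ω hω => hZkT ω (hWB ω hω)
    rw [← h1.liminf_eq]
    calc ∫⁻ ω in B, g ω (W ω) ∂P
        ≤ ∫⁻ ω in B, liminf (fun k => g ω (Zk k ω)) atTop ∂P := by
          refine setLIntegral_mono' (h𝓖 _ hB) fun ω hω => ?_
          exact hg.le_liminf ω _ _ (fun k => hZk0 k ω) (hW0 ω) (hZkT ω (hWB ω hω))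
      _ ≤ liminf (fun k => ∫⁻ ω in B, g ω (Zk k ω) ∂P) atTop :=
          lintegral_liminf_le fun k => hg.measurable _ ((hZkm k).mono h𝓖) (hZk0 k)
      _ = liminf (fun k => ∫⁻ ω in B, ENNReal.ofReal (Γ ω (Zk k ω)) ∂P) atTop := by
          simp_rw [fun k => setLIntegral_condExp_simpleFunc h𝓖 h hB (Zk k) (hZk0 k)]
  have heq : ∀ (B : Set Ω) (c : ℝ), MeasurableSet[𝓖] B → 0 ≤ c → (∀ ω ∈ B, ‖Γ ω‖ ≤ c) →
      (∀ ω ∈ B, ‖Z ω‖ ≤ c) →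
      ∫⁻ ω in B, ENNReal.ofReal (Γ ω (Z ω)) ∂P = ∫⁻ ω in B, g ω (Z ω) ∂P := by
    intro B c hB hc hΓB hZB
    refine le_antisymm ?_ (hle B c hB hc hΓB Z hZ hZ0 hZB)
    obtain ⟨Zk, hZk0, hZkc, hZkT⟩ := happrox Z hZ hZ0 c hc
    have hZkm : ∀ k, StronglyMeasurable[𝓖] (Zk k) := fun k =>
      @SimpleFunc.stronglyMeasurable _ _ 𝓖 _ (Zk k)
    have hWm : ∀ k, StronglyMeasurable[𝓖] fun ω => |Zk k ω - Z ω| := fun k =>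
      (continuous_abs_of_solidNorm (E := E)).comp_stronglyMeasurable ((hZkm k).sub hZ)
    have hWb : ∀ k, ∀ ω ∈ B, ‖|Zk k ω - Z ω|‖ ≤ c + c := fun k ω hω => by
      rw [norm_abs_eq_norm]
      exact (norm_sub_le _ _).trans (add_le_add (hZkc k ω) (hZB ω hω))
    have h1 := hlim B c (h𝓖 _ hB) hΓB (fun k => Zk k) Z hZkm c (fun k ω _ => hZkc k ω)
      fun ω hω => hZkT ω (hZB ω hω)
    have h2 := hlim B c (h𝓖 _ hB) hΓB (fun k ω => |Zk k ω - Z ω|) 0 hWm (c + c) hWb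
      fun ω hω => by
        have h3 := ((continuous_abs_of_solidNorm (E := E)).tendsto _).comp
          ((hZkT ω (hZB ω hω)).sub (tendsto_const_nhds (x := Z ω)))
        simp only [sub_self, abs_zero] at h3
        exact h3
    have h4 := (tendsto_const_nhds (x := ∫⁻ ω in B, g ω (Z ω) ∂P)).add h2
    simp only [Pi.zero_apply, map_zero, ENNReal.ofReal_zero, lintegral_zero, add_zero] at h4
    refine le_of_tendsto_of_tendsto' h1 h4 fun k => ?_
    rw [setLIntegral_condExp_simpleFunc h𝓖 h hB (Zk k) (hZk0 k)]
    have h5 := hle B (c + c) hB (by positivity) (fun ω hω => (hΓB ω hω).trans (by linarith))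
      (fun ω => |Zk k ω - Z ω|) (hWm k) (fun ω => abs_nonneg _) (hWb k)
    calc ∫⁻ ω in B, g ω (Zk k ω) ∂P
        ≤ ∫⁻ ω in B, (g ω (Z ω) + g ω |Zk k ω - Z ω|) ∂P := by
          refine lintegral_mono fun ω => ?_
          rw [← hg.add ω _ _ (hZ0 ω) (abs_nonneg _)]
          refine hg.mono (hZk0 k ω) ?_
          rw [← sub_le_iff_le_add']
          exact le_abs_self _
      _ = ∫⁻ ω in B, g ω (Z ω) ∂P + ∫⁻ ω in B, g ω |Zk k ω - Z ω| ∂P :=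
          lintegral_add_left (hg.measurable Z (hZ.mono h𝓖) hZ0) _
      _ ≤ _ := by gcongr
  -- exhaustion by the sets on which both factors are bounded
  have hBm : ∀ j : ℕ, MeasurableSet[𝓖] (C ∩ {ω | ‖Γ ω‖ ≤ j ∧ ‖Z ω‖ ≤ j}) := fun j =>
    hC.inter ((measurableSet_le hΓm.norm.measurable measurable_const).inter
      (measurableSet_le hZ.norm.measurable measurable_const))
  have hU : C = ⋃ j : ℕ, C ∩ {ω | ‖Γ ω‖ ≤ j ∧ ‖Z ω‖ ≤ j} := by
    rw [← inter_iUnion]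
    refine (inter_eq_left.2 fun ω _ => ?_).symm
    obtain ⟨j, hj⟩ := exists_nat_ge (max ‖Γ ω‖ ‖Z ω‖)
    exact mem_iUnion.2 ⟨j, (le_max_left _ _).trans hj, (le_max_right _ _).trans hj⟩
  have hmono : Monotone fun j : ℕ => C ∩ {ω | ‖Γ ω‖ ≤ j ∧ ‖Z ω‖ ≤ j} := fun i j hij =>
    inter_subset_inter_right _ fun ω hω => by
      have : (i : ℝ) ≤ j := by exact_mod_cast hij
      exact ⟨hω.1.trans this, hω.2.trans this⟩
  rw [hU, setLIntegral_iUnion_of_directed _ hmono.directed_le,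
    setLIntegral_iUnion_of_directed _ hmono.directed_le]
  exact iSup_congr fun j => heq _ j (hBm j) j.cast_nonneg (fun ω hω => hω.2.1) fun ω hω => hω.2.2

end ConditionalExpectation

/-! ### Integration of the optional projection -/

section OptionalProjection

variable {T : ℝ≥0∞} {Ω : Type*} {mΩ : MeasurableSpace Ω} {𝓕 : Filtration (Horizon T) mΩ}
  {P : Measure Ω} [IsProbabilityMeasure P] {m : Ω → Measure (Horizon T)}

/-- The time change under the expectation: for each level `u` the integrand is evaluated at the time
at which the distribution function reaches `u`. -/
lemma lintegral_setLIntegral_Iic_eq_hitting (hm : ∀ ω t, m ω (Iic t) < ∞)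
    (hmm : ∀ t, Measurable fun ω => (m ω).real (Iic t)) {H : Ω × Horizon T → ℝ≥0∞}
    (hH : Measurable H) (N : Horizon T) :
    ∫⁻ ω, ∫⁻ s in Iic N, H (ω, s) ∂(m ω) ∂P =
      ∫⁻ u in Ioi (0 : ℝ), ∫⁻ ω in {ω | u ≤ (m ω).real (Iic N)},
        H (ω, hitting (fun t => (m ω).real (Iic t)) N u) ∂P := by
  have h2 := measurable_hitting_measureReal hm hmm N
  have h : ∀ ω, ∫⁻ s in Iic N, H (ω, s) ∂(m ω) = ∫⁻ u, (Ioc 0 ((m ω).real (Iic N))).indicator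
      (fun u => H (ω, hitting (fun t => (m ω).real (Iic t)) N u)) u := fun ω =>
    setLIntegral_Iic_eq_hitting hm hmm (H := fun s => H (ω, s)) (hH.comp measurable_prodMk_left) N ω
  have h3 : MeasurableSet {p : Ω × ℝ | p.2 ∈ Ioc 0 ((m p.1).real (Iic N))} :=
    (measurableSet_lt measurable_const measurable_snd).inter
      (measurableSet_le measurable_snd ((hmm N).comp measurable_fst))
  have hK : Measurable (Function.uncurry fun ω u => (Ioc 0 ((m ω).real (Iic N))).indicator
      (fun u => H (ω, hitting (fun t => (m ω).real (Iic t)) N u)) u) :=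
    (hH.comp (measurable_fst.prodMk h2)).indicator h3
  simp_rw [h]
  rw [lintegral_lintegral_swap hK.aemeasurable, ← lintegral_indicator measurableSet_Ioi]
  refine lintegral_congr fun u => ?_
  have hC : MeasurableSet {ω | u ≤ (m ω).real (Iic N)} := measurableSet_le measurable_const (hmm N)
  by_cases hu : 0 < u
  · rw [indicator_of_mem (mem_Ioi.2 hu), ← lintegral_indicator hC]
    refine lintegral_congr fun ω => ?_
    simp only [indicator, mem_Ioc, hu, true_and, mem_ofPred_eq]
  · rw [indicator_of_notMem (by simpa using hu)]
    simp [indicator, hu]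

lemma isStoppingTime_hitting (hm : ∀ ω t, m ω (Iic t) < ∞)
    (hmm : StronglyAdapted 𝓕 fun t ω => (m ω).real (Iic t)) (N : Horizon T) (u : ℝ) :
    IsStoppingTime 𝓕 fun ω =>
      ((hitting (fun t => (m ω).real (Iic t)) N u : Horizon T) : WithTop (Horizon T)) := by
  intro t
  simp only [WithTop.coe_le_coe, hitting_le_iff (monotone_measureReal_Iic (hm _))
    (continuousWithinAt_measureReal_Iic (hm _))]
  exact MeasurableSet.union ((hmm t).measurable measurableSet_Ici) (.const _)

variable {F : Type*} [NormedAddCommGroup F]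

lemma _root_.MeasureTheory.IsStronglyProgressive.stronglyMeasurable_stopped {X : Horizon T → Ω → F}
    (hX : IsStronglyProgressive 𝓕 X) {τ : Ω → Horizon T}
    (hτ : IsStoppingTime 𝓕 fun ω => (τ ω : WithTop (Horizon T))) {N : Horizon T}
    (hN : ∀ ω, τ ω ≤ N) :
    StronglyMeasurable[hτ.measurableSpace] fun ω => X (τ ω) ω := by
  borelize F
  have h1 : StronglyMeasurable[𝓕 N] fun ω => X (τ ω) ω :=
    stronglyMeasurable_stoppedValue_of_le hX hτ fun ω => WithTop.coe_le_coe.2 (hN ω)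
  have h2 : Measurable[hτ.measurableSpace] fun ω => X (τ ω) ω := measurable_stoppedValue hX hτ
  exact (@stronglyMeasurable_iff_measurable_separable _ _ _ hτ.measurableSpace _ _ _ _).2
    ⟨h2, h1.isSeparable_range⟩

variable {E : Type*} [NormedAddCommGroup E]
  [NormedSpace ℝ E] [Lattice E] [HasSolidNorm E] [IsOrderedAddMonoid E] [CompleteSpace E]
  {G : Horizon T → Ω → E → ℝ≥0∞} {Γ : Horizon T → Ω → StrongDual ℝ E} {Z : Horizon T → Ω → E}

lemma IsPositiveIntegrand.stopped (hG : IsPositiveIntegrand fun p : Horizon T × Ω => G p.1 p.2)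
    {τ : Ω → Horizon T} (hτ : Measurable τ) : IsPositiveIntegrand fun ω => G (τ ω) ω where
  measurable W hW hW0 := (hG.measurable (fun p => W p.2) (hW.comp_measurable measurable_snd)
    fun p => hW0 p.2).comp (hτ.prodMk measurable_id)
  add ω := hG.add (τ ω, ω)
  le_liminf ω := hG.le_liminf (τ ω, ω)

/-- Integration of an optional projection: against a progressive integrand and an adapted random
measure in time, a process may be replaced by its conditional expectations along stopping times.
The stopping times that are needed are the hitting times of the distribution function of the random
measure, by which its integrals become Lebesgue integrals. -/
theorem IsConditionalExpectation.lintegral_lintegral_eq (hΓ : IsConditionalExpectation P 𝓕 G Γ)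
    (hG : IsPositiveIntegrand fun p : Horizon T × Ω => G p.1 p.2)
    (hm : ∀ ω t, m ω (Iic t) < ∞) (hmm : StronglyAdapted 𝓕 fun t ω => (m ω).real (Iic t))
    (hZ : IsStronglyProgressive 𝓕 Z) (hZ0 : ∀ s ω, 0 ≤ Z s ω) :
    ∫⁻ ω, ∫⁻ s, ENNReal.ofReal (Γ s ω (Z s ω)) ∂(m ω) ∂P =
      ∫⁻ ω, ∫⁻ s, G s ω (Z s ω) ∂(m ω) ∂P := by
  have hmm' : ∀ t, Measurable fun ω => (m ω).real (Iic t) := fun t =>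
    ((hmm t).mono (𝓕.le t)).measurable
  have hZm := hZ.stronglyMeasurable_uncurry
  have hΓm := hΓ.progressive.stronglyMeasurable_uncurry
  have hH1 : Measurable fun p : Ω × Horizon T => ENNReal.ofReal (Γ p.2 p.1 (Z p.2 p.1)) :=
    (measurable_apply hΓm hZm).ennreal_ofReal.comp measurable_swap
  have hH2 : Measurable fun p : Ω × Horizon T => G p.2 p.1 (Z p.2 p.1) :=
    (hG.measurable (fun p => Z p.1 p.2) hZm fun p => hZ0 _ _).comp measurable_swap
  have key : ∀ N, ∫⁻ ω, ∫⁻ s in Iic N, ENNReal.ofReal (Γ s ω (Z s ω)) ∂(m ω) ∂P =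
      ∫⁻ ω, ∫⁻ s in Iic N, G s ω (Z s ω) ∂(m ω) ∂P := by
    intro N
    have e1 := lintegral_setLIntegral_Iic_eq_hitting (P := P) hm hmm' hH1 N
    have e2 := lintegral_setLIntegral_Iic_eq_hitting (P := P) hm hmm' hH2 N
    rw [e1, e2]
    refine setLIntegral_congr_fun measurableSet_Ioi fun u _ => ?_
    have hτ := isStoppingTime_hitting hm hmm N u
    set τ : Ω → Horizon T := fun ω => hitting (fun t => (m ω).real (Iic t)) N u with hτ_def
    have hle : ∀ ω t, τ ω ≤ t ↔ u ≤ (m ω).real (Iic t) ∨ N ≤ t := fun ω t =>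
      hitting_le_iff (monotone_measureReal_Iic (hm ω)) (continuousWithinAt_measureReal_Iic (hm ω))
        N u t
    have hτN : ∀ ω, τ ω ≤ N := fun ω => (hle ω N).2 (Or.inr le_rfl)
    have hτm : Measurable τ :=
      (measurable_hitting_measureReal hm hmm' N).comp measurable_prodMk_right
    -- the level is reached up to time `N`: an event which is known at the hitting time
    have hC : MeasurableSet[hτ.measurableSpace] {ω | u ≤ (m ω).real (Iic N)} := by
      refine ⟨le_iSup 𝓕.seq N _ ((hmm N).measurable measurableSet_Ici), fun t => ?_⟩
      simp only [WithTop.coe_le_coe]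
      rcases le_or_gt N t with h | h
      · refine MeasurableSet.inter ?_ ?_
        · exact 𝓕.mono h _ ((hmm N).measurable measurableSet_Ici)
        · convert MeasurableSet.univ
          exact eq_univ_of_forall fun ω => (hτN ω).trans h
      · have hset : {ω | u ≤ (m ω).real (Iic N)} ∩ {ω | τ ω ≤ t} =
            {ω | u ≤ (m ω).real (Iic t)} := by
          ext ω
          simp only [mem_inter_iff, mem_ofPred_eq, hle, not_le.2 h, or_false]
          exact ⟨fun h1 => h1.2,
            fun h1 => ⟨h1.trans (monotone_measureReal_Iic (hm ω) h.le), h1⟩⟩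
        rw [hset]
        exact (hmm t).measurable measurableSet_Ici
    exact setLIntegral_condExp_apply hτ.measurableSpace_le (hG.stopped hτm)
      (hΓ.progressive.stronglyMeasurable_stopped hτ hτN) (hΓ.condExp τ hτ) hC
      (hZ.stronglyMeasurable_stopped hτ hτN) fun ω => hZ0 _ _
  have hsup : ∀ H : Ω × Horizon T → ℝ≥0∞, Measurable H → ∫⁻ ω, ∫⁻ s, H (ω, s) ∂(m ω) ∂P =
      ⨆ n, ∫⁻ ω, ∫⁻ s in Iic (Horizon.grid T n), H (ω, s) ∂(m ω) ∂P := by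
    intro H hH
    have hdir : Monotone fun n => Iic (Horizon.grid T n) := monotone_Iic.comp Horizon.grid_mono
    rw [← lintegral_iSup (fun n => measurable_setLIntegral_Iic hm hmm' hH _)
      fun i j hij ω => lintegral_mono_set (hdir hij)]
    refine lintegral_congr fun ω => ?_
    rw [← setLIntegral_univ, ← Horizon.iUnion_Iic_grid,
      setLIntegral_iUnion_of_directed _ hdir.directed_le]
  rw [hsup _ hH1, hsup _ hH2]
  exact iSup_congr fun n => key _

end OptionalProjection

/-! ### Nonnegative densities and the controlled part of the state -/

section RegularControl

variable {T : ℝ≥0∞} {Ω : Type*} {mΩ : MeasurableSpace Ω} {𝓕 : Filtration (Horizon T) mΩ}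
  {E : Type*} [NormedAddCommGroup E] [NormedSpace ℝ E] [Lattice E] [HasSolidNorm E]
  [IsOrderedAddMonoid E] [IsOrderedModule ℝ E] [CompleteSpace E] [HasPathDensity E]
  {ν : Horizon T → Ω → E}

/-- A nonnegative progressive version of the density of a control. -/
def positiveDensity (ν : Horizon T → Ω → E) (s : Horizon T) (ω : Ω) : E := (densityProcess ν s ω)⁺

lemma positiveDensity_nonneg (s : Horizon T) (ω : Ω) : 0 ≤ positiveDensity ν s ω :=
  posPart_nonneg _

lemma IsRegularControl.positiveDensity_ae_eq (hν : IsRegularControl 𝓕 ν) (ω : Ω) :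
    (fun s => positiveDensity ν s ω) =ᵐ[variationMeasure fun s => ν s ω]
      polarDensity fun s => ν s ω := by
  filter_upwards [hν.densityProcess_ae_eq ω, (hν.path ω).ae_nonneg] with s h1 h2
  rw [positiveDensity, h1, posPart_of_nonneg h2]

lemma IsRegularControl.stronglyProgressive_positiveDensity [𝓕.IsRightContinuous]
    (hν : IsRegularControl 𝓕 ν) : IsStronglyProgressive 𝓕 (positiveDensity ν) := fun t =>
  continuous_posPart.comp_stronglyMeasurable (hν.stronglyProgressive_densityProcess t)

lemma IsRegularControl.variation_lt_top (hν : IsRegularControl 𝓕 ν) (ω : Ω) (t : Horizon T) :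
    variationMeasure (fun s => ν s ω) (Iic t) < ∞ := (hν.path ω).variationMeasure_Iic_lt_top t

lemma IsRegularControl.measurable_variation (hν : IsRegularControl 𝓕 ν) (t : Horizon T) :
    Measurable fun ω => (variationMeasure fun s => ν s ω).real (Iic t) :=
  ((hν.stronglyAdapted_variationProcess t).mono (𝓕.le t)).measurable

lemma IsRegularControl.pairing_eq (hν : IsRegularControl 𝓕 ν)
    (φ : Horizon T → Ω → StrongDual ℝ E) (ω : Ω) :
    pairing (fun s => φ s ω) (fun s => ν s ω) =
      ∫⁻ s, ENNReal.ofReal (φ s ω (positiveDensity ν s ω)) ∂(variationMeasure fun s => ν s ω) := by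
  refine lintegral_congr_ae ((hν.positiveDensity_ae_eq ω).mono fun s hs => ?_)
  beta_reduce
  rw [← hs]

lemma IsRegularControl.measurable_pairing [𝓕.IsRightContinuous] (hν : IsRegularControl 𝓕 ν)
    {φ : Horizon T → Ω → StrongDual ℝ E}
    (hφ : StronglyMeasurable fun p : Horizon T × Ω => φ p.1 p.2) :
    Measurable fun ω => pairing (fun s => φ s ω) (fun s => ν s ω) := by
  simp_rw [hν.pairing_eq φ]
  exact measurable_lintegral_family hν.variation_lt_top hν.measurable_variation
    ((measurable_apply hφ hν.stronglyProgressive_positiveDensity.stronglyMeasurable_uncurry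
      ).ennreal_ofReal.comp measurable_swap)

variable {S : ℝ≥0 → E →L[ℝ] E}

/-- The contribution of a control to the state. -/
def controlledPart (S : ℝ≥0 → E →L[ℝ] E) (ν : Horizon T → Ω → E) (t : Horizon T) (ω : Ω) : E :=
  convolution S (variationMeasure fun s => ν s ω) (polarDensity fun s => ν s ω) t

lemma IsRegularControl.controlledPart_nonneg (hν : IsRegularControl 𝓕 ν)
    (hS0 : ∀ t x, 0 ≤ x → 0 ≤ S t x) (t : Horizon T) (ω : Ω) : 0 ≤ controlledPart S ν t ω :=
  convolution_nonneg hS0 (hν.path ω).ae_nonneg t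

lemma IsRegularControl.controlledPart_eq (hν : IsRegularControl 𝓕 ν) (t : Horizon T) (ω : Ω) :
    controlledPart S ν t ω = convolution S (variationMeasure fun s => ν s ω)
      (fun s => positiveDensity ν s ω) t :=
  (convolution_congr (hν.positiveDensity_ae_eq ω) t).symm

lemma IsRegularControl.stronglyMeasurable_controlledPart [𝓕.IsRightContinuous]
    (hν : IsRegularControl 𝓕 ν) (hS : ∀ x, Continuous fun t => S t x) :
    StronglyMeasurable fun p : Horizon T × Ω => controlledPart S ν p.1 p.2 := by
  have hρ := hν.stronglyProgressive_positiveDensity.stronglyMeasurable_uncurry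
  have hH : StronglyMeasurable fun z : (Horizon T × Ω) × Horizon T =>
      ({z | z.2 ≤ z.1.1} : Set ((Horizon T × Ω) × Horizon T)).indicator
        (fun z => S (z.1.1.1 - z.2.1) (positiveDensity ν z.2 z.1.2)) z := by
    refine StronglyMeasurable.indicator ?_
      (measurableSet_le measurable_snd (measurable_fst.comp measurable_fst))
    have hg : Measurable fun z : (Horizon T × Ω) × Horizon T => (z.2, z.1.2) :=
      measurable_snd.prodMk (measurable_snd.comp measurable_fst)
    have h2 := hρ.comp_measurable hg
    simp only [Function.comp_def] at h2
    have h3 : Measurable fun z : (Horizon T × Ω) × Horizon T => z.1.1.1 - z.2.1 :=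
      (measurable_subtype_coe.comp (measurable_fst.comp measurable_fst)).sub
        (measurable_subtype_coe.comp measurable_snd)
    exact stronglyMeasurable_semigroup_apply hS h3 h2
  have h1 : ∀ n, StronglyMeasurable fun p : Horizon T × Ω => ∫ s in Iic (Horizon.grid T n),
      ({z | z.2 ≤ z.1.1} : Set ((Horizon T × Ω) × Horizon T)).indicator
        (fun z => S (z.1.1.1 - z.2.1) (positiveDensity ν z.2 z.1.2)) (p, s)
        ∂(variationMeasure fun s => ν s p.2) := fun n =>
    stronglyMeasurable_setIntegral_Iic (m := fun p : Horizon T × Ω =>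
      variationMeasure fun s => ν s p.2) (fun p => hν.variation_lt_top p.2)
      (fun t => (hν.measurable_variation t).comp measurable_snd) hH _
  refine stronglyMeasurable_of_tendsto atTop h1 (tendsto_pi_nhds.2 fun p => ?_)
  refine tendsto_const_nhds.congr' ?_
  obtain ⟨n, hn⟩ := p.1.exists_le_grid
  filter_upwards [eventually_ge_atTop n] with k hk
  rw [hν.controlledPart_eq, convolution]
  have h2 : (fun s => ({z | z.2 ≤ z.1.1} : Set ((Horizon T × Ω) × Horizon T)).indicator
      (fun z => S (z.1.1.1 - z.2.1) (positiveDensity ν z.2 z.1.2)) (p, s)) =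
      (Iic p.1).indicator fun s => S (p.1.1 - s.1) (positiveDensity ν s p.2) := by
    funext s
    simp [indicator]
  rw [h2, setIntegral_indicator measurableSet_Iic, Iic_inter_Iic,
    inf_eq_right.2 (hn.trans (Horizon.grid_mono hk))]

end RegularControl

/-! ### The gradient of the running profit -/

section RunningProfit

lemma one_div_succ_nonneg_and_le (n : ℕ) : 0 ≤ 1 / ((n : ℝ) + 1) ∧ 0 ≤ 1 - 1 / ((n : ℝ) + 1) := by
  refine ⟨by positivity, ?_⟩
  rw [sub_nonneg, div_le_one (by positivity)]
  linarith [n.cast_nonneg (α := ℝ)]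

variable {T : ℝ≥0∞} {Ω : Type*} {mΩ : MeasurableSpace Ω} {𝓕 : Filtration (Horizon T) mΩ}
  {E : Type*} [NormedAddCommGroup E] [NormedSpace ℝ E] [PartialOrder E]
  [IsOrderedAddMonoid E] [IsOrderedModule ℝ E] {S : ℝ≥0 → E →L[ℝ] E} {y : E}
  {Pi : Ω → Horizon T → E → ℝ}

/-- The gradient in a direction `v`, of either sign, along which the segment to `k + v` stays in
`S_y(t)`, is the limit of difference quotients. -/
lemma IsRunningProfit.tendsto_gradient (hPi : IsRunningProfit 𝓕 S y Pi) {ω : Ω} {t : Horizon T}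
    {k v : E} (hk : k ∈ reachable S y t)
    (hv : ∀ n : ℕ, k + (1 / ((n : ℝ) + 1)) • v ∈ reachable S y t) :
    Tendsto (fun n : ℕ => ((n : ℝ) + 1) * (Pi ω t (k + (1 / ((n : ℝ) + 1)) • v) - Pi ω t k)) atTop
      (𝓝 (profitGradient S y Pi ω t k v)) := by
  refine HasFDerivWithinAt.lim (c := fun n : ℕ => (n : ℝ) + 1)
    (d := fun n : ℕ => (1 / ((n : ℝ) + 1)) • v)
    (((hPi.contDiffOn ω t).differentiableOn_one k hk).hasFDerivWithinAt) ?_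
    (Eventually.of_forall hv) ?_
  · simpa using (tendsto_one_div_add_atTop_nhds_zero_nat (𝕜 := ℝ)).smul_const v
  · refine tendsto_const_nhds.congr fun n => ?_
    have : (n : ℝ) + 1 ≠ 0 := by positivity
    rw [smul_smul, mul_one_div_cancel this, one_smul]

lemma reachable_add {t : Horizon T} {k v : E} (hk : k ∈ reachable S y t) (hv : 0 ≤ v) :
    k + v ∈ reachable S y t := ⟨add_nonneg hk.1 hv, le_add_of_le_of_nonneg hk.2 hv⟩

lemma reachable_add_smul {t : Horizon T} {k v : E} (hk : k ∈ reachable S y t) (hv : 0 ≤ v) (n : ℕ) :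
    k + (1 / ((n : ℝ) + 1)) • v ∈ reachable S y t :=
  reachable_add hk (smul_nonneg (by positivity) hv)

lemma IsRunningProfit.gradient_nonneg (hPi : IsRunningProfit 𝓕 S y Pi) {ω : Ω} {t : Horizon T}
    {k v : E} (hk : k ∈ reachable S y t) (hv : 0 ≤ v) : 0 ≤ profitGradient S y Pi ω t k v := by
  refine ge_of_tendsto' (hPi.tendsto_gradient hk (reachable_add_smul hk hv)) fun n => ?_
  refine mul_nonneg (by positivity) (sub_nonneg.2 (hPi.monotone ω t hk.1
    (reachable_add_smul hk hv n).1 ?_))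
  exact le_add_of_nonneg_right (smul_nonneg (by positivity) hv)

/-- The tangent inequality for the concave running profit. -/
lemma IsRunningProfit.sub_le_gradient (hPi : IsRunningProfit 𝓕 S y Pi) {ω : Ω} {t : Horizon T}
    {k l : E} (hk : k ∈ reachable S y t) (hl : l ∈ reachable S y t) :
    Pi ω t l - Pi ω t k ≤ profitGradient S y Pi ω t k (l - k) := by
  have hcomb : ∀ n : ℕ, k + (1 / ((n : ℝ) + 1)) • (l - k) =
      (1 - 1 / ((n : ℝ) + 1)) • k + (1 / ((n : ℝ) + 1)) • l := fun n => by
    rw [smul_sub, sub_smul, one_smul]; abel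
  have h0 := fun n => (one_div_succ_nonneg_and_le n).1
  have h1 := fun n => (one_div_succ_nonneg_and_le n).2
  refine ge_of_tendsto' (hPi.tendsto_gradient hk fun n => ?_) fun n => ?_
  · rw [hcomb]
    refine ⟨add_nonneg (smul_nonneg (h1 n) hk.1) (smul_nonneg (h0 n) hl.1), ?_⟩
    calc S t.1 y = (1 - 1 / ((n : ℝ) + 1)) • S t.1 y + (1 / ((n : ℝ) + 1)) • S t.1 y := by
          rw [← add_smul, sub_add_cancel, one_smul]
      _ ≤ _ := add_le_add (smul_le_smul_of_nonneg_left hk.2 (h1 n))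
          (smul_le_smul_of_nonneg_left hl.2 (h0 n))
  · have h2 := (hPi.concave ω t).2 (x := k) (y := l) hk.1 hl.1 (h1 n) (h0 n) (sub_add_cancel _ _)
    rw [← hcomb, smul_eq_mul, smul_eq_mul] at h2
    have h3 : (0 : ℝ) < (n : ℝ) + 1 := by positivity
    rw [← div_le_iff₀' h3]
    rw [div_eq_mul_one_div]
    linarith

variable {α : Type*} [MeasurableSpace α]

lemma IsRunningProfit.measurable_comp (hPi : IsRunningProfit 𝓕 S y Pi) {f : α → Ω}
    (hf : Measurable f) {t : α → Horizon T} (ht : Measurable t) {K : α → E}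
    (hK : StronglyMeasurable K) (hK0 : ∀ a, 0 ≤ K a) :
    Measurable fun a => Pi (f a) (t a) (K a) := by
  borelize E
  exact hPi.measurable.comp (hf.prodMk (ht.prodMk (hK.measurable.subtype_mk (h := hK0))))

/-- The gradient itself need not be measurable in the dual, but its values are, as limits of difference
quotients. -/
lemma IsRunningProfit.measurable_gradient (hPi : IsRunningProfit 𝓕 S y Pi) {f : α → Ω}
    (hf : Measurable f) {t : α → Horizon T} (ht : Measurable t) {K V : α → E}
    (hK : StronglyMeasurable K) (hKr : ∀ a, K a ∈ reachable S y (t a)) (hV : StronglyMeasurable V)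
    (hV0 : ∀ a, 0 ≤ V a) :
    Measurable fun a => profitGradient S y Pi (f a) (t a) (K a) (V a) := by
  refine measurable_of_tendsto_metrizable (f := fun (n : ℕ) a => ((n : ℝ) + 1) *
    (Pi (f a) (t a) (K a + (1 / ((n : ℝ) + 1)) • V a) - Pi (f a) (t a) (K a))) (fun n => ?_)
    (tendsto_pi_nhds.2 fun a =>
      hPi.tendsto_gradient (hKr a) (reachable_add_smul (hKr a) (hV0 a)))
  exact ((hPi.measurable_comp hf ht (hK.add (hV.const_smul _)) fun a =>
    (reachable_add_smul (hKr a) (hV0 a) n).1).sub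
    (hPi.measurable_comp hf ht hK fun a => (hKr a).1)).const_mul _

end RunningProfit

/-! ### The state and the marginal gain -/

section State

variable {T : ℝ≥0∞} {Ω : Type*} {mΩ : MeasurableSpace Ω} {𝓕 : Filtration (Horizon T) mΩ}
  [𝓕.IsRightContinuous]
  {E : Type*} [NormedAddCommGroup E] [NormedSpace ℝ E] [Lattice E] [HasSolidNorm E]
  [IsOrderedAddMonoid E] [IsOrderedModule ℝ E] [CompleteSpace E] [HasPathDensity E]
  {ν νs : Horizon T → Ω → E} {S : ℝ≥0 → E →L[ℝ] E} {y : E} {Pi : Ω → Horizon T → E → ℝ}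
  {q : Measure (Horizon T)} [IsFiniteMeasure q]

/-- The state process driven by the control `ν`. -/
def state (S : ℝ≥0 → E →L[ℝ] E) (y : E) (ν : Horizon T → Ω → E) (t : Horizon T) (ω : Ω) : E :=
  mildPath S y (fun s => ν s ω) t

lemma state_eq (t : Horizon T) (ω : Ω) : state S y ν t ω = S t.1 y + controlledPart S ν t ω := rfl

lemma IsRegularControl.state_mem_reachable (hν : IsRegularControl 𝓕 ν)
    (hS0 : ∀ t x, 0 ≤ x → 0 ≤ S t x) (hy : 0 ≤ y) (t : Horizon T) (ω : Ω) :
    state S y ν t ω ∈ reachable S y t := by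
  have h := hν.controlledPart_nonneg hS0 t ω
  exact ⟨add_nonneg (hS0 _ _ hy) h, le_add_of_nonneg_right h⟩

lemma futureGradient_eq (s : Horizon T) (ω : Ω) (v : E) : futureGradient S y q Pi νs s ω v =
    ∫⁻ t in Ici s, ENNReal.ofReal
      (profitGradient S y Pi ω t (state S y νs t ω) (S (t.1 - s.1) v)) ∂q := rfl

lemma IsRegularControl.stronglyMeasurable_state (hν : IsRegularControl 𝓕 ν)
    (hS : ∀ x, Continuous fun t => S t x) :
    StronglyMeasurable fun p : Horizon T × Ω => state S y ν p.1 p.2 :=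
  (((hS y).comp continuous_subtype_val).stronglyMeasurable.comp_measurable measurable_fst).add
    (hν.stronglyMeasurable_controlledPart hS)

/-- As a superposition of positive functionals, the future gradient is additive on the positive cone
and, by Fatou's lemma, lower semicontinuous. It may be infinite. -/
lemma isPositiveIntegrand_futureGradient (hPi : IsRunningProfit 𝓕 S y Pi)
    (hS : ∀ x, Continuous fun t => S t x) (hS0 : ∀ t x, 0 ≤ x → 0 ≤ S t x) (hy : 0 ≤ y)
    (hνs : IsRegularControl 𝓕 νs) :
    IsPositiveIntegrand fun p : Horizon T × Ω => futureGradient S y q Pi νs p.1 p.2 := by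
  have hY := hνs.stronglyMeasurable_state (y := y) hS
  have hYr := hνs.state_mem_reachable hS0 hy
  have hjoint : ∀ Z : Horizon T × Ω → E, StronglyMeasurable Z → 0 ≤ Z →
      Measurable fun z : (Horizon T × Ω) × Horizon T => ENNReal.ofReal
        (profitGradient S y Pi z.1.2 z.2 (state S y νs z.2 z.1.2)
          (S (z.2.1 - z.1.1.1) (Z z.1))) := by
    intro Z hZ hZ0
    have hg : Measurable fun z : (Horizon T × Ω) × Horizon T => (z.2, z.1.2) :=
      measurable_snd.prodMk (measurable_snd.comp measurable_fst)
    have h3 : Measurable fun z : (Horizon T × Ω) × Horizon T => z.2.1 - z.1.1.1 :=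
      (measurable_subtype_coe.comp measurable_snd).sub
        (measurable_subtype_coe.comp (measurable_fst.comp measurable_fst))
    have h4 : StronglyMeasurable fun z : (Horizon T × Ω) × Horizon T => state S y νs z.2 z.1.2 := by
      have h := hY.comp_measurable hg
      simp only [Function.comp_def] at h
      exact h
    refine (hPi.measurable_gradient (measurable_snd.comp measurable_fst) measurable_snd h4
      (fun z => hYr _ _) ?_ fun z => hS0 _ _ (hZ0 _)).ennreal_ofReal
    exact stronglyMeasurable_semigroup_apply hS h3 (hZ.comp_measurable measurable_fst)
  have hfix : ∀ (p : Horizon T × Ω) (v : E), 0 ≤ v → Measurable fun t : Horizon T => ENNReal.ofReal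
      (profitGradient S y Pi p.2 t (state S y νs t p.2) (S (t.1 - p.1.1) v)) := fun p v hv =>
    (hjoint (fun _ => v) stronglyMeasurable_const fun _ => hv).comp
      (measurable_prodMk_left (x := p))
  refine ⟨fun Z hZ hZ0 => ?_, fun p v w hv hw => ?_, fun p v w hv hw hvw => ?_⟩
  · have h1 : MeasurableSet {z : (Horizon T × Ω) × Horizon T | z.1.1 ≤ z.2} :=
      measurableSet_le (measurable_fst.comp measurable_fst) measurable_snd
    have h2 := Measurable.lintegral_prod_right' (ν := q) ((hjoint Z hZ hZ0).indicator h1)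
    simp_rw [futureGradient_eq, ← lintegral_indicator measurableSet_Ici]
    exact h2
  · simp_rw [futureGradient_eq]
    rw [← lintegral_add_left (hfix p v hv)]
    refine lintegral_congr fun t => ?_
    have h1 : ∀ u : E, 0 ≤ u →
        0 ≤ profitGradient S y Pi p.2 t (state S y νs t p.2) (S (t.1 - p.1.1) u) := fun u hu =>
      hPi.gradient_nonneg (hYr _ _) (hS0 _ _ hu)
    rw [map_add, map_add]
    exact ENNReal.ofReal_add (h1 v hv) (h1 w hw)
  · refine le_trans (lintegral_mono fun t => ?_) (lintegral_liminf_le fun k => hfix p (v k) (hv k))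
    refine (Tendsto.liminf_eq ?_).ge
    exact ENNReal.tendsto_ofReal ((ContinuousLinearMap.continuous _).tendsto _ |>.comp hvw)

/-- Tonelli's theorem on the triangle `s ≤ t`. -/
lemma lintegral_lintegral_Ici_eq {m : Measure (Horizon T)} [SFinite m]
    {D : Horizon T → StrongDual ℝ E} {ρ : Horizon T → E}
    (hD : Measurable fun z : Horizon T × Horizon T => D z.2 (S (z.2.1 - z.1.1) (ρ z.1)))
    (hD0 : ∀ s t, 0 ≤ D t (S (t.1 - s.1) (ρ s)))
    (hint : ∀ t, IntegrableOn (fun s => S (t.1 - s.1) (ρ s)) (Iic t) m) :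
    ∫⁻ s, ∫⁻ t in Ici s, ENNReal.ofReal (D t (S (t.1 - s.1) (ρ s))) ∂q ∂m =
      ∫⁻ t, ENNReal.ofReal (D t (convolution S m ρ t)) ∂q := by
  have hF : Measurable (Function.uncurry fun (s t : Horizon T) => (Ici s).indicator
      (fun t => ENNReal.ofReal (D t (S (t.1 - s.1) (ρ s)))) t) :=
    hD.ennreal_ofReal.indicator (measurableSet_le measurable_fst measurable_snd)
  simp_rw [← lintegral_indicator measurableSet_Ici]
  rw [lintegral_lintegral_swap hF.aemeasurable]
  refine lintegral_congr fun t => ?_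
  have e2 : ∀ s, (Ici s).indicator (fun t => ENNReal.ofReal (D t (S (t.1 - s.1) (ρ s)))) t =
      (Iic t).indicator (fun s => ENNReal.ofReal (D t (S (t.1 - s.1) (ρ s)))) s := fun s => by
    simp only [indicator, mem_Ici, mem_Iic]
  simp_rw [e2]
  rw [lintegral_indicator measurableSet_Iic, convolution,
    ← ContinuousLinearMap.integral_comp_comm _ (hint t),
    ofReal_integral_eq_lintegral_ofReal (ContinuousLinearMap.integrable_comp _ (hint t))
      (ae_of_all _ fun s => hD0 s t)]

/-- The expected first-order gain, at the control `νs`, in the direction of the control `ν`. -/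
def marginalGain (P : Measure Ω) (S : ℝ≥0 → E →L[ℝ] E) (y : E) (q : Measure (Horizon T))
    (Pi : Ω → Horizon T → E → ℝ) (νs ν : Horizon T → Ω → E) : ℝ≥0∞ :=
  ∫⁻ ω, ∫⁻ t, ENNReal.ofReal
    (profitGradient S y Pi ω t (state S y νs t ω) (controlledPart S ν t ω)) ∂q ∂P

/-- Along each path, the future gradient paired with the increments of a control is the first-order
gain which the control produces. -/
lemma lintegral_futureGradient (hPi : IsRunningProfit 𝓕 S y Pi)
    (hS : ∀ x, Continuous fun t => S t x) (hS0 : ∀ t x, 0 ≤ x → 0 ≤ S t x) (hy : 0 ≤ y)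
    (hνs : IsRegularControl 𝓕 νs) (hν : IsRegularControl 𝓕 ν) (ω : Ω) :
    ∫⁻ s, futureGradient S y q Pi νs s ω (positiveDensity ν s ω) ∂(variationMeasure fun s => ν s ω) =
      ∫⁻ t, ENNReal.ofReal
        (profitGradient S y Pi ω t (state S y νs t ω) (controlledPart S ν t ω)) ∂q := by
  have hYr := hνs.state_mem_reachable hS0 hy
  have hσ := (hν.path ω).sigmaFinite
  have hρm := hν.stronglyProgressive_positiveDensity.stronglyMeasurable_uncurry.comp_measurable
    (measurable_prodMk_right (α := Horizon T) (y := ω))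
  have hYm := (hνs.stronglyMeasurable_state (y := y) hS).comp_measurable
    (measurable_prodMk_right (α := Horizon T) (y := ω))
  simp only [Function.comp_def] at hρm hYm
  have hD : Measurable fun z : Horizon T × Horizon T =>
      profitGradient S y Pi ω z.2 (state S y νs z.2 ω)
        (S (z.2.1 - z.1.1) (positiveDensity ν z.1 ω)) := by
    have h3 : Measurable fun z : Horizon T × Horizon T => z.2.1 - z.1.1 :=
      (measurable_subtype_coe.comp measurable_snd).sub
        (measurable_subtype_coe.comp measurable_fst)
    have h4 : StronglyMeasurable fun z : Horizon T × Horizon T => state S y νs z.2 ω :=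
      hYm.comp_measurable measurable_snd
    have h5 : StronglyMeasurable fun z : Horizon T × Horizon T => positiveDensity ν z.1 ω :=
      hρm.comp_measurable measurable_fst
    exact hPi.measurable_gradient measurable_const measurable_snd h4 (fun z => hYr _ _)
      (stronglyMeasurable_semigroup_apply hS h3 h5) fun z => hS0 _ _ (positiveDensity_nonneg _ _)
  simp_rw [hν.controlledPart_eq, futureGradient_eq]
  exact lintegral_lintegral_Ici_eq hD
    (fun s t => hPi.gradient_nonneg (hYr _ _) (hS0 _ _ (positiveDensity_nonneg _ _)))
    fun t => integrableOn_semigroup_apply hS hρm (((hν.path ω).isPolar.integrableOn t).congr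
      (ae_restrict_of_ae (hν.positiveDensity_ae_eq ω).symm))

/-- The expected pairing of a control with the conditional expectation of the future gradient is the
marginal gain in the direction of the control. -/
theorem lintegral_pairing_eq_marginalGain {P : Measure Ω} [IsProbabilityMeasure P]
    {Γ : Horizon T → Ω → StrongDual ℝ E} (hPi : IsRunningProfit 𝓕 S y Pi)
    (hS : ∀ x, Continuous fun t => S t x) (hS0 : ∀ t x, 0 ≤ x → 0 ≤ S t x) (hy : 0 ≤ y)
    (hνs : IsRegularControl 𝓕 νs)
    (hΓ : IsConditionalExpectation P 𝓕 (futureGradient S y q Pi νs) Γ)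
    (hν : IsRegularControl 𝓕 ν) :
    ∫⁻ ω, pairing (fun s => Γ s ω) (fun s => ν s ω) ∂P = marginalGain P S y q Pi νs ν := by
  simp_rw [hν.pairing_eq Γ]
  rw [hΓ.lintegral_lintegral_eq (isPositiveIntegrand_futureGradient hPi hS hS0 hy hνs)
    hν.variation_lt_top hν.stronglyAdapted_variationProcess
    hν.stronglyProgressive_positiveDensity positiveDensity_nonneg]
  exact lintegral_congr fun ω => lintegral_futureGradient hPi hS hS0 hy hνs hν ω

end State

/-! ### Integrals of extended-real functions -/

section ExtIntegral

variable {α : Type*} [MeasurableSpace α] {m : Measure α}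

lemma extIntegral_congr_ae {h h' : α → EReal} (hh : h =ᵐ[m] h') :
    extIntegral m h = extIntegral m h' := by
  rw [extIntegral, extIntegral,
    lintegral_congr_ae (hh.mono fun a ha => show (h a).toENNReal = (h' a).toENNReal by rw [ha]),
    lintegral_congr_ae (hh.mono fun a ha => show (-h a).toENNReal = (-h' a).toENNReal by rw [ha])]

lemma extIntegral_coe (A : α → ℝ≥0∞) :
    extIntegral m (fun a => (A a : EReal)) = ((∫⁻ a, A a ∂m : ℝ≥0∞) : EReal) := by
  have h : ∀ a, (-(A a : EReal)).toENNReal = 0 := fun a =>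
    EReal.toENNReal_of_nonpos
      (EReal.neg_le_neg_iff.2 (EReal.coe_ennreal_nonneg _) |>.trans_eq neg_zero)
  simp only [extIntegral, h, EReal.toENNReal_coe, lintegral_zero, EReal.coe_ennreal_zero, sub_zero]

lemma coe_sub_coe_eq {a b c d : ℝ≥0∞} (hb : b ≠ ∞) (hd : d ≠ ∞) (h : a + d = b + c) :
    (c : EReal) - (d : EReal) = (a : EReal) - (b : EReal) := by
  lift b to ℝ≥0 using hb
  lift d to ℝ≥0 using hd
  induction a with
  | top =>
    rw [top_add, eq_comm, ENNReal.add_eq_top] at h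
    rw [h.resolve_left ENNReal.coe_ne_top]
    rfl
  | coe a =>
    have hc : c ≠ ∞ := by
      rintro rfl
      rw [add_top] at h
      exact (ENNReal.add_ne_top.2 ⟨ENNReal.coe_ne_top, ENNReal.coe_ne_top⟩) h
    lift c to ℝ≥0 using hc
    have h' : (a : ℝ) + d = b + c := by exact_mod_cast h
    change ((c : ℝ) : EReal) - ((d : ℝ) : EReal) = ((a : ℝ) : EReal) - ((b : ℝ) : EReal)
    rw [← EReal.coe_sub, ← EReal.coe_sub, show (c : ℝ) - d = a - b by linarith]

/-- A difference of nonnegative functions, of which the second has finite integral, is integrated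
termwise. -/
lemma extIntegral_coe_sub_coe {A B : α → ℝ≥0∞} (hA : AEMeasurable A m) (hB : AEMeasurable B m)
    (hfin : ∫⁻ a, B a ∂m ≠ ∞) :
    extIntegral m (fun a => (A a : EReal) - (B a : EReal)) =
      ((∫⁻ a, A a ∂m : ℝ≥0∞) : EReal) - ((∫⁻ a, B a ∂m : ℝ≥0∞) : EReal) := by
  have hpos : ∀ a, ((A a : EReal) - (B a : EReal)).toENNReal = A a - B a := fun a => by
    rw [EReal.toENNReal_sub (EReal.coe_ennreal_nonneg _)]
    simp
  have hneg : ∫⁻ a, (-((A a : EReal) - (B a : EReal))).toENNReal ∂m = ∫⁻ a, (B a - A a) ∂m := by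
    refine lintegral_congr_ae ((ae_lt_top' hB hfin).mono fun a ha => ?_)
    beta_reduce
    rw [EReal.neg_sub (Or.inl (EReal.coe_ennreal_ne_bot _))
      (Or.inr (by simpa using ha.ne)), add_comm, ← sub_eq_add_neg,
      EReal.toENNReal_sub (EReal.coe_ennreal_nonneg _)]
    simp
  rw [extIntegral, hneg]
  simp_rw [hpos]
  refine coe_sub_coe_eq hfin (ne_top_of_le_ne_top hfin (lintegral_mono fun a => tsub_le_self)) ?_
  rw [← lintegral_add_left' hA, ← lintegral_add_left' hB]
  exact lintegral_congr fun a => (add_tsub_eq_max).trans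
    ((max_comm _ _).trans add_tsub_eq_max.symm)

end ExtIntegral

/-! ### The integral of a functional of variable sign -/

section DualIntegral

variable {T : ℝ≥0∞} {E : Type*} [NormedAddCommGroup E] [NormedSpace ℝ E] [CompleteSpace E]
  [PartialOrder E] [IsOrderedAddMonoid E] [IsOrderedModule ℝ E] [OrderClosedTopology E]
  [HasPathDensity E] {f : Horizon T → E} {φ ψ : Horizon T → StrongDual ℝ E}

lemma dualIntegral_eq_pairing (hf : IsMonotonePath f) (hφ0 : ∀ s v, 0 ≤ v → 0 ≤ φ s v) :
    dualIntegral φ f = (pairing φ f : EReal) := by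
  rw [pairing, ← extIntegral_coe, dualIntegral]
  refine extIntegral_congr_ae (hf.ae_nonneg.mono fun s hs => ?_)
  exact (max_eq_left (EReal.coe_le_coe_iff.2 (hφ0 s _ hs))).symm.trans
    (EReal.coe_ennreal_ofReal).symm

lemma dualIntegral_sub (hf : IsMonotonePath f) (hφ : StronglyMeasurable φ)
    (hφ0 : ∀ s v, 0 ≤ v → 0 ≤ φ s v) (hψ : StronglyMeasurable ψ)
    (hψ0 : ∀ s v, 0 ≤ v → 0 ≤ ψ s v) (hfin : pairing ψ f ≠ ∞) :
    dualIntegral (fun s => φ s - ψ s) f = (pairing φ f : EReal) - (pairing ψ f : EReal) := by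
  have hρ := hf.isPolar.stronglyMeasurable
  rw [dualIntegral]
  refine (extIntegral_congr_ae (hf.ae_nonneg.mono fun s hs => ?_)).trans
    (extIntegral_coe_sub_coe (measurable_apply hφ hρ).ennreal_ofReal.aemeasurable
      (measurable_apply hψ hρ).ennreal_ofReal.aemeasurable hfin)
  rw [EReal.coe_ennreal_ofReal, max_eq_left (hφ0 s _ hs), EReal.coe_ennreal_ofReal,
    max_eq_left (hψ0 s _ hs), ← EReal.coe_sub]
  rfl

end DualIntegral

/-! ### First-order conditions -/

section Criterion

variable {T : ℝ≥0∞} {Ω : Type*} {mΩ : MeasurableSpace Ω} {𝓕 : Filtration (Horizon T) mΩ}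
  [𝓕.IsRightContinuous] {P : Measure Ω} [IsProbabilityMeasure P]
  {E : Type*} [NormedAddCommGroup E] [NormedSpace ℝ E] [Lattice E] [HasSolidNorm E]
  [IsOrderedAddMonoid E] [IsOrderedModule ℝ E] [CompleteSpace E] [HasPathDensity E]
  {ν νs : Horizon T → Ω → E} {S : ℝ≥0 → E →L[ℝ] E} {y : E} {Pi : Ω → Horizon T → E → ℝ}
  {q : Measure (Horizon T)} [IsFiniteMeasure q] {Φ : Horizon T → Ω → StrongDual ℝ E}

/-- The expected running profit of a control, an element of `[0, ∞]`. -/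
def expectedProfit (P : Measure Ω) (S : ℝ≥0 → E →L[ℝ] E) (y : E) (q : Measure (Horizon T))
    (Pi : Ω → Horizon T → E → ℝ) (ν : Horizon T → Ω → E) : ℝ≥0∞ :=
  ∫⁻ ω, ∫⁻ t, ENNReal.ofReal (Pi ω t (state S y ν t ω)) ∂q ∂P

/-- The expected cost of a control. -/
def expectedCost (P : Measure Ω) (Φ : Horizon T → Ω → StrongDual ℝ E) (ν : Horizon T → Ω → E) :
    ℝ≥0∞ :=
  ∫⁻ ω, pairing (fun s => Φ s ω) (fun s => ν s ω) ∂P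

lemma IsRegularControl.add_smul (hνs : IsRegularControl 𝓕 νs) (hν : IsRegularControl 𝓕 ν) {a b : ℝ}
    (ha : 0 ≤ a) (hb : 0 ≤ b) : IsRegularControl 𝓕 fun t ω => a • νs t ω + b • ν t ω where
  adapted t := ((hνs.adapted t).const_smul a).add ((hν.adapted t).const_smul b)
  path ω := (hνs.path ω).add_smul (hν.path ω) ha hb

lemma expectedCost_add_smul (hνs : IsRegularControl 𝓕 νs) (hν : IsRegularControl 𝓕 ν) {a b : ℝ}
    (ha : 0 ≤ a) (hb : 0 ≤ b) (hΦ : StronglyMeasurable fun p : Horizon T × Ω => Φ p.1 p.2)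
    (hΦ0 : ∀ s ω v, 0 ≤ v → 0 ≤ Φ s ω v) :
    expectedCost P Φ (fun t ω => a • νs t ω + b • ν t ω) =
      ENNReal.ofReal a * expectedCost P Φ νs + ENNReal.ofReal b * expectedCost P Φ ν := by
  have h1 : ∀ ω, pairing (fun s => Φ s ω) (fun s => a • νs s ω + b • ν s ω) =
      ENNReal.ofReal a * pairing (fun s => Φ s ω) (fun s => νs s ω) +
      ENNReal.ofReal b * pairing (fun s => Φ s ω) (fun s => ν s ω) := fun ω =>
    pairing_add_smul (hνs.path ω) (hν.path ω) ha hb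
      (hΦ.comp_measurable (measurable_prodMk_right (y := ω))) fun s => hΦ0 s ω
  simp only [expectedCost, h1]
  rw [lintegral_add_left ((hνs.measurable_pairing hΦ).const_mul _),
    lintegral_const_mul _ (hνs.measurable_pairing hΦ),
    lintegral_const_mul _ (hν.measurable_pairing hΦ)]

lemma controlledPart_add_smul (hS : ∀ x, Continuous fun t => S t x) (hνs : IsRegularControl 𝓕 νs)
    (hν : IsRegularControl 𝓕 ν) {a b : ℝ} (ha : 0 ≤ a) (hb : 0 ≤ b) (t : Horizon T) (ω : Ω) :
    controlledPart S (fun t ω => a • νs t ω + b • ν t ω) t ω =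
      a • controlledPart S νs t ω + b • controlledPart S ν t ω :=
  convolution_add_smul hS (hνs.path ω).toIsPath (hν.path ω).toIsPath
    ((hνs.path ω).add_smul (hν.path ω) ha hb).toIsPath (fun _ => rfl) t

lemma IsRegularControl.stronglyMeasurable_state_swap (hν : IsRegularControl 𝓕 ν)
    (hS : ∀ x, Continuous fun t => S t x) :
    StronglyMeasurable fun p : Ω × Horizon T => state S y ν p.2 p.1 :=
  (hν.stronglyMeasurable_state hS).comp_measurable measurable_swap

lemma IsRegularControl.stronglyMeasurable_controlledPart_swap (hν : IsRegularControl 𝓕 ν)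
    (hS : ∀ x, Continuous fun t => S t x) :
    StronglyMeasurable fun p : Ω × Horizon T => controlledPart S ν p.2 p.1 :=
  (hν.stronglyMeasurable_controlledPart hS).comp_measurable measurable_swap

section

variable (hPi : IsRunningProfit 𝓕 S y Pi) (hS : ∀ x, Continuous fun t => S t x)
  (hS0 : ∀ t x, 0 ≤ x → 0 ≤ S t x) (hy : 0 ≤ y)

include hPi hS hS0 hy

lemma measurable_profit (hν : IsRegularControl 𝓕 ν) :
    Measurable fun p : Ω × Horizon T => Pi p.1 p.2 (state S y ν p.2 p.1) :=
  hPi.measurable_comp measurable_fst measurable_snd (hν.stronglyMeasurable_state_swap hS)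
    fun _ => (hν.state_mem_reachable hS0 hy _ _).1

lemma measurable_gain (hνs : IsRegularControl 𝓕 νs) (hν : IsRegularControl 𝓕 ν) :
    Measurable fun p : Ω × Horizon T =>
      profitGradient S y Pi p.1 p.2 (state S y νs p.2 p.1) (controlledPart S ν p.2 p.1) :=
  hPi.measurable_gradient measurable_fst measurable_snd (hνs.stronglyMeasurable_state_swap hS)
    (fun _ => hνs.state_mem_reachable hS0 hy _ _) (hν.stronglyMeasurable_controlledPart_swap hS)
    fun _ => hν.controlledPart_nonneg hS0 _ _

lemma expectedProfit_eq (hν : IsRegularControl 𝓕 ν) : expectedProfit P S y q Pi ν =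
    ∫⁻ p, ENNReal.ofReal (Pi p.1 p.2 (state S y ν p.2 p.1)) ∂(P.prod q) :=
  (lintegral_prod _ (measurable_profit hPi hS hS0 hy hν).ennreal_ofReal.aemeasurable).symm

lemma marginalGain_eq (hνs : IsRegularControl 𝓕 νs) (hν : IsRegularControl 𝓕 ν) :
    marginalGain P S y q Pi νs ν = ∫⁻ p, ENNReal.ofReal
      (profitGradient S y Pi p.1 p.2 (state S y νs p.2 p.1) (controlledPart S ν p.2 p.1))
      ∂(P.prod q) :=
  (lintegral_prod _ (measurable_gain hPi hS hS0 hy hνs hν).ennreal_ofReal.aemeasurable).symm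

/-- The concavity of the running profit in integrated form. -/
lemma expectedProfit_add_le (hνs : IsRegularControl 𝓕 νs) (hν : IsRegularControl 𝓕 ν) :
    expectedProfit P S y q Pi ν + marginalGain P S y q Pi νs νs ≤
      expectedProfit P S y q Pi νs + marginalGain P S y q Pi νs ν := by
  rw [expectedProfit_eq hPi hS hS0 hy hν, expectedProfit_eq hPi hS hS0 hy hνs,
    marginalGain_eq hPi hS hS0 hy hνs hν, marginalGain_eq hPi hS hS0 hy hνs hνs,
    ← lintegral_add_left (measurable_profit hPi hS hS0 hy hν).ennreal_ofReal,
    ← lintegral_add_left (measurable_profit hPi hS hS0 hy hνs).ennreal_ofReal]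
  refine lintegral_mono fun ⟨ω, t⟩ => ?_
  have hk := hνs.state_mem_reachable hS0 hy t ω
  have hl := hν.state_mem_reachable hS0 hy t ω
  have h1 := hPi.sub_le_gradient (ω := ω) hk hl
  rw [show state S y ν t ω - state S y νs t ω = controlledPart S ν t ω - controlledPart S νs t ω by
    rw [state_eq, state_eq, add_sub_add_left_eq_sub], map_sub] at h1
  beta_reduce
  rw [← ENNReal.ofReal_add (hPi.nonneg ω t _ hl.1)
    (hPi.gradient_nonneg hk (hνs.controlledPart_nonneg hS0 t ω)),
    ← ENNReal.ofReal_add (hPi.nonneg ω t _ hk.1)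
    (hPi.gradient_nonneg hk (hν.controlledPart_nonneg hS0 t ω))]
  exact ENNReal.ofReal_le_ofReal (by linarith)

variable (hΦ : StronglyMeasurable fun p : Horizon T × Ω => Φ p.1 p.2)
  (hΦ0 : ∀ s ω v, 0 ≤ v → 0 ≤ Φ s ω v)

include hΦ hΦ0

/-- At an optimal control, adding a small multiple of another control is not profitable: the marginal
gain does not exceed the cost, by Fatou's lemma. -/
lemma marginalGain_le_expectedCost (hνs : IsRegularControl 𝓕 νs) (hν : IsRegularControl 𝓕 ν)
    (hb : expectedCost P Φ νs ≠ ∞) (ha : expectedProfit P S y q Pi νs ≠ ∞)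
    (hc : expectedCost P Φ ν ≠ ∞)
    (hopt : ∀ ν', IsRegularControl 𝓕 ν' → expectedCost P Φ ν' ≠ ∞ →
      expectedProfit P S y q Pi ν' + expectedCost P Φ νs ≤
        expectedProfit P S y q Pi νs + expectedCost P Φ ν') :
    marginalGain P S y q Pi νs ν ≤ expectedCost P Φ ν := by
  have hkr := fun p : Ω × Horizon T => hνs.state_mem_reachable hS0 hy p.2 p.1
  have hv0 := fun p : Ω × Horizon T => hν.controlledPart_nonneg hS0 p.2 p.1
  have hlr : ∀ (n : ℕ) (p : Ω × Horizon T), state S y νs p.2 p.1 +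
      (1 / ((n : ℝ) + 1)) • controlledPart S ν p.2 p.1 ∈ reachable S y p.2 := fun n p =>
    reachable_add_smul (hkr p) (hv0 p) n
  have hFm := measurable_profit hPi hS hS0 hy hνs
  have hFnm : ∀ n : ℕ, Measurable fun p : Ω × Horizon T => Pi p.1 p.2 (state S y νs p.2 p.1 +
      (1 / ((n : ℝ) + 1)) • controlledPart S ν p.2 p.1) := fun n =>
    hPi.measurable_comp measurable_fst measurable_snd ((hνs.stronglyMeasurable_state_swap hS).add
      ((hν.stronglyMeasurable_controlledPart_swap hS).const_smul _)) fun p => (hlr n p).1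
  have hDm : ∀ n : ℕ, Measurable fun p : Ω × Horizon T => Pi p.1 p.2 (state S y νs p.2 p.1 +
      (1 / ((n : ℝ) + 1)) • controlledPart S ν p.2 p.1) - Pi p.1 p.2 (state S y νs p.2 p.1) :=
    fun n => (hFnm n).sub hFm
  have hbound : ∀ n : ℕ, ∫⁻ p : Ω × Horizon T, ENNReal.ofReal (((n : ℝ) + 1) *
      (Pi p.1 p.2 (state S y νs p.2 p.1 + (1 / ((n : ℝ) + 1)) • controlledPart S ν p.2 p.1) -
        Pi p.1 p.2 (state S y νs p.2 p.1))) ∂(P.prod q) ≤ expectedCost P Φ ν := by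
    intro n
    have hn0 : (0 : ℝ) < (n : ℝ) + 1 := by positivity
    have hreg := hνs.add_smul hν zero_le_one (one_div_succ_nonneg_and_le n).1
    have hcost := expectedCost_add_smul (P := P) hνs hν zero_le_one
      (one_div_succ_nonneg_and_le n).1 hΦ hΦ0
    rw [ENNReal.ofReal_one, one_mul] at hcost
    have hstate : ∀ p : Ω × Horizon T,
        state S y (fun t ω => (1 : ℝ) • νs t ω + (1 / ((n : ℝ) + 1)) • ν t ω) p.2 p.1 =
        state S y νs p.2 p.1 + (1 / ((n : ℝ) + 1)) • controlledPart S ν p.2 p.1 := fun p => by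
      rw [state_eq, controlledPart_add_smul hS hνs hν zero_le_one
        (one_div_succ_nonneg_and_le n).1, one_smul, ← add_assoc]
      rfl
    have h1 := hopt _ hreg (by
      rw [hcost]
      exact ENNReal.add_ne_top.2 ⟨hb, ENNReal.mul_ne_top ENNReal.ofReal_ne_top hc⟩)
    rw [hcost, expectedProfit_eq hPi hS hS0 hy hreg] at h1
    simp only [hstate] at h1
    have h2 : ∫⁻ p : Ω × Horizon T, ENNReal.ofReal (Pi p.1 p.2 (state S y νs p.2 p.1 +
        (1 / ((n : ℝ) + 1)) • controlledPart S ν p.2 p.1)) ∂(P.prod q) =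
        expectedProfit P S y q Pi νs + ∫⁻ p : Ω × Horizon T, ENNReal.ofReal
          (Pi p.1 p.2 (state S y νs p.2 p.1 + (1 / ((n : ℝ) + 1)) • controlledPart S ν p.2 p.1) -
            Pi p.1 p.2 (state S y νs p.2 p.1)) ∂(P.prod q) := by
      rw [expectedProfit_eq hPi hS hS0 hy hνs, ← lintegral_add_left hFm.ennreal_ofReal]
      refine lintegral_congr fun p => ?_
      rw [← ENNReal.ofReal_add (hPi.nonneg _ _ _ (hkr p).1)
        (sub_nonneg.2 (hPi.monotone _ _ (hkr p).1 (hlr n p).1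
          (le_add_of_nonneg_right (smul_nonneg (one_div_succ_nonneg_and_le n).1 (hv0 p))))),
        add_sub_cancel]
    rw [h2, add_right_comm, ← add_assoc,
      ENNReal.add_le_add_iff_left (ENNReal.add_ne_top.2 ⟨ha, hb⟩)] at h1
    simp_rw [ENNReal.ofReal_mul hn0.le]
    rw [lintegral_const_mul _ (hDm n).ennreal_ofReal]
    refine (mul_le_mul_right h1 _).trans_eq ?_
    rw [← mul_assoc, ← ENNReal.ofReal_mul hn0.le, mul_one_div_cancel hn0.ne', ENNReal.ofReal_one,
      one_mul]
  rw [marginalGain_eq hPi hS hS0 hy hνs hν]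
  calc _ = ∫⁻ p : Ω × Horizon T, liminf (fun n : ℕ => ENNReal.ofReal (((n : ℝ) + 1) *
      (Pi p.1 p.2 (state S y νs p.2 p.1 + (1 / ((n : ℝ) + 1)) • controlledPart S ν p.2 p.1) -
        Pi p.1 p.2 (state S y νs p.2 p.1)))) atTop ∂(P.prod q) :=
        lintegral_congr fun p => (ENNReal.tendsto_ofReal
          (hPi.tendsto_gradient (hkr p) fun n => hlr n p)).liminf_eq.symm
    _ ≤ liminf (fun n : ℕ => ∫⁻ p : Ω × Horizon T, ENNReal.ofReal (((n : ℝ) + 1) *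
      (Pi p.1 p.2 (state S y νs p.2 p.1 + (1 / ((n : ℝ) + 1)) • controlledPart S ν p.2 p.1) -
        Pi p.1 p.2 (state S y νs p.2 p.1))) ∂(P.prod q)) atTop :=
        lintegral_liminf_le fun n => ((hDm n).const_mul _).ennreal_ofReal
    _ ≤ _ := liminf_le_of_le (by isBoundedDefault) fun b hb =>
        let ⟨n, hn⟩ := hb.exists
        hn.trans (hbound n)

/-- At an optimal control, cutting the control back by a small proportion is not profitable: by
dominated convergence its cost does not exceed its marginal gain. The differences of the profits are
dominated by the profit itself, as the running profit is concave and nonnegative. -/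
lemma expectedCost_le_marginalGain_self (hνs : IsRegularControl 𝓕 νs)
    (hb : expectedCost P Φ νs ≠ ∞) (ha : expectedProfit P S y q Pi νs ≠ ∞)
    (hopt : ∀ ν', IsRegularControl 𝓕 ν' → expectedCost P Φ ν' ≠ ∞ →
      expectedProfit P S y q Pi ν' + expectedCost P Φ νs ≤
        expectedProfit P S y q Pi νs + expectedCost P Φ ν') :
    expectedCost P Φ νs ≤ marginalGain P S y q Pi νs νs := by
  have hkr := fun p : Ω × Horizon T => hνs.state_mem_reachable hS0 hy p.2 p.1
  have hv0 := fun p : Ω × Horizon T => hνs.controlledPart_nonneg hS0 p.2 p.1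
  have hstate : ∀ (n : ℕ) (p : Ω × Horizon T),
      state S y (fun t ω => (1 - 1 / ((n : ℝ) + 1)) • νs t ω + (0 : ℝ) • νs t ω) p.2 p.1 =
      state S y νs p.2 p.1 + (1 / ((n : ℝ) + 1)) • -controlledPart S νs p.2 p.1 := fun n p => by
    rw [state_eq, controlledPart_add_smul hS hνs hνs (one_div_succ_nonneg_and_le n).2 le_rfl,
      zero_smul, add_zero, sub_smul, one_smul, smul_neg, ← sub_eq_add_neg, ← add_sub_assoc]
    rfl
  have hreg := fun n : ℕ => hνs.add_smul hνs (one_div_succ_nonneg_and_le n).2 le_rfl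
  have hlr : ∀ (n : ℕ) (p : Ω × Horizon T), state S y νs p.2 p.1 +
      (1 / ((n : ℝ) + 1)) • -controlledPart S νs p.2 p.1 ∈ reachable S y p.2 := fun n p => by
    rw [← hstate]
    exact (hreg n).state_mem_reachable hS0 hy p.2 p.1
  have hFm := measurable_profit hPi hS hS0 hy hνs
  have hFnm : ∀ n : ℕ, Measurable fun p : Ω × Horizon T => Pi p.1 p.2 (state S y νs p.2 p.1 +
      (1 / ((n : ℝ) + 1)) • -controlledPart S νs p.2 p.1) := fun n => by
    simp_rw [← hstate]
    exact measurable_profit hPi hS hS0 hy (hreg n)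
  have hmono : ∀ (n : ℕ) (p : Ω × Horizon T), Pi p.1 p.2 (state S y νs p.2 p.1 +
      (1 / ((n : ℝ) + 1)) • -controlledPart S νs p.2 p.1) ≤ Pi p.1 p.2 (state S y νs p.2 p.1) :=
    fun n p => hPi.monotone _ _ (hlr n p).1 (hkr p).1 (by
      rw [smul_neg]
      exact add_le_of_nonpos_right
        (neg_nonpos.2 (smul_nonneg (one_div_succ_nonneg_and_le n).1 (hv0 p))))
  have hDm : ∀ n : ℕ, Measurable fun p : Ω × Horizon T => Pi p.1 p.2 (state S y νs p.2 p.1) -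
      Pi p.1 p.2 (state S y νs p.2 p.1 +
        (1 / ((n : ℝ) + 1)) • -controlledPart S νs p.2 p.1) :=
    fun n => hFm.sub (hFnm n)
  have hbound : ∀ n : ℕ, expectedCost P Φ νs ≤ ∫⁻ p : Ω × Horizon T, ENNReal.ofReal
      (((n : ℝ) + 1) * (Pi p.1 p.2 (state S y νs p.2 p.1) - Pi p.1 p.2 (state S y νs p.2 p.1 +
        (1 / ((n : ℝ) + 1)) • -controlledPart S νs p.2 p.1))) ∂(P.prod q) := by
    intro n
    have hn0 : (0 : ℝ) < (n : ℝ) + 1 := by positivity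
    have hcost := expectedCost_add_smul (P := P) hνs hνs
      (one_div_succ_nonneg_and_le n).2 le_rfl hΦ hΦ0
    rw [ENNReal.ofReal_zero, zero_mul, add_zero] at hcost
    have h1 := hopt _ (hreg n) (by
      rw [hcost]
      exact ENNReal.mul_ne_top ENNReal.ofReal_ne_top hb)
    rw [hcost, expectedProfit_eq hPi hS hS0 hy (hreg n)] at h1
    simp only [hstate] at h1
    have h2 : expectedProfit P S y q Pi νs = ∫⁻ p : Ω × Horizon T, ENNReal.ofReal
        (Pi p.1 p.2 (state S y νs p.2 p.1 +
          (1 / ((n : ℝ) + 1)) • -controlledPart S νs p.2 p.1)) ∂(P.prod q) +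
        ∫⁻ p : Ω × Horizon T, ENNReal.ofReal
          (Pi p.1 p.2 (state S y νs p.2 p.1) - Pi p.1 p.2 (state S y νs p.2 p.1 +
            (1 / ((n : ℝ) + 1)) • -controlledPart S νs p.2 p.1)) ∂(P.prod q) := by
      rw [expectedProfit_eq hPi hS hS0 hy hνs, ← lintegral_add_left (hFnm n).ennreal_ofReal]
      refine lintegral_congr fun p => ?_
      rw [← ENNReal.ofReal_add (hPi.nonneg _ _ _ (hlr n p).1) (sub_nonneg.2 (hmono n p)),
        add_sub_cancel]
    -- the cost splits into the cost that remains and the cost that is saved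
    have h3 : expectedCost P Φ νs = ENNReal.ofReal (1 - 1 / ((n : ℝ) + 1)) * expectedCost P Φ νs +
        ENNReal.ofReal (1 / ((n : ℝ) + 1)) * expectedCost P Φ νs := by
      rw [← add_mul, ← ENNReal.ofReal_add (one_div_succ_nonneg_and_le n).2
        (one_div_succ_nonneg_and_le n).1, sub_add_cancel, ENNReal.ofReal_one, one_mul]
    have hfin : ∫⁻ p : Ω × Horizon T, ENNReal.ofReal (Pi p.1 p.2 (state S y νs p.2 p.1 +
        (1 / ((n : ℝ) + 1)) • -controlledPart S νs p.2 p.1)) ∂(P.prod q) ≠ ∞ := by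
      intro htop
      rw [htop, top_add] at h2
      exact ha h2
    set A := ∫⁻ p : Ω × Horizon T, ENNReal.ofReal (Pi p.1 p.2 (state S y νs p.2 p.1 +
        (1 / ((n : ℝ) + 1)) • -controlledPart S νs p.2 p.1)) ∂(P.prod q)
    set J := ∫⁻ p : Ω × Horizon T, ENNReal.ofReal
          (Pi p.1 p.2 (state S y νs p.2 p.1) - Pi p.1 p.2 (state S y νs p.2 p.1 +
            (1 / ((n : ℝ) + 1)) • -controlledPart S νs p.2 p.1)) ∂(P.prod q) with hJ
    have h4 : ENNReal.ofReal (1 / ((n : ℝ) + 1)) * expectedCost P Φ νs ≤ J := by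
      refine (ENNReal.add_le_add_iff_left (a := A + ENNReal.ofReal (1 - 1 / ((n : ℝ) + 1)) *
        expectedCost P Φ νs) (ENNReal.add_ne_top.2
          ⟨hfin, ENNReal.mul_ne_top ENNReal.ofReal_ne_top hb⟩)).1 ?_
      rw [add_assoc, ← h3]
      refine h1.trans_eq ?_
      rw [h2, add_right_comm]
    simp_rw [ENNReal.ofReal_mul hn0.le]
    rw [lintegral_const_mul _ (hDm n).ennreal_ofReal]
    refine le_trans (Eq.le ?_) (mul_le_mul_right h4 (ENNReal.ofReal ((n : ℝ) + 1)))
    rw [← mul_assoc, ← ENNReal.ofReal_mul hn0.le, mul_one_div_cancel hn0.ne', ENNReal.ofReal_one,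
      one_mul]
  rw [marginalGain_eq hPi hS hS0 hy hνs hνs]
  refine ge_of_tendsto' (tendsto_lintegral_of_dominated_convergence
    (fun p => ENNReal.ofReal (Pi p.1 p.2 (state S y νs p.2 p.1)))
    (fun n : ℕ => ((hDm n).const_mul ((n : ℝ) + 1)).ennreal_ofReal)
    (fun n => ae_of_all _ fun p => ENNReal.ofReal_le_ofReal ?_) ?_ (ae_of_all _ fun p => ?_)) hbound
  -- domination: the reduced state lies on the segment from the state to the uncontrolled state
  · have h0 : S p.2.1 y ∈ reachable S y p.2 := ⟨hS0 _ _ hy, le_rfl⟩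
    have h1 := (hPi.concave p.1 p.2).2 (hkr p).1 h0.1 (one_div_succ_nonneg_and_le n).2
      (one_div_succ_nonneg_and_le n).1 (sub_add_cancel _ _)
    have h2 : (1 - 1 / ((n : ℝ) + 1)) • state S y νs p.2 p.1 + (1 / ((n : ℝ) + 1)) • S p.2.1 y =
        state S y νs p.2 p.1 + (1 / ((n : ℝ) + 1)) • -controlledPart S νs p.2 p.1 := by
      rw [state_eq, smul_neg, smul_add, sub_smul, sub_smul, one_smul, one_smul]
      abel
    rw [h2, smul_eq_mul, smul_eq_mul] at h1
    have h3 : 0 ≤ 1 / ((n : ℝ) + 1) * Pi p.1 p.2 (S p.2.1 y) :=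
      mul_nonneg (one_div_succ_nonneg_and_le n).1 (hPi.nonneg _ _ _ h0.1)
    have h4 : (0 : ℝ) < (n : ℝ) + 1 := by positivity
    have h5 : Pi p.1 p.2 (state S y νs p.2 p.1) / ((n : ℝ) + 1) =
        1 / ((n : ℝ) + 1) * Pi p.1 p.2 (state S y νs p.2 p.1) := by ring
    rw [← le_div_iff₀' h4, h5]
    linarith
  · rw [← expectedProfit_eq hPi hS hS0 hy hνs]
    exact ha
  · have h1 := (hPi.tendsto_gradient (ω := p.1) (hkr p) fun n => hlr n p).neg
    rw [← map_neg, neg_neg] at h1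
    refine ENNReal.tendsto_ofReal (h1.congr fun n => ?_)
    ring

/-- The characterization of optimality in terms of the expected profit, cost and marginal gain.
Optimality is written without subtraction, as the costs of the competing controls are finite. -/
lemma optimal_iff (hνs : IsRegularControl 𝓕 νs)
    (hb : expectedCost P Φ νs ≠ ∞) (ha : expectedProfit P S y q Pi νs ≠ ∞) :
    (∀ ν, IsRegularControl 𝓕 ν → expectedCost P Φ ν ≠ ∞ →
      expectedProfit P S y q Pi ν + expectedCost P Φ νs ≤
        expectedProfit P S y q Pi νs + expectedCost P Φ ν) ↔
    (∀ ν, IsRegularControl 𝓕 ν → expectedCost P Φ ν ≠ ∞ →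
      marginalGain P S y q Pi νs ν ≤ expectedCost P Φ ν) ∧
      marginalGain P S y q Pi νs νs = expectedCost P Φ νs := by
  refine ⟨fun h => ?_, fun h ν hν hc => ?_⟩
  · have h1 := fun ν hν hc =>
      marginalGain_le_expectedCost hPi hS hS0 hy hΦ hΦ0 hνs (ν := ν) hν hb ha hc h
    exact ⟨h1, le_antisymm (h1 νs hνs hb)
      (expectedCost_le_marginalGain_self hPi hS hS0 hy hΦ hΦ0 hνs hb ha h)⟩
  · rw [← h.2]
    exact (expectedProfit_add_le hPi hS hS0 hy hνs hν).trans (add_le_add_right (h.1 ν hν hc) _)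

end

end Criterion

/-! ### Modification on null events -/

section Modification

variable {T : ℝ≥0∞} {Ω : Type*} {mΩ : MeasurableSpace Ω} {𝓕 : Filtration (Horizon T) mΩ}
  {P : Measure Ω} {B : Set Ω} {F : Type*} [NormedAddCommGroup F] {X : Horizon T → Ω → F}

/-- The process `X`, replaced by zero on the event `B`. -/
def killOn (B : Set Ω) (X : Horizon T → Ω → F) (t : Horizon T) : Ω → F := Bᶜ.indicator (X t)

lemma killOn_of_mem {ω : Ω} (h : ω ∈ B) (t : Horizon T) : killOn B X t ω = 0 :=
  indicator_of_notMem (notMem_compl_iff.2 h) _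

lemma killOn_of_notMem {ω : Ω} (h : ω ∉ B) (t : Horizon T) : killOn B X t ω = X t ω :=
  indicator_of_mem h _

lemma ae_killOn_eq (hB : P B = 0) : ∀ᵐ ω ∂P, ∀ t, killOn B X t ω = X t ω := by
  filter_upwards [measure_eq_zero_iff_ae_notMem.1 hB] with ω hω t
  exact killOn_of_notMem hω t

lemma UsualConditions.measurableSet (h𝓕 : UsualConditions P 𝓕) (hB : P B = 0) (t : Horizon T) :
    MeasurableSet[𝓕 t] B := 𝓕.mono (Horizon.zero_le t) _ (h𝓕.complete B hB)

lemma UsualConditions.stronglyAdapted_killOn (h𝓕 : UsualConditions P 𝓕) (hB : P B = 0)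
    (hX : StronglyAdapted 𝓕 X) : StronglyAdapted 𝓕 (killOn B X) := fun t =>
  (hX t).indicator (h𝓕.measurableSet hB t).compl

lemma UsualConditions.stronglyProgressive_killOn (h𝓕 : UsualConditions P 𝓕) (hB : P B = 0)
    (hX : IsStronglyProgressive 𝓕 X) : IsStronglyProgressive 𝓕 (killOn B X) := fun t => by
  let _ : MeasurableSpace Ω := 𝓕 t
  exact (hX t).indicator (s := Prod.snd ⁻¹' Bᶜ)
    (measurable_snd (h𝓕.measurableSet hB t).compl)

end Modification

/-! ### Reduction to controls with regular paths -/

section Regularization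

variable {T : ℝ≥0∞} {Ω : Type*} {mΩ : MeasurableSpace Ω} {𝓕 : Filtration (Horizon T) mΩ}
  {P : Measure Ω} [IsProbabilityMeasure P] {E : Type*} [NormedAddCommGroup E]
  [NormedSpace ℝ E] [Lattice E] [HasSolidNorm E]
  [IsOrderedAddMonoid E] [IsOrderedModule ℝ E] [CompleteSpace E] [HasPathDensity E]
  {ν νs : Horizon T → Ω → E} {S : ℝ≥0 → E →L[ℝ] E} {y : E} {Pi : Ω → Horizon T → E → ℝ}
  {q : Measure (Horizon T)} [IsFiniteMeasure q] {Φ Φ' Γ Γ' : Horizon T → Ω → StrongDual ℝ E}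

lemma isMonotonePath_zero : IsMonotonePath fun _ : Horizon T => (0 : E) where
  rightContinuous _ := continuousWithinAt_const
  finiteVariation t := by
    rw [eVariationOn.constant_on]
    · exact ENNReal.zero_ne_top
    · rintro _ ⟨_, _, rfl⟩ _ ⟨_, _, rfl⟩
      rfl
  nonneg _ := le_rfl
  monotone _ _ _ := le_rfl

/-- Under the usual conditions a control is indistinguishable from one all of whose paths are
regular. -/
lemma IsControl.exists_regular (h𝓕 : UsualConditions P 𝓕) (hν : IsControl P 𝓕 ν) :
    ∃ ν', IsRegularControl 𝓕 ν' ∧ ∀ᵐ ω ∂P, ∀ t, ν' t ω = ν t ω := by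
  have h : ∀ᵐ ω ∂P, IsMonotonePath fun t => ν t ω := by
    filter_upwards [hν.nonneg, hν.monotone, hν.rightContinuous, hν.finiteVariation] with ω h1 h2 h3 h4
    exact ⟨⟨h3, h4⟩, h1, h2⟩
  have hB : P {ω | ¬IsMonotonePath fun t => ν t ω} = 0 := ae_iff.1 h
  refine ⟨killOn {ω | ¬IsMonotonePath fun t => ν t ω} ν,
    ⟨h𝓕.stronglyAdapted_killOn hB hν.adapted, fun ω => ?_⟩, ae_killOn_eq hB⟩
  by_cases hω : ω ∈ {ω | ¬IsMonotonePath fun t => ν t ω}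
  · simp_rw [killOn_of_mem hω]
    exact isMonotonePath_zero
  · simp_rw [killOn_of_notMem hω]
    exact not_not.1 hω

lemma IsRegularControl.isControl (hν : IsRegularControl 𝓕 ν) : IsControl P 𝓕 ν where
  adapted := hν.adapted
  nonneg := ae_of_all _ fun ω => (hν.path ω).nonneg
  monotone := ae_of_all _ fun ω => (hν.path ω).monotone
  rightContinuous := ae_of_all _ fun ω => (hν.path ω).rightContinuous
  finiteVariation := ae_of_all _ fun ω => (hν.path ω).finiteVariation

/-- The marginal cost is indistinguishable from a jointly measurable process with nonnegative values. -/
lemma IsMarginalCost.exists_regular (h𝓕 : UsualConditions P 𝓕) (hΦ : IsMarginalCost P 𝓕 Φ) :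
    ∃ Φ' : Horizon T → Ω → StrongDual ℝ E,
      (StronglyMeasurable fun p : Horizon T × Ω => Φ' p.1 p.2) ∧
      (∀ s ω v, 0 ≤ v → 0 ≤ Φ' s ω v) ∧ ∀ᵐ ω ∂P, ∀ t, Φ' t ω = Φ t ω := by
  have hB : P {ω | ¬((∀ t v, 0 ≤ v → 0 ≤ Φ t ω v) ∧
      ∀ t, ContinuousWithinAt (fun s => Φ s ω) (Ici t) t)} = 0 :=
    ae_iff.1 (hΦ.nonneg.and hΦ.rightContinuous)
  set B := {ω | ¬((∀ t v, 0 ≤ v → 0 ≤ Φ t ω v) ∧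
      ∀ t, ContinuousWithinAt (fun s => Φ s ω) (Ici t) t)}
  refine ⟨killOn B Φ, stronglyMeasurable_of_restrict_grid fun n =>
    stronglyMeasurable_restrict_of_rightContinuous _ (fun s _ =>
      (h𝓕.stronglyAdapted_killOn hB hΦ.adapted s).mono (𝓕.le s)) fun ω s => ?_, fun s ω v hv => ?_,
    ae_killOn_eq hB⟩
  · by_cases hω : ω ∈ B
    · simp_rw [killOn_of_mem hω]
      exact continuousWithinAt_const
    · simp_rw [killOn_of_notMem hω]
      exact (not_not.1 hω).2 s
  · by_cases hω : ω ∈ B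
    · rw [killOn_of_mem hω]
      exact le_rfl
    · rw [killOn_of_notMem hω]
      exact (not_not.1 hω).1 s v hv

lemma futureGradient_congr {νs' : Horizon T → Ω → E} {ω : Ω} (h : ∀ t, νs' t ω = νs t ω)
    (s : Horizon T) (v : E) :
    futureGradient S y q Pi νs' s ω v = futureGradient S y q Pi νs s ω v := by
  simp only [futureGradient, h]

/-- The conditional expectation may be taken nonnegative everywhere, and for a modification of the
control. -/
lemma IsConditionalExpectation.exists_regular (h𝓕 : UsualConditions P 𝓕)
    {νs' : Horizon T → Ω → E} (hνs : ∀ᵐ ω ∂P, ∀ t, νs' t ω = νs t ω)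
    (hΓ : IsConditionalExpectation P 𝓕 (futureGradient S y q Pi νs) Γ) :
    ∃ Γ', IsConditionalExpectation P 𝓕 (futureGradient S y q Pi νs') Γ' ∧
      (∀ s ω v, 0 ≤ v → 0 ≤ Γ' s ω v) ∧ ∀ᵐ ω ∂P, ∀ t, Γ' t ω = Γ t ω := by
  have hB : P {ω | ¬(∀ s v, 0 ≤ v → 0 ≤ Γ s ω v)} = 0 := ae_iff.1 hΓ.nonneg
  set B := {ω | ¬(∀ s v, 0 ≤ v → 0 ≤ Γ s ω v)}
  have h0 : ∀ s ω v, 0 ≤ v → 0 ≤ killOn B Γ s ω v := fun s ω v hv => by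
    by_cases hω : ω ∈ B
    · rw [killOn_of_mem hω]
      exact le_rfl
    · rw [killOn_of_notMem hω]
      exact not_not.1 hω s v hv
  refine ⟨killOn B Γ, ⟨h𝓕.stronglyProgressive_killOn hB hΓ.progressive,
    ae_of_all _ fun ω s v => h0 s ω v, fun τ hτ v hv => ?_⟩, h0, ae_killOn_eq hB⟩
  have h1 : (fun ω => ENNReal.ofReal (killOn B Γ (τ ω) ω v)) =ᵐ[P]
      fun ω => ENNReal.ofReal (Γ (τ ω) ω v) := by
    filter_upwards [ae_killOn_eq (X := Γ) hB] with ω hω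
    rw [hω]
  have h2 : (fun ω => futureGradient S y q Pi νs (τ ω) ω v) =ᵐ[P]
      fun ω => futureGradient S y q Pi νs' (τ ω) ω v := by
    filter_upwards [hνs] with ω hω
    exact (futureGradient_congr hω _ _).symm
  exact (h1.trans (hΓ.condExp τ hτ v hv)).trans (condLExp_congr_ae h2)

variable [𝓕.IsRightContinuous]

lemma IsRegularControl.extIntegral_dualIntegral (hν : IsRegularControl 𝓕 ν)
    (hΦ0 : ∀ s ω v, 0 ≤ v → 0 ≤ Φ' s ω v) (hΦ : ∀ᵐ ω ∂P, ∀ t, Φ' t ω = Φ t ω) :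
    extIntegral P (fun ω => dualIntegral (fun s => Φ s ω) fun s => ν s ω) =
      (expectedCost P Φ' ν : EReal) := by
  rw [expectedCost, ← extIntegral_coe]
  refine extIntegral_congr_ae (hΦ.mono fun ω hω => ?_)
  simp only [← hω]
  exact dualIntegral_eq_pairing (hν.path ω) fun s => hΦ0 s ω

lemma IsRegularControl.ae_pairing_ne_top (hν : IsRegularControl 𝓕 ν)
    (hΦm : StronglyMeasurable fun p : Horizon T × Ω => Φ' p.1 p.2)
    (hb : expectedCost P Φ' ν ≠ ∞) :
    ∀ᵐ ω ∂P, pairing (fun s => Φ' s ω) (fun s => ν s ω) ≠ ∞ :=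
  (ae_lt_top (hν.measurable_pairing hΦm) hb).mono fun _ h => h.ne

lemma IsRegularControl.payoff_eq (hν : IsRegularControl 𝓕 ν) (hPi : IsRunningProfit 𝓕 S y Pi)
    (hS : ∀ x, Continuous fun t => S t x) (hS0 : ∀ t x, 0 ≤ x → 0 ≤ S t x) (hy : 0 ≤ y)
    (hΦm : StronglyMeasurable fun p : Horizon T × Ω => Φ' p.1 p.2)
    (hΦ0 : ∀ s ω v, 0 ≤ v → 0 ≤ Φ' s ω v) (hΦ : ∀ᵐ ω ∂P, ∀ t, Φ' t ω = Φ t ω)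
    (hb : expectedCost P Φ' ν ≠ ∞) :
    payoff P S y q Pi Φ ν =
      (expectedProfit P S y q Pi ν : EReal) - (expectedCost P Φ' ν : EReal) := by
  refine (extIntegral_congr_ae (hΦ.mono fun ω hω => ?_)).trans
    (extIntegral_coe_sub_coe ?_ (hν.measurable_pairing hΦm).aemeasurable hb)
  · simp only [← hω]
    rw [dualIntegral_eq_pairing (hν.path ω) fun s => hΦ0 s ω]
    rfl
  · exact (measurable_profit hPi hS hS0 hy hν).ennreal_ofReal.lintegral_prod_right'.aemeasurable

lemma IsRegularControl.extIntegral_dualIntegral_sub (hν : IsRegularControl 𝓕 ν)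
    (hΦm : StronglyMeasurable fun p : Horizon T × Ω => Φ' p.1 p.2)
    (hΦ0 : ∀ s ω v, 0 ≤ v → 0 ≤ Φ' s ω v) (hΦ : ∀ᵐ ω ∂P, ∀ t, Φ' t ω = Φ t ω)
    (hΓm : StronglyMeasurable fun p : Horizon T × Ω => Γ' p.1 p.2)
    (hΓ0 : ∀ s ω v, 0 ≤ v → 0 ≤ Γ' s ω v) (hΓ : ∀ᵐ ω ∂P, ∀ t, Γ' t ω = Γ t ω)
    (hb : expectedCost P Φ' ν ≠ ∞) :
    extIntegral P (fun ω => dualIntegral (fun s => Γ s ω - Φ s ω) fun s => ν s ω) =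
      ((∫⁻ ω, pairing (fun s => Γ' s ω) (fun s => ν s ω) ∂P : ℝ≥0∞) : EReal) -
        (expectedCost P Φ' ν : EReal) := by
  refine (extIntegral_congr_ae ?_).trans (extIntegral_coe_sub_coe
    (hν.measurable_pairing hΓm).aemeasurable (hν.measurable_pairing hΦm).aemeasurable hb)
  filter_upwards [hΦ, hΓ, hν.ae_pairing_ne_top hΦm hb] with ω h1 h2 h3
  simp only [← h1, ← h2]
  exact dualIntegral_sub (hν.path ω) (hΓm.comp_measurable (measurable_prodMk_right (y := ω)))
    (fun s => hΓ0 s ω) (hΦm.comp_measurable (measurable_prodMk_right (y := ω)))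
    (fun s => hΦ0 s ω) h3

lemma coe_sub_le_coe_sub_iff {a b c d : ℝ≥0∞} (ha : a ≠ ∞) (hb : b ≠ ∞) (hc : c ≠ ∞) (hd : d ≠ ∞) :
    (a : EReal) - b ≤ (c : EReal) - d ↔ a + d ≤ c + b := by
  lift a to ℝ≥0 using ha
  lift b to ℝ≥0 using hb
  lift c to ℝ≥0 using hc
  lift d to ℝ≥0 using hd
  change ((a : ℝ) : EReal) - ((b : ℝ) : EReal) ≤ ((c : ℝ) : EReal) - ((d : ℝ) : EReal) ↔ _
  rw [← EReal.coe_sub, ← EReal.coe_sub, EReal.coe_le_coe_iff, ← ENNReal.coe_add, ← ENNReal.coe_add,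
    ENNReal.coe_le_coe, ← NNReal.coe_le_coe]
  push_cast
  constructor <;> intro h <;> linarith

lemma coe_sub_nonpos_iff {a b : ℝ≥0∞} (hb : b ≠ ∞) : (a : EReal) - b ≤ 0 ↔ a ≤ b := by
  lift b to ℝ≥0 using hb
  induction a with
  | top => simp
  | coe a =>
    change ((a : ℝ) : EReal) - ((b : ℝ) : EReal) ≤ ((0 : ℝ) : EReal) ↔ _
    rw [← EReal.coe_sub, EReal.coe_le_coe_iff, ENNReal.coe_le_coe, sub_nonpos, NNReal.coe_le_coe]

lemma coe_sub_eq_zero_iff {a b : ℝ≥0∞} (hb : b ≠ ∞) : (a : EReal) - b = 0 ↔ a = b := by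
  lift b to ℝ≥0 using hb
  induction a with
  | top => simp
  | coe a =>
    change ((a : ℝ) : EReal) - ((b : ℝ) : EReal) = ((0 : ℝ) : EReal) ↔ _
    rw [← EReal.coe_sub, EReal.coe_eq_coe_iff, ENNReal.coe_inj, sub_eq_zero, NNReal.coe_inj]

/-- The characterization of optimality in an ordered Banach space whose paths of finite variation
have densities. -/
theorem isOptimal_iff (h𝓕 : UsualConditions P 𝓕) (hS : ∀ x, Continuous fun t => S t x)
    (hS0 : ∀ t x, 0 ≤ x → 0 ≤ S t x) (hy : 0 ≤ y) (hΦ : IsMarginalCost P 𝓕 Φ)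
    (hPi : IsRunningProfit 𝓕 S y Pi) (hJ : ∀ ν ∈ admissible P 𝓕 Φ, payoff P S y q Pi Φ ν < ⊤)
    (hνs : νs ∈ admissible P 𝓕 Φ)
    (hΓ : IsConditionalExpectation P 𝓕 (futureGradient S y q Pi νs) Γ) :
    IsOptimal P 𝓕 S y q Pi Φ νs ↔
      (∀ ν ∈ admissible P 𝓕 Φ,
        extIntegral P (fun ω => dualIntegral (fun s => Γ s ω - Φ s ω) (fun s => ν s ω)) ≤ 0) ∧
      extIntegral P (fun ω => dualIntegral (fun s => Γ s ω - Φ s ω) (fun s => νs s ω)) = 0 := by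
  obtain ⟨Φ', hΦm, hΦ0, hΦe⟩ := hΦ.exists_regular h𝓕
  obtain ⟨νs', hνs', hνse⟩ := hνs.1.exists_regular h𝓕
  obtain ⟨Γ', hΓ', hΓ0, hΓe⟩ := hΓ.exists_regular h𝓕 hνse
  have hΓm := hΓ'.progressive.stronglyMeasurable_uncurry
  -- all functionals of a control are unchanged under indistinguishability
  have hcongr : ∀ {h : Ω → (Horizon T → E) → EReal} {ν ν' : Horizon T → Ω → E},
      (∀ᵐ ω ∂P, ∀ t, ν' t ω = ν t ω) →
      extIntegral P (fun ω => h ω fun s => ν' s ω) = extIntegral P (fun ω => h ω fun s => ν s ω) :=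
    fun hν => extIntegral_congr_ae (hν.mono fun ω hω => by simp only [hω])
  have hadm : ∀ {ν}, IsRegularControl 𝓕 ν →
      (ν ∈ admissible P 𝓕 Φ ↔ expectedCost P Φ' ν ≠ ∞) := fun {ν} hν => by
    rw [admissible, mem_ofPred_eq, hν.extIntegral_dualIntegral hΦ0 hΦe, and_iff_right hν.isControl,
      lt_top_iff_ne_top, Ne, EReal.coe_ennreal_eq_top_iff]
  have hreg : ∀ {ν}, ν ∈ admissible P 𝓕 Φ → ∃ ν', IsRegularControl 𝓕 ν' ∧
      expectedCost P Φ' ν' ≠ ∞ ∧ ∀ᵐ ω ∂P, ∀ t, ν' t ω = ν t ω := fun {ν} hν => by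
    obtain ⟨ν', hν', he⟩ := hν.1.exists_regular h𝓕
    refine ⟨ν', hν', (hadm hν').1 ⟨hν'.isControl, ?_⟩, he⟩
    rw [hcongr (h := fun ω f => dualIntegral (fun s => Φ s ω) f) he]
    exact hν.2
  have hpay : ∀ {ν}, IsRegularControl 𝓕 ν → expectedCost P Φ' ν ≠ ∞ → payoff P S y q Pi Φ ν =
      (expectedProfit P S y q Pi ν : EReal) - (expectedCost P Φ' ν : EReal) := fun hν hb =>
    hν.payoff_eq hPi hS hS0 hy hΦm hΦ0 hΦe hb
  have hprofit : ∀ {ν}, IsRegularControl 𝓕 ν → expectedCost P Φ' ν ≠ ∞ →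
      expectedProfit P S y q Pi ν ≠ ∞ := fun {ν} hν hb htop => by
    have h1 := hJ ν ((hadm hν).2 hb)
    rw [hpay hν hb, htop] at h1
    lift expectedCost P Φ' ν to ℝ≥0 using hb with b
    exact h1.ne rfl
  have hdual : ∀ {ν}, IsRegularControl 𝓕 ν → expectedCost P Φ' ν ≠ ∞ →
      extIntegral P (fun ω => dualIntegral (fun s => Γ s ω - Φ s ω) (fun s => ν s ω)) =
      (marginalGain P S y q Pi νs' ν : EReal) - (expectedCost P Φ' ν : EReal) := fun hν hb => by
    rw [hν.extIntegral_dualIntegral_sub hΦm hΦ0 hΦe hΓm hΓ0 hΓe hb,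
      lintegral_pairing_eq_marginalGain hPi hS hS0 hy hνs' hΓ' hν]
  have hbs : expectedCost P Φ' νs' ≠ ∞ := by
    refine (hadm hνs').1 ⟨hνs'.isControl, ?_⟩
    rw [hcongr (h := fun ω f => dualIntegral (fun s => Φ s ω) f) hνse]
    exact hνs.2
  have has := hprofit hνs' hbs
  have hpayc : ∀ {ν ν' : Horizon T → Ω → E}, (∀ᵐ ω ∂P, ∀ t, ν' t ω = ν t ω) →
      payoff P S y q Pi Φ ν' = payoff P S y q Pi Φ ν := fun he =>
    hcongr (h := fun ω f => ((∫⁻ t, ENNReal.ofReal (Pi ω t (mildPath S y f t)) ∂q : ℝ≥0∞) : EReal)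
      - dualIntegral (fun s => Φ s ω) f) he
  have hdualc : ∀ {ν ν' : Horizon T → Ω → E}, (∀ᵐ ω ∂P, ∀ t, ν' t ω = ν t ω) →
      extIntegral P (fun ω => dualIntegral (fun s => Γ s ω - Φ s ω) (fun s => ν' s ω)) =
      extIntegral P (fun ω => dualIntegral (fun s => Γ s ω - Φ s ω) (fun s => ν s ω)) := fun he =>
    hcongr (h := fun ω f => dualIntegral (fun s => Γ s ω - Φ s ω) f) he
  have key := optimal_iff (P := P) (q := q) hPi hS hS0 hy hΦm hΦ0 hνs' hbs has
  have hopt : IsOptimal P 𝓕 S y q Pi Φ νs ↔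
      ∀ ν, IsRegularControl 𝓕 ν → expectedCost P Φ' ν ≠ ∞ →
        expectedProfit P S y q Pi ν + expectedCost P Φ' νs' ≤
          expectedProfit P S y q Pi νs' + expectedCost P Φ' ν := by
    constructor
    · intro h ν hν hb
      rw [← coe_sub_le_coe_sub_iff (hprofit hν hb) hb has hbs, ← hpay hν hb, ← hpay hνs' hbs,
        hpayc hνse, h.2]
      exact le_iSup₂_of_le ν ((hadm hν).2 hb) le_rfl
    · refine fun h => ⟨hνs, le_antisymm (le_iSup₂_of_le νs hνs le_rfl) (iSup₂_le fun ν hν => ?_)⟩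
      obtain ⟨ν', hν', hb, he⟩ := hreg hν
      rw [← hpayc he, ← hpayc hνse, hpay hν' hb, hpay hνs' hbs,
        coe_sub_le_coe_sub_iff (hprofit hν' hb) hb has hbs]
      exact h ν' hν' hb
  rw [hopt, key, ← hdualc hνse, hdual hνs' hbs, coe_sub_eq_zero_iff hbs]
  refine and_congr_left fun _ => ⟨fun h ν hν => ?_, fun h ν hν hb => ?_⟩
  · obtain ⟨ν', hν', hb, he⟩ := hreg hν
    rw [← hdualc he, hdual hν' hb, coe_sub_nonpos_iff hb]
    exact h ν' hν' hb
  · rw [← coe_sub_nonpos_iff hb, ← hdual hν hb]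
    exact h ν ((hadm hν).2 hb)

end Regularization

end SingularControl

end

theorem theorem3p1
    {D : Type*} [MeasurableSpace D] (μ : Measure D)
    (p : ℝ≥0∞) [Fact (1 ≤ p)] (hp : 1 < p) (hp' : p < ∞)
    (A : Lp ℝ p μ →ₗ.[ℝ] Lp ℝ p μ) (S : ℝ≥0 → Lp ℝ p μ →L[ℝ] Lp ℝ p μ)
    (hA : SingularControl.GeneratesPositiveSemigroup A S)
    (T : ℝ≥0∞)
    {Ω : Type*} [mΩ : MeasurableSpace Ω] (P : Measure Ω) [IsProbabilityMeasure P]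
    (𝓕 : Filtration (SingularControl.Horizon T) mΩ)
    (h𝓕 : SingularControl.UsualConditions P 𝓕)
    (q : Measure (SingularControl.Horizon T)) [IsFiniteMeasure q]
    (y : Lp ℝ p μ) (hy : 0 ≤ y)
    (Φ : SingularControl.Horizon T → Ω → StrongDual ℝ (Lp ℝ p μ))
    (hΦ : SingularControl.IsMarginalCost P 𝓕 Φ)
    (Pi : Ω → SingularControl.Horizon T → Lp ℝ p μ → ℝ)
    (hPi : SingularControl.IsRunningProfit 𝓕 S y Pi)
    (hJ : ∀ ν ∈ SingularControl.admissible P 𝓕 Φ, SingularControl.payoff P S y q Pi Φ ν < ⊤)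
    (νs : SingularControl.Horizon T → Ω → Lp ℝ p μ)
    (hνs : νs ∈ SingularControl.admissible P 𝓕 Φ)
    (Γ : SingularControl.Horizon T → Ω → StrongDual ℝ (Lp ℝ p μ))
    (hΓ : SingularControl.IsConditionalExpectation P 𝓕
      (SingularControl.futureGradient S y q Pi νs) Γ) :
    SingularControl.IsOptimal P 𝓕 S y q Pi Φ νs ↔
      (∀ ν ∈ SingularControl.admissible P 𝓕 Φ,
        SingularControl.extIntegral P (fun ω =>
          SingularControl.dualIntegral (fun s => Γ s ω - Φ s ω) (fun s => ν s ω)) ≤ 0) ∧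
      SingularControl.extIntegral P (fun ω =>
        SingularControl.dualIntegral (fun s => Γ s ω - Φ s ω) (fun s => νs s ω)) = 0 := by
  have := h𝓕.rightContinuous
  have := SingularControl.isOrderedModule_Lp (μ := μ) (p := p)
  have hp1 : 1 < p.toReal := by
    simpa using (ENNReal.toReal_lt_toReal ENNReal.one_ne_top hp'.ne).2 hp
  have : SingularControl.HasPathDensity (Lp ℝ p μ) :=
    ⟨fun hf => hf.exists_isPolar hp1 (SingularControl.midpointConvexityGap_Lp hp hp')⟩
  exact SingularControl.isOptimal_iff h𝓕 hA.continuous hA.nonneg hy hΦ hPi hJ hνs hΓ
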